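/- Let $H$ be a complex Hilbert space, $\omega>0$, and let $\mathcal H=L^2([0,\omega],H)$ carry the inner product $\frac1\omega\int_0^\omega\langle x(s),y(s)\rangle\,ds$. Let $\mathcal V:[0,\omega]\to B(H)$ be such that $s\mapsto\mathcal V(s)x$ belongs to $L^2([0,\omega],H)$ for every $x\in H$, put $\widehat{\mathcal V}(n)x=\frac1\omega\int_0^\omega e^{-2\pi i ns/\omega}\mathcal V(s)x\,ds$, and assume $$\sum_{n\in\mathbb Z}\|\widehat{\mathcal V}(n)\|^2<\infty,\qquad \sum_{j,\ell\in\mathbb Z}\Big\|\sum_{n\ne\ell}\frac{\widehat{\mathcal V}(j+n)\widehat{\mathcal V}(\ell+n)}{\ell-n}\Big\|^2<\infty .$$ Let $L_0=\frac{d}{ds}$ with domain $D(L_0)=\{y\in W_2^1([0,\omega],H): y(0)=y(\omega)\}$, let $(Vy)(s)=\mathcal V(s)y(\omega-s)$, and let $L=L_0-V$ with $D(L)=D(L_0)$. For $\ell\in\mathbb Z$ let $\lambda_\ell=\frac{2\pi i\ell}{\omega}$, and let $P_\ell$, $(P_\ell x)(s)=\widehat x(\ell)e^{\lambda_\ell s}$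 with $\widehat x(\ell)=\frac1\omega\int_0^\omega x(\tau)e^{-\lambda_\ell\tau}d\tau$, be the spectral projections of $L_0$; put $P_{(k)}=\sum_{|\ell|\le k}P_\ell$, $\mathcal H_\ell=\operatorname{Im}P_\ell$, $\mathcal H_{(k)}=\operatorname{Im}P_{(k)}$. Let $\mathfrak S_2(\mathcal H,\mathcal P)$ be the space of all $X\in B(\mathcal H)$ with $\|X\|_{2,\mathcal P}^2=\sum_{j,\ell\in\mathbb Z}\|P_jXP_\ell\|^2<\infty$. Call $(k,U,V_0)$ a *reduction* of $L$ if $k\in\mathbb Z_{\ge0}$; $U\in B(\mathcal H)$ is continuously invertible with $U-I\in\mathfrak S_2(\mathcal H,\mathcal P)$; $V_0\in\mathfrak S_2(\mathcal H,\mathcal P)$; $U D(L_0)=D(L)$ and $LUx=U(L_0-V_0)x$ for $x\in D(L_0)$; and $\mathcal H_{(k)}$ and all $\mathcal H_\ell$ with $|\ell|>k$ are invariant under $V_0$. For a reduction let $\sigma_{(k)}$ be the spectrum of the restriction of $L_0-V_0$ to $\mathcal H_{(k)}$ and, for $|\ell|>k$, let $\Sigma_\ell=\{\lambda_\ell-\mu:\mu\in\sigma(V_0|_{\mathcal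 H_\ell})\}$, the spectrum of the restriction of $L_0-V_0$ to $\mathcal H_\ell$. Call the reduction *separated* if the sets $\sigma_{(k)}$ and $\Sigma_\ell$, $|\ell|>k$, are pairwise disjoint. For a separated reduction let $\widetilde P_{(k)}=P(\sigma_{(k)},L)$ and $\widetilde P_\ell=P(\Sigma_\ell,L)$, $|\ell|>k$, be the Riesz spectral projections of $L$; that is, $P(\sigma,L)=\frac1{2\pi i}\oint_\Gamma(z-L)^{-1}dz$, where the contour $\Gamma$ lies in the resolvent set of $L$, winds once around each point of $\sigma$, and has winding number $0$ about each point of $\sigma(L)\setminus\sigma$. **Theorem.** There is a separated reduction $(k,U,V_0)$ of $L$ for which such contours, and hence the projections $\widetilde P_{(k)}$ and $\widetilde P_\ell$, $|\ell|>k$, exist. For every separated reduction $(k,U,V_0)$ of $L$ and its Riesz projections, the operators $\widetilde P_{(k)}+\sum_{k<|\ell|\le n}\widetilde P_\ell-P_{(k)}-\sum_{k<|\ell|\le n}P_\ell$, $n\ge0$, belong to $\mathfrak S_2(\mathcal H,\mathcal P)$, and $$\lim_{n\to\infty}\Big\|\widetilde P_{(k)}+\sum_{k<|\ell|\le n}\widetilde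 P_\ell-P_{(k)}-\sum_{k<|\ell|\le n}P_\ell\Big\|_{2,\mathcal P}=0 .$$ -/

import Mathlib

open MeasureTheory Filter Topology

noncomputable section

namespace InvolutionOperator

/-! ### The space `L²([0, ω], H)` with the normalised inner product `(1/ω) ∫₀^ω ⟨x(s), y(s)⟩ ds` -/

/-- The measure `(1/ω) ds` on `[0, ω]`. -/
def muI (ω : ℝ) : Measure ℝ := ENNReal.ofReal ω⁻¹ • volume.restrict (Set.Icc 0 ω)

instance (ω : ℝ) : IsFiniteMeasure (muI ω) :=
  ⟨by simp [muI, ENNReal.mul_lt_top]⟩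

/-- The Hilbert space `L²([0, ω], H)`. -/
abbrev L2 (ω : ℝ) (H : Type*) [NormedAddCommGroup H] : Type _ := Lp H 2 (muI ω)

/-- The eigenvalue `λ_ℓ = 2πiℓ/ω` of `d/ds` with periodic boundary conditions. -/
def lam (ω : ℝ) (l : ℤ) : ℂ := Complex.I * ((2 * Real.pi * l / ω : ℝ) : ℂ)

section Basic

variable {H : Type*} [NormedAddCommGroup H] [InnerProductSpace ℂ H] [CompleteSpace H]

theorem norm_exp_lam (ω : ℝ) (l : ℤ) (s : ℝ) : ‖Complex.exp (lam ω l * s)‖ = 1 := by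
  have : lam ω l * s = ((2 * Real.pi * l / ω * s : ℝ) : ℂ) * Complex.I := by
    simp [lam]; ring
  rw [this, Complex.norm_exp_ofReal_mul_I]

theorem norm_exp_neg_lam (ω : ℝ) (l : ℤ) (s : ℝ) : ‖Complex.exp (-(lam ω l * s))‖ = 1 := by
  rw [Complex.exp_neg, norm_inv, norm_exp_lam, inv_one]

theorem continuous_exp_lam (ω : ℝ) (l : ℤ) :
    Continuous fun s : ℝ => Complex.exp (lam ω l * s) := by fun_prop

theorem continuous_exp_neg_lam (ω : ℝ) (l : ℤ) :
    Continuous fun s : ℝ => Complex.exp (-(lam ω l * s)) := by fun_prop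

theorem integrable_of_memLp {ω : ℝ} {x : ℝ → H} (hx : MemLp x 2 (muI ω)) :
    Integrable x (muI ω) := hx.integrable (by norm_num)

theorem integrable_exp_smul {ω : ℝ} {x : ℝ → H} (hx : Integrable x (muI ω)) (l : ℤ) :
    Integrable (fun s : ℝ => Complex.exp (-(lam ω l * s)) • x s) (muI ω) :=
  hx.bdd_smul 1 (continuous_exp_neg_lam ω l).aestronglyMeasurable
    (Eventually.of_forall fun s => (norm_exp_neg_lam ω l s).le)

/-- The Fourier coefficient `x ↦ x̂(ℓ) = (1/ω) ∫₀^ω e^{-2πiℓτ/ω} x(τ) dτ`. -/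
def coeffL (ω : ℝ) (H : Type*) [NormedAddCommGroup H] [InnerProductSpace ℂ H] [CompleteSpace H]
    (l : ℤ) : L2 ω H →L[ℂ] H :=
  LinearMap.mkContinuous
    { toFun := fun x => ∫ s, Complex.exp (-(lam ω l * s)) • x s ∂(muI ω)
      map_add' := fun x y => by
        rw [← integral_add (integrable_exp_smul (integrable_of_memLp (Lp.memLp x)) l)
          (integrable_exp_smul (integrable_of_memLp (Lp.memLp y)) l)]
        refine integral_congr_ae ?_
        filter_upwards [Lp.coeFn_add x y] with s hs
        rw [hs, Pi.add_apply, smul_add]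
      map_smul' := fun c x => by
        rw [RingHom.id_apply, ← integral_smul]
        refine integral_congr_ae ?_
        filter_upwards [Lp.coeFn_smul c x] with s hs
        rw [hs, Pi.smul_apply, smul_comm] }
    ((muI ω Set.univ).toReal ^ (1 / 2 : ℝ))
    (fun x => by
      have h1 : ‖∫ s, Complex.exp (-(lam ω l * s)) • x s ∂(muI ω)‖ ≤ ∫ s, ‖x s‖ ∂(muI ω) := by
        refine (norm_integral_le_integral_norm _).trans (le_of_eq ?_)
        refine integral_congr_ae (Eventually.of_forall fun s => ?_)
        simp only [norm_smul, norm_exp_neg_lam, one_mul]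
      refine h1.trans ?_
      have h2 : eLpNorm x 1 (muI ω) ≤ eLpNorm x 2 (muI ω) * (muI ω) Set.univ ^ (1 / 2 : ℝ) := by
        have := eLpNorm_le_eLpNorm_mul_rpow_measure_univ (μ := muI ω) (p := 1) (q := 2)
          (f := x) (by norm_num) (Lp.aestronglyMeasurable x)
        refine this.trans (le_of_eq ?_)
        norm_num
      have h3 : ∫ s, ‖x s‖ ∂(muI ω) = (eLpNorm x 1 (muI ω)).toReal := by
        rw [integral_norm_eq_lintegral_enorm (Lp.aestronglyMeasurable x),
          eLpNorm_one_eq_lintegral_enorm]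
      rw [h3, Lp.norm_def, mul_comm, ENNReal.toReal_rpow, ← ENNReal.toReal_mul]
      refine ENNReal.toReal_mono ?_ h2
      exact ENNReal.mul_ne_top (Lp.eLpNorm_ne_top x)
        (ENNReal.rpow_ne_top_of_nonneg (by norm_num) (measure_ne_top _ _)))

theorem memLp_mode (ω : ℝ) (l : ℤ) (h : H) :
    MemLp (fun s : ℝ => Complex.exp (lam ω l * s) • h) 2 (muI ω) :=
  MemLp.of_bound ((continuous_exp_lam ω l).smul continuous_const).aestronglyMeasurable ‖h‖
    (Eventually.of_forall fun s => by simp [norm_smul, norm_exp_lam])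

/-- The mode `h ↦ (s ↦ e^{2πiℓs/ω} h)`. -/
def modeL (ω : ℝ) (H : Type*) [NormedAddCommGroup H] [InnerProductSpace ℂ H] [CompleteSpace H]
    (l : ℤ) : H →L[ℂ] L2 ω H :=
  LinearMap.mkContinuous
    { toFun := fun h => (memLp_mode ω l h).toLp _
      map_add' := fun x y => by
        rw [← MemLp.toLp_add]
        exact MemLp.toLp_congr _ _ (Eventually.of_forall fun s => by simp)
      map_smul' := fun c x => by
        rw [RingHom.id_apply, ← MemLp.toLp_const_smul]
        exact MemLp.toLp_congr _ _ (Eventually.of_forall fun s => by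
          simp only [Pi.smul_apply]; rw [smul_comm]) }
    ((muI ω Set.univ).toReal ^ (1 / 2 : ℝ))
    (fun h => by
      have hb := Lp.norm_le_of_ae_bound (f := (memLp_mode ω l h).toLp _) (norm_nonneg h) (by
        filter_upwards [(memLp_mode ω l h).coeFn_toLp] with s hs
        rw [hs]; simp [norm_smul, norm_exp_lam])
      refine hb.trans (le_of_eq ?_)
      rw [measureUnivNNReal, ENNReal.coe_toNNReal_eq_toReal]
      norm_num)

/-- The spectral projection `P_ℓ` of `d/ds`: `(P_ℓ x)(s) = x̂(ℓ) e^{2πiℓs/ω}`. -/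
def proj (ω : ℝ) (H : Type*) [NormedAddCommGroup H] [InnerProductSpace ℂ H] [CompleteSpace H]
    (l : ℤ) : L2 ω H →L[ℂ] L2 ω H := modeL ω H l ∘L coeffL ω H l

/-- `P_(k) = ∑_{|ℓ| ≤ k} P_ℓ`. -/
def projLow (ω : ℝ) (H : Type*) [NormedAddCommGroup H] [InnerProductSpace ℂ H] [CompleteSpace H]
    (k : ℕ) : L2 ω H →L[ℂ] L2 ω H := ∑ l ∈ Finset.Icc (-(k : ℤ)) k, proj ω H l

theorem muI_eq_zero {ω : ℝ} (hω : ω ≤ 0) : muI ω = 0 := by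
  simp [muI, ENNReal.ofReal_eq_zero.2 (inv_nonpos.2 hω)]

theorem L2_eq_zero {ω : ℝ} (hω : ω ≤ 0) (x : L2 ω H) : x = 0 := by
  have hbot : ae (muI ω) = ⊥ := by rw [muI_eq_zero hω, ae_zero]
  refine Lp.ext ?_
  rw [hbot]
  exact Filter.eventually_bot

theorem coeffL_modeL {ω : ℝ} (hω : 0 < ω) (j l : ℤ) (h : H) :
    coeffL ω H j (modeL ω H l h) = if j = l then h else 0 := by
  have h1 : coeffL ω H j (modeL ω H l h) =
      ∫ s, Complex.exp ((lam ω l - lam ω j) * s) • h ∂(muI ω) := by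
    refine integral_congr_ae ?_
    filter_upwards [(memLp_mode ω l h).coeFn_toLp] with s hs
    have hs' : (modeL ω H l h) s = Complex.exp (lam ω l * s) • h := hs
    change Complex.exp (-(lam ω j * s)) • (modeL ω H l h) s = _
    rw [hs', smul_smul, ← Complex.exp_add]
    congr 2; ring
  have h2 : ∫ s : ℝ, Complex.exp ((lam ω l - lam ω j) * s) ∂(muI ω) = if j = l then 1 else 0 := by
    rw [muI, integral_smul_measure, integral_Icc_eq_integral_Ioc,
      ← intervalIntegral.integral_of_le hω.le, ENNReal.toReal_ofReal (inv_nonneg.2 hω.le)]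
    split_ifs with hjl
    · subst hjl
      simp [hω.ne']
    · have hω' : (ω : ℂ) ≠ 0 := by exact_mod_cast hω.ne'
      have hc : lam ω l - lam ω j = ((l - j : ℤ) : ℂ) * (2 * Real.pi * Complex.I) / ω := by
        simp only [lam]; push_cast; field_simp
      have hne : lam ω l - lam ω j ≠ 0 := by
        rw [hc]
        refine div_ne_zero (mul_ne_zero ?_ Complex.two_pi_I_ne_zero) hω'
        exact_mod_cast sub_ne_zero.2 (Ne.symm hjl)
      rw [integral_exp_mul_complex hne]
      have : (lam ω l - lam ω j) * (ω : ℂ) = ((l - j : ℤ) : ℂ) * (2 * Real.pi * Complex.I) := by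
        rw [hc]; field_simp
      rw [this, Complex.exp_int_mul_two_pi_mul_I]
      simp
  rw [h1, integral_smul_const, h2]
  split_ifs <;> simp

theorem proj_proj {ω : ℝ} (hω : 0 < ω) (j l : ℤ) (x : L2 ω H) :
    proj ω H j (proj ω H l x) = if j = l then proj ω H l x else 0 := by
  simp only [proj, ContinuousLinearMap.comp_apply]
  rw [coeffL_modeL hω]
  split_ifs with h
  · rw [h]
  · rw [map_zero]

/-- `∑_{|ℓ| ≤ k} λ_ℓ P_ℓ`: on `Im P_(k)` this is the operator `d/ds`. -/
def diagLow (ω : ℝ) (H : Type*) [NormedAddCommGroup H] [InnerProductSpace ℂ H] [CompleteSpace H]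
    (k : ℕ) : L2 ω H →L[ℂ] L2 ω H := ∑ l ∈ Finset.Icc (-(k : ℤ)) k, lam ω l • proj ω H l

theorem diagLow_mem (ω : ℝ) (k : ℕ) (x : L2 ω H) : diagLow ω H k x ∈ (projLow ω H k).range := by
  rcases le_or_gt ω 0 with hω | hω
  · rw [L2_eq_zero hω (diagLow ω H k x)]
    exact Submodule.zero_mem _
  · refine ⟨diagLow ω H k x, ?_⟩
    change projLow ω H k (diagLow ω H k x) = _
    simp only [projLow, diagLow, sum_apply, smul_apply, map_sum, map_smul, proj_proj hω]
    refine Finset.sum_congr rfl fun l hl => ?_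
    rw [Finset.sum_ite_eq' (Finset.Icc (-(k : ℤ)) k) l, if_pos hl]

/-! ### The Hilbert-Schmidt class relative to the resolution of the identity `(P_ℓ)` -/

/-- `X ∈ 𝔖₂(𝓗, 𝒫)`, that is `∑_{j,ℓ} ‖P_j X P_ℓ‖² < ∞`. -/
def MemHS {ω : ℝ} (X : L2 ω H →L[ℂ] L2 ω H) : Prop :=
  Summable fun p : ℤ × ℤ => ‖proj ω H p.1 ∘L X ∘L proj ω H p.2‖ ^ 2

/-- `‖X‖_{2,𝒫} = (∑_{j,ℓ} ‖P_j X P_ℓ‖²)^{1/2}`; meaningful for `X` with `MemHS X`. -/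
def hsNorm {ω : ℝ} (X : L2 ω H →L[ℂ] L2 ω H) : ℝ :=
  Real.sqrt (∑' p : ℤ × ℤ, ‖proj ω H p.1 ∘L X ∘L proj ω H p.2‖ ^ 2)

end Basic

/-! ### The potential -/

/-- An operator-valued potential `𝒱 : [0, ω] → B(H)` such that `s ↦ 𝒱(s)x` is (strongly measurable
and) square integrable for each `x ∈ H`. -/
structure Potential (ω : ℝ) (H : Type*) [NormedAddCommGroup H] [InnerProductSpace ℂ H] where
  /-- The operator `𝒱(s)`; only the values at `s ∈ [0, ω]` matter. -/
  toFun : ℝ → H →L[ℂ] H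
  memLp : ∀ x : H, MemLp (fun s => toFun s x) 2 (muI ω)

namespace Potential

variable {ω : ℝ} {H : Type*} [NormedAddCommGroup H] [InnerProductSpace ℂ H] [CompleteSpace H]

/-- The linear map `x ↦ 𝒱(·)x` from `H` to `L²`. -/
def evalLin (V : Potential ω H) : H →ₗ[ℂ] L2 ω H where
  toFun x := (V.memLp x).toLp _
  map_add' x y := by
    rw [← MemLp.toLp_add]
    exact MemLp.toLp_congr _ _ (Eventually.of_forall fun s => by simp)
  map_smul' c x := by
    rw [RingHom.id_apply, ← MemLp.toLp_const_smul]
    exact MemLp.toLp_congr _ _ (Eventually.of_forall fun s => by simp)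

theorem evalLin_closed (V : Potential ω H) (u : ℕ → H) (x : H) (y : L2 ω H)
    (hu : Tendsto u atTop (𝓝 x)) (hy : Tendsto (V.evalLin ∘ u) atTop (𝓝 y)) :
    y = V.evalLin x := by
  have hm := tendstoInMeasure_of_tendsto_Lp hy
  obtain ⟨ns, hns, hae⟩ := hm.exists_seq_tendsto_ae
  refine Lp.ext ?_
  have hall : ∀ᵐ s ∂(muI ω), ∀ n, (V.evalLin (u n)) s = V.toFun s (u n) :=
    ae_all_iff.2 fun n => (V.memLp (u n)).coeFn_toLp
  filter_upwards [hae, hall, (V.memLp x).coeFn_toLp] with s h1 h2 h3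
  have h4 : Tendsto (fun i => V.toFun s (u (ns i))) atTop (𝓝 (V.toFun s x)) :=
    ((V.toFun s).continuous.tendsto x).comp (hu.comp hns.tendsto_atTop)
  have h5 : Tendsto (fun i => V.toFun s (u (ns i))) atTop (𝓝 (y s)) := by
    simpa [Function.comp, h2] using h1
  exact (tendsto_nhds_unique h5 h4).trans h3.symm

/-- The bounded operator `x ↦ 𝒱(·)x` from `H` to `L²`. -/
def evalL (V : Potential ω H) : H →L[ℂ] L2 ω H :=
  ContinuousLinearMap.ofSeqClosedGraph (g := V.evalLin) (fun u x y => V.evalLin_closed u x y)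

/-- The Fourier coefficient `𝒱̂(n) ∈ B(H)`, `𝒱̂(n)x = (1/ω) ∫₀^ω e^{-2πins/ω} 𝒱(s)x ds`. -/
def coeff (V : Potential ω H) (n : ℤ) : H →L[ℂ] H := coeffL ω H n ∘L V.evalL

theorem coeff_apply (V : Potential ω H) (n : ℤ) (x : H) :
    V.coeff n x = ∫ s, Complex.exp (-(lam ω n * s)) • V.toFun s x ∂(muI ω) := by
  refine integral_congr_ae ?_
  filter_upwards [(V.memLp x).coeFn_toLp] with s hs
  exact congrArg _ hs

/-- The standing assumptions on the potential: `∑ₙ ‖𝒱̂(n)‖² < ∞` and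
`∑_{j,ℓ} ‖∑_{n ≠ ℓ} 𝒱̂(j+n) 𝒱̂(ℓ+n) / (ℓ-n)‖² < ∞`. Under the first one, the inner series
converges absolutely in `B(H)`. (The term with `n = ℓ` vanishes, as `0⁻¹ = 0`.) -/
structure Admissible (V : Potential ω H) : Prop where
  summable_sq : Summable fun n : ℤ => ‖V.coeff n‖ ^ 2
  summable_double : Summable fun p : ℤ × ℤ =>
    ‖∑' n : ℤ, (((p.2 - n : ℤ) : ℂ))⁻¹ • (V.coeff (p.1 + n) ∘L V.coeff (p.2 + n))‖ ^ 2

end Potential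

/-! ### The unbounded operators -/

section Unbounded

variable {ω : ℝ} {H : Type*} [NormedAddCommGroup H] [InnerProductSpace ℂ H] [CompleteSpace H]

theorem ae_restrict_of_ae_muI {p : ℝ → Prop} (hω : 0 < ω) (h : ∀ᵐ s ∂(muI ω), p s) :
    ∀ᵐ s ∂(volume.restrict (Set.Icc 0 ω)), p s := by
  rw [muI, Measure.ae_ennreal_smul_measure_iff (by simpa using hω)] at h
  exact h

theorem intervalIntegrable_L2 (x : L2 ω H) {s : ℝ} (hs : s ∈ Set.Icc 0 ω) :
    IntervalIntegrable x volume 0 s := by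
  rcases hs.1.eq_or_lt with h | h
  · rw [← h]
  have hω : 0 < ω := h.trans_le hs.2
  have h1 : Integrable x (muI ω) := integrable_of_memLp (Lp.memLp x)
  have h2 : Integrable x (volume.restrict (Set.Icc 0 ω)) :=
    (integrable_smul_measure (by simpa using hω) (by simp)).1 h1
  rw [intervalIntegrable_iff, Set.uIoc_of_le hs.1]
  exact IntegrableOn.mono_set h2 fun t ht => ⟨ht.1.le, ht.2.trans hs.2⟩

theorem intervalIntegral_congr_L2 {f g : ℝ → H} (hfg : f =ᵐ[muI ω] g) {s : ℝ}
    (hs : s ∈ Set.Icc 0 ω) : ∫ t in (0 : ℝ)..s, f t = ∫ t in (0 : ℝ)..s, g t := by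
  rcases hs.1.eq_or_lt with h | h
  · rw [← h]; simp
  have hω : 0 < ω := h.trans_le hs.2
  have h1 := (ae_restrict_iff' measurableSet_Icc).1 (ae_restrict_of_ae_muI hω hfg)
  refine intervalIntegral.integral_congr_ae ?_
  filter_upwards [h1] with t ht ht'
  rw [Set.uIoc_of_le hs.1] at ht'
  exact ht ⟨ht'.1.le, ht'.2.trans hs.2⟩

/-- The graph of `L₀ = d/ds` with domain `{y ∈ W₂¹([0, ω], H) : y(0) = y(ω)}`: a pair `(y, g)`
belongs to it iff `y` has a representative `f` that is the absolutely continuous primitive of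
`g ∈ L²` on `[0, ω]` and satisfies `f(0) = f(ω)`. -/
def derivGraph (ω : ℝ) (H : Type*) [NormedAddCommGroup H] [InnerProductSpace ℂ H]
    [CompleteSpace H] : Submodule ℂ (L2 ω H × L2 ω H) where
  carrier := {p | ∃ f : ℝ → H, p.1 =ᵐ[muI ω] f ∧
    (∀ s ∈ Set.Icc 0 ω, f s = f 0 + ∫ t in (0 : ℝ)..s, p.2 t) ∧ f 0 = f ω}
  zero_mem' := by
    refine ⟨0, Lp.coeFn_zero _ _ _, fun s hs => ?_, rfl⟩
    have := intervalIntegral_congr_L2 (Lp.coeFn_zero H 2 (muI ω)) hs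
    simp only [Pi.zero_apply, intervalIntegral.integral_zero] at this
    simp only [Pi.zero_apply, zero_add]
    exact this.symm
  add_mem' := by
    rintro ⟨y, g⟩ ⟨y', g'⟩ ⟨f, h1, h2, h3⟩ ⟨f', h1', h2', h3'⟩
    refine ⟨f + f', (Lp.coeFn_add y y').trans (h1.add h1'), fun s hs => ?_, ?_⟩
    · have := intervalIntegral_congr_L2 (Lp.coeFn_add g g') hs
      simp only [Pi.add_apply] at this
      rw [intervalIntegral.integral_add (intervalIntegrable_L2 g hs)
        (intervalIntegrable_L2 g' hs)] at this
      simp only [Pi.add_apply, Prod.mk_add_mk]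
      rw [this, h2 s hs, h2' s hs]
      abel
    · simp only [Pi.add_apply, h3, h3']
  smul_mem' := by
    rintro c ⟨y, g⟩ ⟨f, h1, h2, h3⟩
    refine ⟨c • f, (Lp.coeFn_smul c y).trans (h1.const_smul c), fun s hs => ?_, ?_⟩
    · have := intervalIntegral_congr_L2 (Lp.coeFn_smul c g) hs
      simp only [Pi.smul_apply] at this
      rw [intervalIntegral.integral_smul] at this
      simp only [Pi.smul_apply, Prod.smul_mk]
      rw [this, h2 s hs, smul_add]
    · simp only [Pi.smul_apply, h3]

/-- The operator `L₀ = d/ds` with periodic boundary conditions. -/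
def opL0 (ω : ℝ) (H : Type*) [NormedAddCommGroup H] [InnerProductSpace ℂ H] [CompleteSpace H] :
    L2 ω H →ₗ.[ℂ] L2 ω H := (derivGraph ω H).toLinearPMap

theorem ae_reflect {p : ℝ → Prop} (h : ∀ᵐ s ∂(muI ω), p s) : ∀ᵐ s ∂(muI ω), p (ω - s) := by
  have hmp : MeasurePreserving (fun s : ℝ => ω - s) volume volume :=
    Measure.measurePreserving_sub_left volume ω
  rcases le_or_gt ω 0 with hω | hω
  · have : muI ω = 0 := muI_eq_zero hω
    simp [this]
  · have h1 := (ae_restrict_iff' measurableSet_Icc).1 (ae_restrict_of_ae_muI hω h)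
    have h2 := hmp.quasiMeasurePreserving.ae h1
    rw [muI]
    refine Measure.ae_smul_measure ?_ _
    refine (ae_restrict_iff' measurableSet_Icc).2 ?_
    filter_upwards [h2] with s hs hs'
    exact hs ⟨by linarith [hs'.2], by linarith [hs'.1]⟩

/-- The graph of the operator `V`, `(Vy)(s) = 𝒱(s) y(ω - s)`. -/
def Potential.graph (V : Potential ω H) : Submodule ℂ (L2 ω H × L2 ω H) where
  carrier := {p | p.2 =ᵐ[muI ω] fun s => V.toFun s (p.1 (ω - s))}
  zero_mem' := by
    have h := ae_reflect (Lp.coeFn_zero H 2 (muI ω))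
    change ((0 : L2 ω H) : ℝ → H) =ᵐ[muI ω] _
    filter_upwards [Lp.coeFn_zero H 2 (muI ω), h] with s h1 h2
    simp only [Prod.fst_zero]
    rw [h1, h2]; simp
  add_mem' := by
    rintro ⟨y, z⟩ ⟨y', z'⟩ h h'
    have h0 := ae_reflect (Lp.coeFn_add y y')
    change ((z + z' : L2 ω H) : ℝ → H) =ᵐ[muI ω] _
    filter_upwards [Lp.coeFn_add z z', h0, h, h'] with s h1 h2 h3 h4
    simp only [Prod.mk_add_mk]
    rw [h1, h2, Pi.add_apply, Pi.add_apply, map_add, h3, h4]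
  smul_mem' := by
    rintro c ⟨y, z⟩ h
    have h0 := ae_reflect (Lp.coeFn_smul c y)
    change ((c • z : L2 ω H) : ℝ → H) =ᵐ[muI ω] _
    filter_upwards [Lp.coeFn_smul c z, h0, h] with s h1 h2 h3
    simp only [Prod.smul_mk]
    rw [h1, h2, Pi.smul_apply, Pi.smul_apply, map_smul, h3]

/-- The operator `V`, `(Vy)(s) = 𝒱(s) y(ω - s)`, with its maximal domain. -/
def Potential.op (V : Potential ω H) : L2 ω H →ₗ.[ℂ] L2 ω H := V.graph.toLinearPMap

/-- The operator `L = L₀ - V`, `(Ly)(s) = y'(s) - 𝒱(s) y(ω - s)`, with periodic boundary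
conditions. Its domain `D(L₀) ∩ D(V)` is `D(L₀)` as soon as `∑ₙ ‖𝒱̂(n)‖² < ∞`. -/
def opL (V : Potential ω H) : L2 ω H →ₗ.[ℂ] L2 ω H := opL0 ω H - V.op

theorem derivGraph_functional (p : L2 ω H × L2 ω H) (hp : p ∈ derivGraph ω H) (h0 : p.1 = 0) :
    p.2 = 0 := by
  obtain ⟨f, h1, h2, -⟩ := hp
  rcases le_or_gt ω 0 with hω | hω
  · exact L2_eq_zero hω _
  have hint := intervalIntegrable_L2 p.2 (s := ω) ⟨hω.le, le_rfl⟩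
  have hcont : ContinuousOn f (Set.Icc 0 ω) := by
    have hc := intervalIntegral.continuousOn_primitive_interval' hint Set.left_mem_uIcc
    rw [Set.uIcc_of_le hω.le] at hc
    exact (continuousOn_const.add hc).congr h2
  have hf0 : f =ᵐ[volume.restrict (Set.Icc 0 ω)] fun _ => (0 : H) := by
    have h3 : p.1 =ᵐ[muI ω] fun _ => (0 : H) := by rw [h0]; exact Lp.coeFn_zero _ _ _
    exact ae_restrict_of_ae_muI hω (h1.symm.trans h3)
  have hf := Measure.eqOn_Icc_of_ae_eq volume hω.ne hf0 hcont continuousOn_const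
  have hprim : ∀ s ∈ Set.Icc 0 ω, ∫ t in (0 : ℝ)..s, p.2 t = 0 := fun s hs => by
    have := h2 s hs
    rw [hf hs, hf ⟨le_rfl, hω.le⟩, zero_add] at this
    exact this.symm
  have hd := hint.ae_hasDerivAt_integral
  rw [Set.uIcc_of_le hω.le] at hd
  refine Lp.ext ?_
  have hae : ∀ᵐ s ∂(muI ω), p.2 s = 0 := by
    suffices h : ∀ᵐ s ∂(volume.restrict (Set.Icc 0 ω)), p.2 s = 0 from
      Measure.ae_smul_measure h _
    rw [Measure.restrict_congr_set Ioo_ae_eq_Icc.symm]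
    refine (ae_restrict_iff' measurableSet_Ioo).2 ?_
    filter_upwards [hd] with s hs hs'
    have hs1 := hs (Set.Ioo_subset_Icc_self hs') 0 ⟨le_rfl, hω.le⟩
    have hs2 : HasDerivAt (fun x => ∫ t in (0 : ℝ)..x, p.2 t) 0 s := by
      refine (hasDerivAt_const s (0 : H)).congr_of_eventuallyEq ?_
      filter_upwards [Ioo_mem_nhds hs'.1 hs'.2] with x hx
      exact hprim x (Set.Ioo_subset_Icc_self hx)
    exact hs1.unique hs2
  filter_upwards [hae, Lp.coeFn_zero H 2 (muI ω)] with s h3 h4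
  rw [h3, h4]; rfl

theorem opL0_graph : (opL0 ω H).graph = derivGraph ω H :=
  Submodule.toLinearPMap_graph_eq _ fun p hp h => derivGraph_functional p hp h

theorem Potential.op_graph (V : Potential ω H) : V.op.graph = V.graph := by
  refine Submodule.toLinearPMap_graph_eq _ fun p hp h => ?_
  refine Lp.ext ?_
  have h2 := ae_reflect (Lp.coeFn_zero H 2 (muI ω))
  have hp' : p.2 =ᵐ[muI ω] fun s => V.toFun s (p.1 (ω - s)) := hp
  rw [h] at hp'
  filter_upwards [hp', h2, Lp.coeFn_zero H 2 (muI ω)] with s h3 h4 h5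
  rw [h3, h4, h5]; simp

end Unbounded

/-! ### Resolvents, contours and Riesz projections of unbounded operators -/

section Riesz

variable {E : Type*} [NormedAddCommGroup E] [NormedSpace ℂ E]

/-- `R` is the bounded inverse of `z - T`. -/
def IsResolventAt (T : E →ₗ.[ℂ] E) (z : ℂ) (R : E →L[ℂ] E) : Prop :=
  (∀ x : E, ∃ h : R x ∈ T.domain, z • R x - T ⟨R x, h⟩ = x) ∧
    ∀ y : T.domain, R (z • (y : E) - T y) = y

/-- The resolvent set of an unbounded operator. -/
def resSet (T : E →ₗ.[ℂ] E) : Set ℂ := {z | ∃ R : E →L[ℂ] E, IsResolventAt T z R}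

/-- The spectrum of an unbounded operator. -/
def spec (T : E →ₗ.[ℂ] E) : Set ℂ := (resSet T)ᶜ

open Classical in
/-- The resolvent `(z - T)⁻¹` for `z` in the resolvent set. -/
def res (T : E →ₗ.[ℂ] E) (z : ℂ) : E →L[ℂ] E :=
  if h : ∃ R : E →L[ℂ] E, IsResolventAt T z R then h.choose else 0

theorem IsResolventAt.unique {T : E →ₗ.[ℂ] E} {z : ℂ} {R R' : E →L[ℂ] E}
    (h : IsResolventAt T z R) (h' : IsResolventAt T z R') : R = R' := by
  ext x
  obtain ⟨hx, hx'⟩ := h.1 x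
  have := h'.2 ⟨R x, hx⟩
  simp only [hx'] at this
  exact this.symm

/-- A contour: finitely many closed `C¹` curves `[0, 1] → ℂ`. (Velocities may vanish, so this
covers piecewise `C¹` curves, after reparametrisation.) -/
structure Contour where
  num : ℕ
  curve : Fin num → ℝ → ℂ
  smooth : ∀ i, ContDiff ℝ 1 (curve i)
  closed : ∀ i, curve i 0 = curve i 1

/-- The set of points on the contour. -/
def Contour.support (c : Contour) : Set ℂ := ⋃ i, c.curve i '' Set.Icc 0 1

/-- The contour integral `∮_c f(z) dz`. -/
def Contour.integral {F : Type*} [NormedAddCommGroup F] [NormedSpace ℂ F] (c : Contour)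
    (f : ℂ → F) : F :=
  ∑ i, ∫ t in (0 : ℝ)..1, deriv (c.curve i) t • f (c.curve i t)

/-- The winding number of the contour about `w`. -/
def Contour.winding (c : Contour) (w : ℂ) : ℂ :=
  (2 * Real.pi * Complex.I)⁻¹ * c.integral fun z => (z - w)⁻¹

/-- `Q` is the Riesz (spectral) projection `P(σ, T)` of `T` corresponding to the part `σ` of its
spectrum: `Q = (1/2πi) ∮_c (z - T)⁻¹ dz`, where the contour `c` lies in the resolvent set, winds
once around each point of `σ` and does not wind around the rest of the spectrum. -/
def IsRieszProjection (T : E →ₗ.[ℂ] E) (σ : Set ℂ) (Q : E →L[ℂ] E) : Prop :=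
  ∃ c : Contour, c.support ⊆ resSet T ∧ (∀ w ∈ σ, c.winding w = 1) ∧
    (∀ w ∈ spec T \ σ, c.winding w = 0) ∧
    Q = (2 * Real.pi * Complex.I : ℂ)⁻¹ • c.integral (res T)

/-- `U` is a similarity transform of `A₁` into `A₂`: `U D(A₂) = D(A₁)` and `A₁ U x = U A₂ x` for
all `x ∈ D(A₂)`. -/
def IsSimilarityTransform (A₁ A₂ : E →ₗ.[ℂ] E) (U : E ≃L[ℂ] E) : Prop :=
  U '' (A₂.domain : Set E) = (A₁.domain : Set E) ∧
    ∀ (x : A₂.domain) (h : U x ∈ A₁.domain), A₁ ⟨U x, h⟩ = U (A₂ x)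

/-- The restriction of a bounded operator to an invariant subspace. -/
def restrictTo (X : E →L[ℂ] E) (K : Submodule ℂ E) (h : ∀ x ∈ K, X x ∈ K) : K →L[ℂ] K :=
  (X ∘L K.subtypeL).codRestrict K fun x => h x x.2

end Riesz

/-! ### The similarity of `L` to a block diagonal operator -/

section Similarity

variable {ω : ℝ} {H : Type*} [NormedAddCommGroup H] [InnerProductSpace ℂ H] [CompleteSpace H]

/-- `(k, U, V₀)` reduces `L` to block diagonal form: `U = I + W` is continuously invertible with
`W ∈ 𝔖₂(𝓗, 𝒫)`, `V₀ ∈ 𝔖₂(𝓗, 𝒫)`, `U` is a similarity transform of `L` into `L₀ - V₀`, and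
`𝓗_(k) = Im P_(k)` and `𝓗_ℓ = Im P_ℓ`, `|ℓ| > k`, are invariant for `V₀`. -/
structure Reduction (V : Potential ω H) (k : ℕ) (U : L2 ω H ≃L[ℂ] L2 ω H)
    (V₀ : L2 ω H →L[ℂ] L2 ω H) : Prop where
  memHS_W : MemHS ((U : L2 ω H →L[ℂ] L2 ω H) - ContinuousLinearMap.id ℂ (L2 ω H))
  memHS_V₀ : MemHS V₀
  similar : IsSimilarityTransform (opL V)
    (opL0 ω H - (V₀ : L2 ω H →ₗ[ℂ] L2 ω H).toPMap ⊤) U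
  invariant_low : ∀ x ∈ (projLow ω H k).range, V₀ x ∈ (projLow ω H k).range
  invariant : ∀ l : ℤ, (k : ℤ) < |l| → ∀ x ∈ (proj ω H l).range, V₀ x ∈ (proj ω H l).range

namespace Reduction

variable {V : Potential ω H} {k : ℕ} {U : L2 ω H ≃L[ℂ] L2 ω H} {V₀ : L2 ω H →L[ℂ] L2 ω H}

/-- `σ_(k)`: the spectrum of the restriction of `L₀ - V₀` to `𝓗_(k)`. -/
def sigmaLow (hR : Reduction V k U V₀) : Set ℂ :=
  spectrum ℂ (restrictTo (diagLow ω H k - V₀) (projLow ω H k).range fun x hx =>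
    Submodule.sub_mem _ (diagLow_mem ω k x) (hR.invariant_low x hx))

/-- For `|ℓ| > k`, the set `λ_ℓ - σ(V₀|𝓗_ℓ)`: the spectrum of the restriction of `L₀ - V₀` to
`𝓗_ℓ`. -/
def sigma (hR : Reduction V k U V₀) (l : ℤ) (hl : (k : ℤ) < |l|) : Set ℂ :=
  (fun μ => lam ω l - μ) '' spectrum ℂ (restrictTo V₀ (proj ω H l).range (hR.invariant l hl))

/-- The sets `σ_(k)` and `λ_ℓ - σ(V₀|𝓗_ℓ)`, `|ℓ| > k`, are pairwise disjoint, so that each of them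
is a separate part of the spectrum of `L`. -/
def Separated (hR : Reduction V k U V₀) : Prop :=
  (∀ l hl, Disjoint hR.sigmaLow (hR.sigma l hl)) ∧
    ∀ l hl l' hl', l ≠ l' → Disjoint (hR.sigma l hl) (hR.sigma l' hl')

/-- `Qlow = P(σ_(k), L)`, and `Q ℓ = P(λ_ℓ - σ(V₀|𝓗_ℓ), L)` for `|ℓ| > k`. -/
def AreSpectralProjections (hR : Reduction V k U V₀) (Qlow : L2 ω H →L[ℂ] L2 ω H)
    (Q : ℤ → L2 ω H →L[ℂ] L2 ω H) : Prop :=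
  IsRieszProjection (opL V) hR.sigmaLow Qlow ∧
    ∀ l hl, IsRieszProjection (opL V) (hR.sigma l hl) (Q l)

end Reduction

/-- `Q_(k) + ∑_{k<|ℓ|≤n} Q_ℓ - P_(k) - ∑_{k<|ℓ|≤n} P_ℓ`. -/
def partialSumDiff (k : ℕ) (Qlow : L2 ω H →L[ℂ] L2 ω H) (Q : ℤ → L2 ω H →L[ℂ] L2 ω H) (n : ℕ) :
    L2 ω H →L[ℂ] L2 ω H :=
  Qlow + ∑ l ∈ (Finset.Icc (-(n : ℤ)) n).filter (fun l => (k : ℤ) < |l|), Q l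
    - projLow ω H k - ∑ l ∈ (Finset.Icc (-(n : ℤ)) n).filter (fun l => (k : ℤ) < |l|), proj ω H l

end Similarity

end InvolutionOperator

end

open InvolutionOperator

open MeasureTheory Filter Topology

noncomputable section

namespace InvolutionOperator

/-! ### Vector-valued Fourier series -/

section Fourier

variable {H : Type*} [NormedAddCommGroup H] [InnerProductSpace ℂ H] [CompleteSpace H] {ω : ℝ}

/-! The modes `e^{λ_ℓ s} h` identify the space with `ℓ²(ℤ, H)`. There `d/ds` is multiplication by
`λ_ℓ`, and the reflection in `V` gives it the Hankel block matrix `𝒱̂(j+ℓ)`. Since `L₀W - WL₀` has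
blocks `(λ_j - λ_ℓ) W_{jℓ}`, dividing by `λ_j - λ_ℓ` off the diagonal (the operation `Γ_k`) produces
transformations that remove off-diagonal blocks. Leaving a central box of size `k` untouched makes
`Γ_k` of a fixed matrix as small as desired. `J_k` denotes what `Γ_k` leaves: the diagonal and the
box.

A reduction arises from two similarities. With `W = Γ_k V`, the second assumption on the potential
makes `VW` Hilbert-Schmidt, so `(L₀ - V)(I + W) = (I + W)(L₀ - C)` with `C` Hilbert-Schmidt
(`Potential.exists_HS_perturbation`). A contraction argument then solves `X = C + C Γ_k X - (Γ_k
X)(J_k X)`, which says `(L₀ - C)(I + Γ_k X) = (I + Γ_k X)(L₀ - J_k X)`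
(`exists_blockDiagonal_of_HS`). Equality of domains follows by comparing injectivity and
surjectivity at a large real point (`exists_reduction`). The columns of `V₀` have a small tail, so
enlarging `k` confines the block spectra to disjoint discs, and circles serve as contours
(`exists_spectral_gap`).

For the limit, consider any separated reduction. The contour integral of the resolvent of a bounded
operator is a scalar as soon as the winding number is constant on its spectrum
(`Contour.integral_resolvent`). Applied block by block, with winding number one on the chosen block
and zero on the others, this shows that the Riesz projections of `L₀ - V₀` are exactly the `P`'s.
Those of `L` are therefore their conjugates by `U`, and the operator to be estimated is `U P U⁻¹ -
P` with `P` a finite sum of the `P_ℓ`. Here `U = I + W` and `U⁻¹ = I + W'` with `W'` again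
Hilbert-Schmidt (`MemHS.inverse`). The difference equals `WP + PW' + WPW'`, and the same expression
with `P` replaced by `I` vanishes, so its norm is controlled by tails of `W` and `W'`
(`tendsto_hsNorm_conj_projF`). -/

theorem integral_muI (hω : 0 < ω) {F : Type*} [NormedAddCommGroup F] [NormedSpace ℝ F]
    (f : ℝ → F) : ∫ s, f s ∂(muI ω) = ω⁻¹ • ∫ s in (0 : ℝ)..ω, f s := by
  rw [muI, integral_smul_measure, integral_Icc_eq_integral_Ioc,
    ← intervalIntegral.integral_of_le hω.le, ENNReal.toReal_ofReal (inv_nonneg.2 hω.le)]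

theorem muI_smul (hω : 0 < ω) :
    ENNReal.ofReal ω • muI ω = volume.restrict (Set.Icc 0 ω) := by
  rw [muI, smul_smul, ← ENNReal.ofReal_mul hω.le, mul_inv_cancel₀ hω.ne', ENNReal.ofReal_one,
    one_smul]

theorem memLp_of_continuousOn {f : ℝ → H} (hf : ContinuousOn f (Set.Icc 0 ω)) :
    MemLp f 2 (muI ω) := by
  obtain ⟨C, hC⟩ := isCompact_Icc.exists_bound_of_continuousOn hf
  refine MemLp.of_bound ?_ C ?_
  · exact (hf.aestronglyMeasurable measurableSet_Icc).smul_measure _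
  · exact Measure.ae_smul_measure
      ((ae_restrict_iff' measurableSet_Icc).2 (Eventually.of_forall hC)) _

theorem coeffL_apply (l : ℤ) (x : L2 ω H) :
    coeffL ω H l x = ∫ s, Complex.exp (-(lam ω l * s)) • x s ∂(muI ω) := rfl

theorem modeL_ae (l : ℤ) (h : H) :
    (modeL ω H l h : ℝ → H) =ᵐ[muI ω] fun s => Complex.exp (lam ω l * s) • h :=
  (memLp_mode ω l h).coeFn_toLp

theorem conj_exp_lam (ω : ℝ) (l : ℤ) (s : ℝ) :
    (starRingEnd ℂ) (Complex.exp (lam ω l * s)) = Complex.exp (-(lam ω l * s)) := by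
  rw [← Complex.exp_conj]
  congr 1
  rw [map_mul, lam, map_mul, Complex.conj_ofReal, Complex.conj_ofReal, Complex.conj_I]
  ring

theorem inner_modeL (l : ℤ) (h : H) (x : L2 ω H) :
    inner ℂ (modeL ω H l h) x = inner ℂ h (coeffL ω H l x) := by
  rw [coeffL_apply, ← integral_inner
    (integrable_exp_smul (integrable_of_memLp (Lp.memLp x)) l), L2.inner_def]
  refine integral_congr_ae ?_
  filter_upwards [modeL_ae (ω := ω) l h] with s hs
  rw [hs, inner_smul_left, inner_smul_right, conj_exp_lam]

theorem norm_modeL (hω : 0 < ω) (l : ℤ) (h : H) : ‖modeL ω H l h‖ = ‖h‖ := by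
  have := inner_modeL (ω := ω) l h (modeL ω H l h)
  rw [coeffL_modeL hω, if_pos rfl, inner_self_eq_norm_sq_to_K, inner_self_eq_norm_sq_to_K] at this
  have h2 : ‖modeL ω H l h‖ ^ 2 = ‖h‖ ^ 2 := by exact_mod_cast this
  exact (pow_left_inj₀ (norm_nonneg _) (norm_nonneg _) two_ne_zero).1 h2

/-- The mode as a linear isometry. -/
def modeI (hω : 0 < ω) (l : ℤ) : H →ₗᵢ[ℂ] L2 ω H :=
  ⟨(modeL ω H l : H →ₗ[ℂ] L2 ω H), norm_modeL hω l⟩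

/-- Parseval's identity for scalar Fourier series on an interval forces the `L²` norm to vanish. -/
theorem scalar_ae_eq_zero (hω : 0 < ω) {f : ℝ → ℂ} (hf : MemLp f 2 (muI ω))
    (h0 : ∀ l, ∫ s, Complex.exp (-(lam ω l * s)) * f s ∂(muI ω) = 0) : f =ᵐ[muI ω] 0 := by
  have hf' : MemLp f 2 (volume.restrict (Set.Icc 0 ω)) :=
    muI_smul hω ▸ hf.smul_measure ENNReal.ofReal_ne_top
  have hf2 : MemLp f 2 (volume.restrict (Set.Ioc 0 ω)) :=
    hf'.mono_measure (Measure.restrict_mono Set.Ioc_subset_Icc_self le_rfl)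
  have hp := hasSum_sq_fourierCoeffOn hω hf2
  have hc : ∀ i, fourierCoeffOn hω f i = 0 := by
    intro i
    have := h0 i
    rw [integral_muI hω] at this
    rw [fourierCoeffOn_eq_integral, sub_zero, one_div, ← this]
    congr 1
    refine intervalIntegral.integral_congr fun s _ => ?_
    simp only [smul_eq_mul]
    congr 1
    rw [fourier_coe_apply]
    congr 1
    simp [lam]
    ring
  simp only [hc, norm_zero, ne_eq, OfNat.ofNat_ne_zero, not_false_eq_true, zero_pow] at hp
  have h1 := hp.unique hasSum_zero
  have h2 : ∫ s, ‖f s‖ ^ 2 ∂(muI ω) = 0 := by rw [integral_muI hω]; simpa using h1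
  have h3 := (integral_eq_zero_iff_of_nonneg (fun s => by positivity)
    ((memLp_two_iff_integrable_sq_norm hf.1).1 hf)).1 h2
  filter_upwards [h3] with s hs
  simpa using hs

/-- Pairing with `h` reduces to the scalar case, but the exceptional null set depends on `h` and `H`
may be nonseparable. The integrals of `x` over measurable sets are tested against every `h` instead.
-/
theorem eq_zero_of_coeffL (hω : 0 < ω) (x : L2 ω H) (h0 : ∀ l, coeffL ω H l x = 0) : x = 0 := by
  have hint := integrable_of_memLp (Lp.memLp x)
  have key : ∀ h : H, (fun s => inner ℂ h (x s)) =ᵐ[muI ω] 0 := fun h => by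
    refine scalar_ae_eq_zero hω ((Lp.memLp x).const_inner h) fun l => ?_
    have : inner ℂ h (coeffL ω H l x) = 0 := by rw [h0, inner_zero_right]
    rw [coeffL_apply, ← integral_inner (integrable_exp_smul hint l)] at this
    simpa only [inner_smul_right] using this
  refine Lp.ext (EventuallyEq.trans ?_ (Lp.coeFn_zero H 2 (muI ω)).symm)
  refine hint.ae_eq_zero_of_forall_setIntegral_eq_zero fun s _ _ => ?_
  refine ext_inner_left ℂ fun h => ?_
  rw [inner_zero_right, ← integral_inner hint.integrableOn]
  exact integral_eq_zero_of_ae (ae_restrict_of_ae (key h))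

theorem ext_coeffL (hω : 0 < ω) {x y : L2 ω H} (h : ∀ l, coeffL ω H l x = coeffL ω H l y) :
    x = y := by
  rw [← sub_eq_zero]
  exact eq_zero_of_coeffL hω _ fun l => by rw [map_sub, h, sub_self]

theorem orthogonalFamily_modeI (hω : 0 < ω) :
    OrthogonalFamily ℂ (fun _ : ℤ => H) (modeI (H := H) hω) := fun i j hij v w => by
  change inner ℂ (modeL ω H i v) (modeL ω H j w) = 0
  rw [inner_modeL, coeffL_modeL hω, if_neg hij, inner_zero_right]

theorem isHilbertSum_modeI (hω : 0 < ω) : IsHilbertSum ℂ (fun _ : ℤ => H) (modeI (H := H) hω) := by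
  refine IsHilbertSum.mk (orthogonalFamily_modeI hω) ?_
  rw [top_le_iff, Submodule.topologicalClosure_eq_top_iff, Submodule.eq_bot_iff]
  intro x hx
  refine eq_zero_of_coeffL hω x fun l => ext_inner_left ℂ fun h => ?_
  rw [inner_zero_right, ← inner_modeL]
  exact hx _ (Submodule.mem_iSup_of_mem l ⟨h, rfl⟩)

theorem exists_hasSum_modeL (hω : 0 < ω) {y : ℤ → H} (hy : Summable fun l => ‖y l‖ ^ 2) :
    ∃ x : L2 ω H, HasSum (fun l => modeL ω H l (y l)) x ∧ (∀ l, coeffL ω H l x = y l) ∧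
      ‖x‖ ^ 2 = ∑' l, ‖y l‖ ^ 2 := by
  have hm : Memℓp y 2 := memℓp_gen (by simpa using hy)
  have hs := (isHilbertSum_modeI (H := H) hω).hasSum_linearIsometryEquiv_symm ⟨y, hm⟩
  refine ⟨_, hs, fun l => ?_, ?_⟩
  · have := hs.mapL (coeffL ω H l)
    refine this.unique ?_
    convert hasSum_ite_eq l (y l) using 2 with j
    change coeffL ω H l (modeL ω H j (y j)) = _
    rw [coeffL_modeL hω]
    by_cases h1 : l = j
    · subst h1; simp
    · rw [if_neg h1, if_neg (Ne.symm h1)]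
  · rw [LinearIsometryEquiv.norm_map]
    have := lp.norm_rpow_eq_tsum (p := 2) (by norm_num) (⟨y, hm⟩ : lp (fun _ : ℤ => H) 2)
    simpa using this

theorem hasSum_modeL_coeffL (hω : 0 < ω) (x : L2 ω H) :
    HasSum (fun l => modeL ω H l (coeffL ω H l x)) x ∧
      HasSum (fun l => ‖coeffL ω H l x‖ ^ 2) (‖x‖ ^ 2) := by
  obtain ⟨y, rfl⟩ := (isHilbertSum_modeI (H := H) hω).linearIsometryEquiv.symm.surjective x
  have hsum : Summable fun l => ‖y l‖ ^ 2 := by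
    simpa using (lp.memℓp y).summable (by norm_num)
  obtain ⟨x, h1, h2, h3⟩ := exists_hasSum_modeL hω hsum
  have := (isHilbertSum_modeI (H := H) hω).hasSum_linearIsometryEquiv_symm y
  rw [this.unique h1]
  simp only [h2]
  exact ⟨h1, h3 ▸ hsum.hasSum⟩

theorem hasSum_modeL (hω : 0 < ω) (x : L2 ω H) :
    HasSum (fun l => modeL ω H l (coeffL ω H l x)) x := (hasSum_modeL_coeffL hω x).1

theorem hasSum_norm_coeffL_sq (hω : 0 < ω) (x : L2 ω H) :
    HasSum (fun l => ‖coeffL ω H l x‖ ^ 2) (‖x‖ ^ 2) := (hasSum_modeL_coeffL hω x).2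

theorem norm_coeffL_le (hω : 0 < ω) (l : ℤ) (x : L2 ω H) : ‖coeffL ω H l x‖ ≤ ‖x‖ := by
  have h := hasSum_norm_coeffL_sq hω x
  have := le_hasSum h l fun j _ => by positivity
  exact (sq_le_sq₀ (norm_nonneg _) (norm_nonneg _)).1 this

/-! ### The domain of `d/ds` in terms of Fourier coefficients -/

theorem lam_eq_zero_iff (hω : 0 < ω) {l : ℤ} : lam ω l = 0 ↔ l = 0 := by
  simp [lam, Real.pi_ne_zero, hω.ne']

theorem lam_zero (ω : ℝ) : lam ω 0 = 0 := by simp [lam]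

theorem exp_lam_mul_omega (hω : 0 < ω) (l : ℤ) : Complex.exp (lam ω l * ω) = 1 := by
  have : lam ω l * (ω : ℂ) = (l : ℂ) * (2 * Real.pi * Complex.I) := by
    have : (ω : ℂ) ≠ 0 := by exact_mod_cast hω.ne'
    simp only [lam]; push_cast; field_simp
  rw [this, Complex.exp_int_mul_two_pi_mul_I]

/-- Integration by parts against a primitive of an integrable function. -/
theorem integral_smul_primitive (hω : 0 < ω) {g : ℝ → H} (hg : IntervalIntegrable g volume 0 ω)
    {φ φ' : ℝ → ℂ} (hφ : ∀ s, HasDerivAt φ (φ' s) s) (hφ' : Continuous φ') :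
    ∫ s in (0 : ℝ)..ω, φ' s • ∫ t in (0 : ℝ)..s, g t = ∫ t in (0 : ℝ)..ω, (φ ω - φ t) • g t := by
  have hg1 : IntegrableOn g (Set.Ioc 0 ω) := by
    rwa [intervalIntegrable_iff, Set.uIoc_of_le hω.le] at hg
  have hφ1 : IntegrableOn φ' (Set.Ioc 0 ω) :=
    (hφ'.integrableOn_Icc (μ := volume) (a := 0) (b := ω)).mono_set Set.Ioc_subset_Icc_self
  set μ := volume.restrict (Set.Ioc 0 ω)
  -- Both sides are integrals of `φ'(s) g(t)` over the triangle `0 < t ≤ s ≤ ω`, taken in the two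
  -- orders.
  let F : ℝ → ℝ → H := fun s t => {p : ℝ × ℝ | p.2 ≤ p.1}.indicator (fun p => φ' p.1 • g p.2) (s, t)
  have hF : Integrable (Function.uncurry F) (μ.prod μ) := by
    have : Integrable (fun p : ℝ × ℝ => φ' p.1 • g p.2) (μ.prod μ) :=
      Integrable.smul_prod (μ := μ) (ν := μ) hφ1 hg1
    exact this.indicator (measurableSet_le measurable_snd measurable_fst)
  have hswap := integral_integral_swap hF
  rw [intervalIntegral.integral_of_le hω.le, intervalIntegral.integral_of_le hω.le]
  have h1 : ∀ s ∈ Set.Ioc 0 ω, φ' s • ∫ t in (0 : ℝ)..s, g t = ∫ t, F s t ∂μ := fun s hs => by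
    rw [intervalIntegral.integral_of_le hs.1.le, ← integral_smul]
    have : (fun t => F s t) = (Set.Iic s).indicator fun t => φ' s • g t := by
      ext t; simp [F, Set.indicator]
    rw [this, integral_indicator measurableSet_Iic, Measure.restrict_restrict measurableSet_Iic]
    congr 2
    ext t
    simp only [Set.mem_Ioc, Set.mem_inter_iff, Set.mem_Iic]
    constructor
    · rintro ⟨h1, h2⟩; exact ⟨h2, h1, h2.trans hs.2⟩
    · rintro ⟨h1, h2, _⟩; exact ⟨h2, h1⟩
  have h2 : ∀ t ∈ Set.Ioc 0 ω, ∫ s, F s t ∂μ = (φ ω - φ t) • g t := fun t ht => by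
    have : (fun s => F s t) = (Set.Ici t).indicator fun s => φ' s • g t := by
      ext s; simp [F, Set.indicator]
    rw [this, integral_indicator measurableSet_Ici, Measure.restrict_restrict measurableSet_Ici]
    have hset : Set.Ici t ∩ Set.Ioc 0 ω = Set.Icc t ω := by
      ext s
      simp only [Set.mem_Ioc, Set.mem_inter_iff, Set.mem_Ici, Set.mem_Icc]
      constructor
      · rintro ⟨h1, _, h2⟩; exact ⟨h1, h2⟩
      · rintro ⟨h1, h2⟩; exact ⟨h1, ht.1.trans_le h1, h2⟩
    rw [hset, integral_smul_const, integral_Icc_eq_integral_Ioc,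
      ← intervalIntegral.integral_of_le ht.2,
      intervalIntegral.integral_eq_sub_of_hasDerivAt (fun s _ => hφ s)
        (hφ'.intervalIntegrable _ _)]
  rw [setIntegral_congr_fun measurableSet_Ioc h1, ← setIntegral_congr_fun measurableSet_Ioc h2]
  exact hswap

theorem continuousOn_primitive_L2 (hω : 0 < ω) (g : L2 ω H) :
    ContinuousOn (fun s => ∫ t in (0 : ℝ)..s, g t) (Set.Icc 0 ω) := by
  have hc := intervalIntegral.continuousOn_primitive_interval'
    (intervalIntegrable_L2 g ⟨hω.le, le_rfl⟩) Set.left_mem_uIcc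
  rwa [Set.uIcc_of_le hω.le] at hc

theorem coeffL_eq_of_ae (l : ℤ) {x : L2 ω H} {f : ℝ → H} (h : x =ᵐ[muI ω] f) :
    coeffL ω H l x = ∫ s, Complex.exp (-(lam ω l * s)) • f s ∂(muI ω) := by
  refine integral_congr_ae ?_
  filter_upwards [h] with s hs
  exact congrArg _ hs

theorem coeffL_zero_eq (hω : 0 < ω) (g : L2 ω H) :
    coeffL ω H 0 g = ω⁻¹ • ∫ t in (0 : ℝ)..ω, g t := by
  rw [coeffL_apply, integral_muI hω]
  simp [lam_zero]

/-- Integration by parts with `φ(s) = -e^{-λ_l s}`, for which `φ(ω) - φ(t) = e^{-λ_l t} - 1`. The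
subtracted zeroth coefficient of `g` is the jump `y(ω) - y(0)` divided by `ω`; it disappears exactly
under the periodic boundary condition. -/
theorem lam_smul_coeffL_primitive (hω : 0 < ω) (g y : L2 ω H) (a : H)
    (hy : y =ᵐ[muI ω] fun s => a + ∫ t in (0 : ℝ)..s, g t) (l : ℤ) :
    lam ω l • coeffL ω H l y = coeffL ω H l g - coeffL ω H 0 g := by
  have hint := intervalIntegrable_L2 g (s := ω) ⟨hω.le, le_rfl⟩
  have hd : ∀ s : ℝ, HasDerivAt (fun s : ℝ => -Complex.exp (-(lam ω l * s)))
      (lam ω l * Complex.exp (-(lam ω l * s))) s := fun s => by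
    have h1 : HasDerivAt (fun s : ℝ => -(lam ω l * (s : ℂ))) (-(lam ω l * 1)) s :=
      ((hasDerivAt_id s).ofReal_comp.const_mul (lam ω l)).neg
    exact h1.cexp.neg.congr_deriv (by ring)
  have hd' : Continuous fun s : ℝ => lam ω l * Complex.exp (-(lam ω l * s)) := by fun_prop
  have hend : Complex.exp (-(lam ω l * ω)) = 1 := by
    rw [Complex.exp_neg, exp_lam_mul_omega hω, inv_one]
  have hparts := integral_smul_primitive hω hint hd hd'
  have hconst : ∫ s in (0 : ℝ)..ω, (lam ω l * Complex.exp (-(lam ω l * s))) • a = 0 := by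
    rw [intervalIntegral.integral_smul_const,
      intervalIntegral.integral_eq_sub_of_hasDerivAt (fun s _ => hd s)
        (hd'.intervalIntegrable _ _), hend]
    simp
  have hprod : IntervalIntegrable (fun s => (lam ω l * Complex.exp (-(lam ω l * s))) •
      ∫ t in (0 : ℝ)..s, g t) volume 0 ω := by
    refine ContinuousOn.intervalIntegrable ?_
    rw [Set.uIcc_of_le hω.le]
    exact hd'.continuousOn.smul (continuousOn_primitive_L2 hω g)
  rw [coeffL_eq_of_ae l hy, integral_muI hω, smul_comm, ← intervalIntegral.integral_smul,
    coeffL_zero_eq hω, coeffL_apply, integral_muI hω, ← smul_sub,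
    ← intervalIntegral.integral_sub _ hint]
  · congr 1
    simp only [smul_add, smul_smul]
    rw [intervalIntegral.integral_add
      (f := fun s => (lam ω l * Complex.exp (-(lam ω l * s))) • a)
      (Continuous.intervalIntegrable (by fun_prop) _ _) hprod, hconst, zero_add, hparts]
    refine intervalIntegral.integral_congr fun t _ => ?_
    simp only [hend, sub_smul, neg_smul, one_smul]
    abel
  · exact hint.continuousOn_smul (continuous_exp_neg_lam ω l).continuousOn

/-- From here on the domain and action of `d/ds` are handled only through Fourier coefficients. -/
theorem mem_derivGraph_iff (hω : 0 < ω) {y g : L2 ω H} :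
    (y, g) ∈ derivGraph ω H ↔ ∀ l, coeffL ω H l g = lam ω l • coeffL ω H l y := by
  have hω' : (ω⁻¹ : ℝ) ≠ 0 := inv_ne_zero hω.ne'
  constructor
  · rintro ⟨f, h1, h2, h3⟩ l
    simp only at h1 h2
    have h0 : coeffL ω H 0 g = 0 := by
      have := h2 ω ⟨hω.le, le_rfl⟩
      rw [← h3, left_eq_add] at this
      rw [coeffL_zero_eq hω, this, smul_zero]
    have h4 : y =ᵐ[muI ω] fun s => f 0 + ∫ t in (0 : ℝ)..s, g t := by
      refine h1.trans ?_
      exact Measure.ae_smul_measure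
        ((ae_restrict_iff' measurableSet_Icc).2 (Eventually.of_forall h2)) _
    rw [lam_smul_coeffL_primitive hω g y (f 0) h4, h0, sub_zero]
  · intro h
    have h0 : coeffL ω H 0 g = 0 := by rw [h, lam_zero, zero_smul]
    have hp := continuousOn_primitive_L2 hω g
    let y₀ : L2 ω H := (memLp_of_continuousOn hp).toLp _
    have hy₀ : y₀ =ᵐ[muI ω] fun s => ∫ t in (0 : ℝ)..s, g t := MemLp.coeFn_toLp _
    -- The integration constant is fixed by the zeroth coefficient of `y`; the others are determined
    -- by those of `g`, since `λ_l ≠ 0` for `l ≠ 0`.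
    let a : H := coeffL ω H 0 (y - y₀)
    have hsum : (y₀ + modeL ω H 0 a : L2 ω H) =ᵐ[muI ω] fun s => a + ∫ t in (0 : ℝ)..s, g t := by
      filter_upwards [hy₀, modeL_ae (ω := ω) 0 a, Lp.coeFn_add y₀ (modeL ω H 0 a)] with s h1 h2 h3
      rw [h3, Pi.add_apply, h1, h2, lam_zero, zero_mul, Complex.exp_zero, one_smul, add_comm]
    have hy : y = y₀ + modeL ω H 0 a := by
      refine ext_coeffL hω fun l => ?_
      by_cases hl : l = 0
      · subst hl
        rw [map_add, coeffL_modeL hω, if_pos rfl]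
        simp only [a, map_sub]
        abel
      · have := lam_smul_coeffL_primitive hω g _ a hsum l
        rw [h0, sub_zero, h] at this
        exact (smul_right_injective H (mt (lam_eq_zero_iff hω).1 hl) this).symm
    refine ⟨fun s => a + ∫ t in (0 : ℝ)..s, g t, ?_, fun s _ => ?_, ?_⟩
    · simpa only [hy] using hsum
    · simp
    · have := h0
      rw [coeffL_zero_eq hω, smul_eq_zero_iff_right hω'] at this
      simp [this]

end Fourier


/-! ### Hilbert-Schmidt block matrices -/

section HilbertSchmidt

variable {H : Type*} [NormedAddCommGroup H] [InnerProductSpace ℂ H] [CompleteSpace H] {ω : ℝ}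

/-- Cauchy-Schwarz for series. -/
theorem summable_mul_and_sq_tsum_le {ι : Type*} {u v : ι → ℝ} (hu0 : ∀ i, 0 ≤ u i)
    (hv0 : ∀ i, 0 ≤ v i) (hu : Summable fun i => u i ^ 2) (hv : Summable fun i => v i ^ 2) :
    (Summable fun i => u i * v i) ∧
      (∑' i, u i * v i) ^ 2 ≤ (∑' i, u i ^ 2) * ∑' i, v i ^ 2 := by
  have hU : 0 ≤ ∑' i, u i ^ 2 := tsum_nonneg fun i => sq_nonneg _
  have hV : 0 ≤ ∑' i, v i ^ 2 := tsum_nonneg fun i => sq_nonneg _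
  have hb : ∀ s : Finset ι, ∑ i ∈ s, u i * v i ≤ √((∑' i, u i ^ 2) * ∑' i, v i ^ 2) := fun s => by
    refine Real.le_sqrt_of_sq_le ((Finset.sum_mul_sq_le_sq_mul_sq s u v).trans ?_)
    exact mul_le_mul (hu.sum_le_tsum s fun i _ => sq_nonneg _)
      (hv.sum_le_tsum s fun i _ => sq_nonneg _) (Finset.sum_nonneg fun i _ => sq_nonneg _) hU
  have hs : Summable fun i => u i * v i :=
    summable_of_sum_le (fun i => mul_nonneg (hu0 i) (hv0 i)) hb
  refine ⟨hs, ?_⟩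
  rw [← Real.le_sqrt (tsum_nonneg fun i => mul_nonneg (hu0 i) (hv0 i)) (mul_nonneg hU hV)]
  exact hs.tsum_le_of_sum_le hb

theorem summable_and_norm_tsum_sq_le {ι F : Type*} [NormedAddCommGroup F] [CompleteSpace F]
    {f : ι → F} {u v : ι → ℝ} (hf : ∀ i, ‖f i‖ ≤ u i * v i) (hu0 : ∀ i, 0 ≤ u i)
    (hv0 : ∀ i, 0 ≤ v i) (hu : Summable fun i => u i ^ 2) (hv : Summable fun i => v i ^ 2) :
    (Summable fun i => ‖f i‖) ∧ ‖∑' i, f i‖ ^ 2 ≤ (∑' i, u i ^ 2) * ∑' i, v i ^ 2 := by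
  obtain ⟨h1, h2⟩ := summable_mul_and_sq_tsum_le hu0 hv0 hu hv
  have hs : Summable fun i => ‖f i‖ := Summable.of_nonneg_of_le (fun i => norm_nonneg _) hf h1
  refine ⟨hs, le_trans ?_ h2⟩
  gcongr
  exact (norm_tsum_le_tsum_norm hs).trans (hs.tsum_le_tsum hf h1)

theorem summable_norm_coeffL_sq (hω : 0 < ω) (x : L2 ω H) :
    Summable fun l => ‖coeffL ω H l x‖ ^ 2 := (hasSum_norm_coeffL_sq hω x).summable

theorem tsum_norm_coeffL_sq (hω : 0 < ω) (x : L2 ω H) :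
    ∑' l, ‖coeffL ω H l x‖ ^ 2 = ‖x‖ ^ 2 := (hasSum_norm_coeffL_sq hω x).tsum_eq

theorem norm_le_of_coeffL (hω : 0 < ω) {x y : L2 ω H} {C : ℝ} (hC : 0 ≤ C)
    (h : ∀ l, ‖coeffL ω H l y‖ ≤ C * ‖coeffL ω H l x‖) : ‖y‖ ≤ C * ‖x‖ := by
  refine (sq_le_sq₀ (norm_nonneg _) (by positivity)).1 ?_
  rw [← tsum_norm_coeffL_sq hω, mul_pow, ← tsum_norm_coeffL_sq hω x, ← tsum_mul_left]
  refine (summable_norm_coeffL_sq hω y).tsum_le_tsum (fun l => ?_)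
    ((summable_norm_coeffL_sq hω x).mul_left _)
  rw [← mul_pow]
  gcongr
  exact h l

/-- A bounded operator is determined by compatible square summable rows. -/
theorem exists_clm_of_rows (hω : 0 < ω) (T : ℤ → L2 ω H →ₗ[ℂ] H) {C : ℝ} (hC : 0 ≤ C)
    (hT : ∀ x, (Summable fun j => ‖T j x‖ ^ 2) ∧ ∑' j, ‖T j x‖ ^ 2 ≤ C ^ 2 * ‖x‖ ^ 2) :
    ∃ A : L2 ω H →L[ℂ] L2 ω H, (∀ j x, coeffL ω H j (A x) = T j x) ∧ ‖A‖ ≤ C := by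
  choose A h1 h2 h3 using fun x => exists_hasSum_modeL hω (hT x).1
  refine ⟨LinearMap.mkContinuous
    { toFun := A
      map_add' := fun x y => ext_coeffL hω fun l => by simp only [map_add, h2]
      map_smul' := fun c x => ext_coeffL hω fun l => by simp [h2] } C fun x => ?_,
    fun j x => h2 x j, LinearMap.mkContinuous_norm_le _ hC _⟩
  change ‖A x‖ ≤ _
  refine (sq_le_sq₀ (norm_nonneg _) (by positivity)).1 ?_
  rw [h3, mul_pow]
  exact (hT x).2

/-- Block matrices with square summable norms. -/
abbrev HS (H : Type*) [NormedAddCommGroup H] [InnerProductSpace ℂ H] : Type _ :=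
  lp (fun _ : ℤ × ℤ => H →L[ℂ] H) 2

namespace HS

theorem hasSum_sq (a : HS H) : HasSum (fun p => ‖a p‖ ^ 2) (‖a‖ ^ 2) := by
  simpa using lp.hasSum_norm (p := 2) (by norm_num) a

theorem summable_sq (a : HS H) : Summable fun p => ‖a p‖ ^ 2 := a.hasSum_sq.summable

theorem memℓp_of_summable {f : ℤ × ℤ → H →L[ℂ] H} (h : Summable fun p => ‖f p‖ ^ 2) :
    Memℓp f 2 := memℓp_gen (by simpa using h)

/-- The block matrix with given square summable entries. -/
def mk (f : ℤ × ℤ → H →L[ℂ] H) (h : Summable fun p => ‖f p‖ ^ 2) : HS H :=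
  ⟨f, memℓp_of_summable h⟩

@[simp] theorem mk_apply (f : ℤ × ℤ → H →L[ℂ] H) (h : Summable fun p => ‖f p‖ ^ 2) (p : ℤ × ℤ) :
    mk f h p = f p := rfl

theorem norm_le_mul {a b : HS H} {C : ℝ} (hC : 0 ≤ C) (h : ∀ p, ‖a p‖ ≤ C * ‖b p‖) :
    ‖a‖ ≤ C * ‖b‖ := by
  refine (sq_le_sq₀ (norm_nonneg _) (by positivity)).1 ?_
  rw [mul_pow, ← a.hasSum_sq.tsum_eq, ← b.hasSum_sq.tsum_eq, ← tsum_mul_left]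
  refine a.summable_sq.tsum_le_tsum (fun l => ?_) (b.summable_sq.mul_left _)
  rw [← mul_pow]
  gcongr
  exact h l

theorem summable_row (a : HS H) (j : ℤ) : Summable fun l => ‖a (j, l)‖ ^ 2 :=
  a.summable_sq.comp_injective (i := fun l => (j, l)) (Prod.mk_right_injective j)

theorem summable_col (a : HS H) (l : ℤ) : Summable fun j => ‖a (j, l)‖ ^ 2 :=
  a.summable_sq.comp_injective (i := fun j => (j, l)) (Prod.mk_left_injective l)

theorem summable_rows (a : HS H) : Summable fun j => ∑' l, ‖a (j, l)‖ ^ 2 :=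
  a.summable_sq.prod

theorem tsum_rows (a : HS H) : ∑' j, ∑' l, ‖a (j, l)‖ ^ 2 = ‖a‖ ^ 2 := by
  rw [← a.summable_sq.tsum_prod, a.hasSum_sq.tsum_eq]

theorem swap_summable (a : HS H) : Summable fun p : ℤ × ℤ => ‖a (p.2, p.1)‖ ^ 2 :=
  a.summable_sq.comp_injective (i := Prod.swap) Prod.swap_injective

theorem summable_cols (a : HS H) : Summable fun l => ∑' j, ‖a (j, l)‖ ^ 2 :=
  a.swap_summable.prod

theorem tsum_cols (a : HS H) : ∑' l, ∑' j, ‖a (j, l)‖ ^ 2 = ‖a‖ ^ 2 := by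
  rw [← a.tsum_rows]
  exact Summable.tsum_comm (f := fun j l => ‖a (j, l)‖ ^ 2) a.summable_sq

theorem apply_summable (hω : 0 < ω) (a : HS H) (x : L2 ω H) (j : ℤ) :
    (Summable fun l => ‖a (j, l) (coeffL ω H l x)‖) ∧
      ‖∑' l, a (j, l) (coeffL ω H l x)‖ ^ 2 ≤ (∑' l, ‖a (j, l)‖ ^ 2) * ‖x‖ ^ 2 := by
  rw [← tsum_norm_coeffL_sq hω x]
  exact summable_and_norm_tsum_sq_le (fun l => (a (j, l)).le_opNorm _) (fun _ => norm_nonneg _)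
    (fun _ => norm_nonneg _) (a.summable_row j) (summable_norm_coeffL_sq hω x)

/-- Cauchy-Schwarz bounds each row; summing over the rows bounds the operator norm by the
Hilbert-Schmidt norm. -/
theorem exists_op (hω : 0 < ω) (a : HS H) : ∃ A : L2 ω H →L[ℂ] L2 ω H,
    (∀ j x, coeffL ω H j (A x) = ∑' l, a (j, l) (coeffL ω H l x)) ∧ ‖A‖ ≤ ‖a‖ := by
  refine exists_clm_of_rows hω (fun j =>
    { toFun := fun x => ∑' l, a (j, l) (coeffL ω H l x)
      map_add' := fun x y => by
        simp only [map_add]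
        exact Summable.tsum_add (a.apply_summable hω x j).1.of_norm
          (a.apply_summable hω y j).1.of_norm
      map_smul' := fun c x => by
        simp only [map_smul, RingHom.id_apply]
        exact Summable.tsum_const_smul c (a.apply_summable hω x j).1.of_norm }) (norm_nonneg _)
    fun x => ?_
  have hb := fun j => (a.apply_summable hω x j).2
  have hs : Summable fun j => ‖∑' l, a (j, l) (coeffL ω H l x)‖ ^ 2 :=
    Summable.of_nonneg_of_le (fun j => sq_nonneg _) hb (a.summable_rows.mul_right _)
  refine ⟨hs, ?_⟩
  rw [← a.tsum_rows, ← tsum_mul_right]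
  exact hs.tsum_le_tsum hb (a.summable_rows.mul_right _)

end HS

/-- The `(j, l)` block of an operator. -/
def blk (X : L2 ω H →L[ℂ] L2 ω H) (p : ℤ × ℤ) : H →L[ℂ] H :=
  coeffL ω H p.1 ∘L X ∘L modeL ω H p.2

theorem norm_comp_coeffL_le (hω : 0 < ω) {F : Type*} [NormedAddCommGroup F] [NormedSpace ℂ F]
    (A : H →L[ℂ] F) (l : ℤ) : ‖A ∘L coeffL ω H l‖ ≤ ‖A‖ :=
  ContinuousLinearMap.opNorm_le_bound _ (norm_nonneg _) fun x =>
    (A.le_opNorm _).trans (by gcongr; exact norm_coeffL_le hω l x)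

theorem norm_comp_modeL_le (hω : 0 < ω) {F : Type*} [NormedAddCommGroup F] [NormedSpace ℂ F]
    (A : L2 ω H →L[ℂ] F) (l : ℤ) : ‖A ∘L modeL ω H l‖ ≤ ‖A‖ :=
  ContinuousLinearMap.opNorm_le_bound _ A.opNorm_nonneg fun x =>
    (A.le_opNorm _).trans (congrArg (‖A‖ * ·) (norm_modeL hω l x)).le

theorem norm_modeL_comp (hω : 0 < ω) {F : Type*} [NormedAddCommGroup F] [NormedSpace ℂ F]
    (A : F →L[ℂ] H) (l : ℤ) : ‖modeL ω H l ∘L A‖ ≤ ‖A‖ :=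
  ContinuousLinearMap.opNorm_le_bound _ A.opNorm_nonneg fun x => by
    rw [ContinuousLinearMap.comp_apply, norm_modeL hω]; exact A.le_opNorm _

theorem norm_coeffL_comp (hω : 0 < ω) {F : Type*} [NormedAddCommGroup F] [NormedSpace ℂ F]
    (A : F →L[ℂ] L2 ω H) (l : ℤ) : ‖coeffL ω H l ∘L A‖ ≤ ‖A‖ :=
  ContinuousLinearMap.opNorm_le_bound _ A.opNorm_nonneg fun _ =>
    (norm_coeffL_le hω l _).trans (A.le_opNorm _)

/-- Modes are isometries and coefficients are contractions, so passing between operators on the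
whole space and their blocks in `B(H)` loses nothing in either direction. -/
theorem norm_proj_comp_proj (hω : 0 < ω) (X : L2 ω H →L[ℂ] L2 ω H) (p : ℤ × ℤ) :
    ‖proj ω H p.1 ∘L X ∘L proj ω H p.2‖ = ‖blk X p‖ := by
  have h1 : proj ω H p.1 ∘L X ∘L proj ω H p.2 =
    (modeL ω H p.1 ∘L blk X p) ∘L coeffL ω H p.2 := rfl
  have h2 : blk X p =
      (coeffL ω H p.1 ∘L (proj ω H p.1 ∘L X ∘L proj ω H p.2)) ∘L modeL ω H p.2 := by
    ext h
    simp [proj, blk, coeffL_modeL hω]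
  refine le_antisymm ?_ ?_
  · rw [h1]
    exact (norm_comp_coeffL_le hω _ _).trans (norm_modeL_comp hω _ _)
  · rw [h2]
    exact (norm_comp_modeL_le hω _ _).trans (norm_coeffL_comp hω _ _)

theorem memHS_iff (hω : 0 < ω) {X : L2 ω H →L[ℂ] L2 ω H} :
    MemHS X ↔ Summable fun p => ‖blk X p‖ ^ 2 := by
  simp only [MemHS, norm_proj_comp_proj hω]

theorem hsNorm_eq (hω : 0 < ω) (X : L2 ω H →L[ℂ] L2 ω H) :
    hsNorm X = √(∑' p, ‖blk X p‖ ^ 2) := by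
  simp only [hsNorm, norm_proj_comp_proj hω]

theorem hasSum_blk (hω : 0 < ω) (X : L2 ω H →L[ℂ] L2 ω H) (j : ℤ) (x : L2 ω H) :
    HasSum (fun l => blk X (j, l) (coeffL ω H l x)) (coeffL ω H j (X x)) :=
  ((hasSum_modeL hω x).mapL X).mapL (coeffL ω H j)

theorem ext_blk (hω : 0 < ω) {X Y : L2 ω H →L[ℂ] L2 ω H} (h : ∀ p, blk X p = blk Y p) : X = Y := by
  refine ContinuousLinearMap.ext fun x => ext_coeffL hω fun j => ?_
  have h1 := hasSum_blk hω X j x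
  simp only [h] at h1
  exact h1.unique (hasSum_blk hω Y j x)

/-- The operator with a given Hilbert-Schmidt block matrix. -/
def hsOp (hω : 0 < ω) : HS H →L[ℂ] L2 ω H →L[ℂ] L2 ω H :=
  LinearMap.mkContinuous
    { toFun := fun a => (a.exists_op hω).choose
      map_add' := fun a b => ContinuousLinearMap.ext fun x => ext_coeffL hω fun j => by
        rw [add_apply, map_add, (HS.exists_op hω _).choose_spec.1,
          (HS.exists_op hω _).choose_spec.1, (HS.exists_op hω _).choose_spec.1,
          ← Summable.tsum_add (a.apply_summable hω x j).1.of_norm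
            (b.apply_summable hω x j).1.of_norm]
        rfl
      map_smul' := fun c a => ContinuousLinearMap.ext fun x => ext_coeffL hω fun j => by
        rw [RingHom.id_apply, smul_apply, map_smul, (HS.exists_op hω _).choose_spec.1,
          (HS.exists_op hω _).choose_spec.1,
          ← Summable.tsum_const_smul c (a.apply_summable hω x j).1.of_norm]
        rfl } 1 fun a => by
          rw [one_mul]; exact (a.exists_op hω).choose_spec.2

theorem coeffL_op (hω : 0 < ω) (a : HS H) (j : ℤ) (x : L2 ω H) :
    coeffL ω H j (hsOp hω a x) = ∑' l, a (j, l) (coeffL ω H l x) :=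
  (a.exists_op hω).choose_spec.1 j x

theorem norm_op_le (hω : 0 < ω) (a : HS H) : ‖hsOp hω a‖ ≤ ‖a‖ := (a.exists_op hω).choose_spec.2

theorem blk_op (hω : 0 < ω) (a : HS H) (p : ℤ × ℤ) : blk (hsOp hω a) p = a p := by
  ext h
  change coeffL ω H p.1 (hsOp hω a (modeL ω H p.2 h)) = _
  rw [coeffL_op, tsum_eq_single p.2]
  · rw [coeffL_modeL hω, if_pos rfl]
  · intro l hl
    rw [coeffL_modeL hω, if_neg hl, map_zero]

theorem op_injective (hω : 0 < ω) : Function.Injective (hsOp (H := H) hω) := fun a b h => by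
  refine lp.ext (funext fun p => ?_)
  rw [← blk_op hω a, ← blk_op hω b, h]

theorem memHS_op (hω : 0 < ω) (a : HS H) : MemHS (hsOp hω a) := by
  rw [memHS_iff hω]
  simpa only [blk_op] using a.summable_sq

theorem hsNorm_op (hω : 0 < ω) (a : HS H) : hsNorm (hsOp hω a) = ‖a‖ := by
  rw [hsNorm_eq hω]
  simp only [blk_op]
  rw [a.hasSum_sq.tsum_eq, Real.sqrt_sq (norm_nonneg _)]

theorem MemHS.exists_op (hω : 0 < ω) {X : L2 ω H →L[ℂ] L2 ω H} (hX : MemHS X) :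
    ∃ a : HS H, hsOp hω a = X :=
  ⟨HS.mk (blk X) ((memHS_iff hω).1 hX), ext_blk hω fun p => by rw [blk_op, HS.mk_apply]⟩

theorem blk_comp_hasSum (hω : 0 < ω) (a b : HS H) (p : ℤ × ℤ) :
    (Summable fun n => ‖a (p.1, n) ∘L b (n, p.2)‖) ∧
      ‖∑' n, a (p.1, n) ∘L b (n, p.2)‖ ^ 2 ≤
        (∑' n, ‖a (p.1, n)‖ ^ 2) * ∑' n, ‖b (n, p.2)‖ ^ 2 ∧
      blk (hsOp hω a ∘L hsOp hω b) p = ∑' n, a (p.1, n) ∘L b (n, p.2) := by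
  obtain ⟨h1, h2⟩ := summable_and_norm_tsum_sq_le (F := H →L[ℂ] H)
    (f := fun n => a (p.1, n) ∘L b (n, p.2)) (u := fun n => ‖a (p.1, n)‖)
    (v := fun n => ‖b (n, p.2)‖) (fun n => (a (p.1, n)).opNorm_comp_le (b (n, p.2))) (fun _ => norm_nonneg _)
    (fun _ => norm_nonneg _) (a.summable_row p.1) (b.summable_col p.2)
  refine ⟨h1, h2, ContinuousLinearMap.ext fun h => ?_⟩
  have h3 := hasSum_blk hω (hsOp hω a) p.1 (hsOp hω b (modeL ω H p.2 h))
  have h4 := h1.of_norm.hasSum.mapL (ContinuousLinearMap.apply ℂ H h)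
  refine HasSum.unique ?_ h4
  change HasSum _ (coeffL ω H p.1 (hsOp hω a (hsOp hω b (modeL ω H p.2 h))))
  convert h3 using 2 with n
  rw [blk_op, ← blk_op hω b]
  rfl

/-- By Cauchy-Schwarz the squared norm of block `(j, l)` of the product is at most row `j` of `a`
times column `l` of `b`, and the double sum of these bounds factorises. -/
theorem exists_op_comp (hω : 0 < ω) (a b : HS H) :
    ∃ c : HS H, hsOp hω c = hsOp hω a ∘L hsOp hω b ∧ ‖c‖ ≤ ‖a‖ * ‖b‖ := by
  have hb : ∀ p, ‖blk (hsOp hω a ∘L hsOp hω b) p‖ ^ 2 ≤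
      (∑' n, ‖a (p.1, n)‖ ^ 2) * ∑' n, ‖b (n, p.2)‖ ^ 2 := fun p => by
    rw [(blk_comp_hasSum hω a b p).2.2]; exact (blk_comp_hasSum hω a b p).2.1
  have hm : Summable fun p : ℤ × ℤ =>
      (∑' n, ‖a (p.1, n)‖ ^ 2) * ∑' n, ‖b (n, p.2)‖ ^ 2 :=
    a.summable_rows.mul_of_nonneg b.summable_cols (fun _ => tsum_nonneg fun _ => sq_nonneg _)
      (fun _ => tsum_nonneg fun _ => sq_nonneg _)
  have hs := Summable.of_nonneg_of_le (fun p => sq_nonneg _) hb hm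
  refine ⟨HS.mk _ hs, ext_blk hω fun p => by rw [blk_op, HS.mk_apply], ?_⟩
  refine (sq_le_sq₀ (norm_nonneg _) (by positivity)).1 ?_
  rw [← (HS.hasSum_sq _).tsum_eq, mul_pow, ← a.tsum_rows, ← b.tsum_cols,
    a.summable_rows.tsum_mul_tsum b.summable_cols hm]
  exact hs.tsum_le_tsum hb hm

/-- The product of Hilbert-Schmidt block matrices. -/
def mulHS (hω : 0 < ω) (a b : HS H) : HS H := (exists_op_comp hω a b).choose

theorem op_mulHS (hω : 0 < ω) (a b : HS H) : hsOp hω (mulHS hω a b) = hsOp hω a ∘L hsOp hω b :=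
  (exists_op_comp hω a b).choose_spec.1

/-- Multiplication of Hilbert-Schmidt block matrices as a bounded bilinear map. -/
def mulL (hω : 0 < ω) : HS H →L[ℂ] HS H →L[ℂ] HS H :=
  LinearMap.mkContinuous₂
    (LinearMap.mk₂ ℂ (mulHS hω)
      (fun a a' b => op_injective hω (by
        rw [map_add, op_mulHS, op_mulHS, op_mulHS, map_add, ContinuousLinearMap.add_comp]))
      (fun c a b => op_injective hω (by
        rw [map_smul, op_mulHS, op_mulHS, map_smul, ContinuousLinearMap.smul_comp]))
      (fun a b b' => op_injective hω (by
        rw [map_add, op_mulHS, op_mulHS, op_mulHS, map_add, ContinuousLinearMap.comp_add]))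
      (fun c a b => op_injective hω (by
        rw [map_smul, op_mulHS, op_mulHS, map_smul, ContinuousLinearMap.comp_smul]))) 1
    fun a b => by
      rw [one_mul]; exact (exists_op_comp hω a b).choose_spec.2

theorem op_mulL (hω : 0 < ω) (a b : HS H) : hsOp hω (mulL hω a b) = hsOp hω a ∘L hsOp hω b :=
  (exists_op_comp hω a b).choose_spec.1

theorem norm_mulL_le (hω : 0 < ω) (a b : HS H) : ‖mulL hω a b‖ ≤ ‖a‖ * ‖b‖ :=
  (exists_op_comp hω a b).choose_spec.2

theorem HS.summable_smul_sq {φ : ℤ × ℤ → ℂ} {C : ℝ} (hφ : ∀ p, ‖φ p‖ ≤ C) (a : HS H) :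
    Summable fun p => ‖φ p • a p‖ ^ 2 := by
  refine Summable.of_nonneg_of_le (fun p => sq_nonneg _) (fun p => ?_)
    (a.summable_sq.mul_left (C ^ 2))
  rw [norm_smul, mul_pow]
  gcongr
  exact hφ p

/-- The Schur multiplier with a bounded symbol. -/
def schur (φ : ℤ × ℤ → ℂ) {C : ℝ} (hφ : ∀ p, ‖φ p‖ ≤ C) : HS H →L[ℂ] HS H :=
  LinearMap.mkContinuous
    { toFun := fun a => HS.mk (fun p => φ p • a p) (HS.summable_smul_sq hφ a)
      map_add' := fun a b => lp.ext (funext fun p => smul_add _ _ _)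
      map_smul' := fun c a => lp.ext (funext fun p => smul_comm (φ p) c (a p)) } C fun a => by
        refine HS.norm_le_mul ((norm_nonneg _).trans (hφ 0)) fun p => ?_
        change ‖φ p • a p‖ ≤ _
        rw [norm_smul]
        gcongr
        exact hφ p

@[simp] theorem schur_apply (φ : ℤ × ℤ → ℂ) {C : ℝ} (hφ : ∀ p, ‖φ p‖ ≤ C) (a : HS H) (p : ℤ × ℤ) :
    schur φ hφ a p = φ p • a p := rfl

theorem norm_indicator_one_le (s : Set (ℤ × ℤ)) (p : ℤ × ℤ) :
    ‖s.indicator (fun _ => (1 : ℂ)) p‖ ≤ 1 := by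
  by_cases h : p ∈ s <;> simp [h]

/-- The restriction of a block matrix to a set of indices. -/
def cut (s : Set (ℤ × ℤ)) : HS H →L[ℂ] HS H :=
  schur (s.indicator fun _ => 1) (norm_indicator_one_le s)

open Classical in
theorem cut_apply (s : Set (ℤ × ℤ)) (a : HS H) (p : ℤ × ℤ) :
    cut s a p = if p ∈ s then a p else 0 := by
  change s.indicator (fun _ => (1 : ℂ)) p • a p = _
  by_cases h : p ∈ s <;> simp [h]

theorem norm_cut_le (s : Set (ℤ × ℤ)) (a : HS H) : ‖cut s a‖ ≤ ‖a‖ := by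
  rw [← one_mul ‖a‖]
  refine HS.norm_le_mul zero_le_one fun p => ?_
  rw [cut_apply]
  split_ifs <;> simp

/-- Dominated convergence, with the squared block norms of `a` as majorant. All smallness in the
proof that comes from tails of Hilbert-Schmidt matrices rests on this. -/
theorem tendsto_norm_cut {ι : Type*} {f : Filter ι} (s : ι → Set (ℤ × ℤ))
    (hs : ∀ p, ∀ᶠ i in f, p ∉ s i) (a : HS H) :
    Tendsto (fun i => ‖cut (s i) a‖) f (𝓝 0) := by
  have h1 : Tendsto (fun i => ∑' p, ‖cut (s i) a p‖ ^ 2) f (𝓝 (∑' _ : ℤ × ℤ, (0 : ℝ))) := by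
    refine tendsto_tsum_of_dominated_convergence a.summable_sq (fun p => ?_)
      (Eventually.of_forall fun i p => ?_)
    · refine tendsto_const_nhds.congr' ?_
      filter_upwards [hs p] with i hi
      rw [cut_apply, if_neg hi]
      simp
    · rw [Real.norm_of_nonneg (sq_nonneg _), cut_apply]
      split_ifs
      · exact le_rfl
      · simp
  simp only [(HS.hasSum_sq _).tsum_eq, tsum_zero] at h1
  have h2 := h1.sqrt
  simpa only [Real.sqrt_sq (norm_nonneg _), Real.sqrt_zero] using h2

theorem cut_add_cut_compl (s : Set (ℤ × ℤ)) (a : HS H) : cut s a + cut sᶜ a = a := by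
  refine lp.ext (funext fun p => ?_)
  rw [lp.coeFn_add, Pi.add_apply, cut_apply, cut_apply]
  by_cases h : p ∈ s <;> simp [h]

/-! ### Block projections -/

/-- `∑_{ℓ ∈ F} P_ℓ`. -/
def projF (ω : ℝ) (H : Type*) [NormedAddCommGroup H] [InnerProductSpace ℂ H] [CompleteSpace H]
    (F : Finset ℤ) : L2 ω H →L[ℂ] L2 ω H := ∑ l ∈ F, proj ω H l

theorem coeffL_proj (hω : 0 < ω) (j l : ℤ) (x : L2 ω H) :
    coeffL ω H j (proj ω H l x) = if j = l then coeffL ω H j x else 0 := by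
  rw [proj, ContinuousLinearMap.comp_apply, coeffL_modeL hω]
  split_ifs with h
  · rw [h]
  · rfl

theorem coeffL_projF (hω : 0 < ω) (F : Finset ℤ) (j : ℤ) (x : L2 ω H) :
    coeffL ω H j (projF ω H F x) = if j ∈ F then coeffL ω H j x else 0 := by
  simp only [projF, sum_apply, map_sum, coeffL_proj hω, Finset.sum_ite_eq]

theorem projF_modeL (hω : 0 < ω) (F : Finset ℤ) (l : ℤ) (h : H) :
    projF ω H F (modeL ω H l h) = if l ∈ F then modeL ω H l h else 0 := by
  refine ext_coeffL hω fun j => ?_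
  rw [coeffL_projF hω]
  by_cases hl : l ∈ F <;> by_cases hj : j = l <;> simp_all [coeffL_modeL hω]

theorem projF_projF (hω : 0 < ω) (F : Finset ℤ) (x : L2 ω H) :
    projF ω H F (projF ω H F x) = projF ω H F x := by
  refine ext_coeffL hω fun j => ?_
  simp only [coeffL_projF hω]
  split_ifs <;> rfl

theorem op_comp_projF (hω : 0 < ω) (a : HS H) (F : Finset ℤ) :
    hsOp hω a ∘L projF ω H F = hsOp hω (cut {p | p.2 ∈ F} a) := by
  refine ext_blk hω fun p => ?_
  rw [blk_op, cut_apply, ← blk_op hω a]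
  ext h
  simp only [blk, ContinuousLinearMap.comp_apply, projF_modeL hω, Set.mem_ofPred_eq]
  split_ifs <;> simp

theorem projF_comp_op (hω : 0 < ω) (a : HS H) (F : Finset ℤ) :
    projF ω H F ∘L hsOp hω a = hsOp hω (cut {p | p.1 ∈ F} a) := by
  refine ext_blk hω fun p => ?_
  rw [blk_op, cut_apply, ← blk_op hω a]
  ext h
  simp only [blk, ContinuousLinearMap.comp_apply, coeffL_projF hω, Set.mem_ofPred_eq]
  split_ifs <;> simp

theorem memHS_projF_comp_comp_projF (hω : 0 < ω) (X : L2 ω H →L[ℂ] L2 ω H) (F : Finset ℤ) :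
    MemHS (projF ω H F ∘L X ∘L projF ω H F) := by
  rw [memHS_iff hω]
  refine summable_of_ne_finset_zero (s := F ×ˢ F) fun p hp => ?_
  have : blk (projF ω H F ∘L X ∘L projF ω H F) p = 0 := by
    ext h
    simp only [blk, ContinuousLinearMap.comp_apply, coeffL_projF hω, projF_modeL hω]
    rw [Finset.mem_product, not_and_or] at hp
    rcases hp with hp | hp <;> simp [hp]
  simp [this]

end HilbertSchmidt


/-! ### Inverses of `I + W` and conjugated projections -/

section Inverse

variable {H : Type*} [NormedAddCommGroup H] [InnerProductSpace ℂ H] [CompleteSpace H] {ω : ℝ}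

theorem isUnit_one_add_of_norm_lt_one {R : Type*} [NormedRing R] [HasSummableGeomSeries R] {x : R}
    (h : ‖x‖ < 1) : IsUnit (1 + x) := by
  have := isUnit_one_sub_of_norm_lt_one (x := -x) (by rwa [norm_neg])
  rwa [sub_neg_eq_add] at this

theorem op_mulL_eq_mul (hω : 0 < ω) (a b : HS H) : hsOp hω (mulL hω a b) = hsOp hω a * hsOp hω b :=
  op_mulL hω a b

/-- The Neumann series is run for left multiplication on the Hilbert-Schmidt space itself, so the
solution stays in that space. -/
theorem exists_add_mulL_eq (hω : 0 < ω) {w : HS H} (hw : ‖w‖ < 1) (m : HS H) :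
    ∃ x : HS H, x + mulL hω w x = m := by
  have h1 : ‖mulL hω w‖ < 1 := lt_of_le_of_lt
    (ContinuousLinearMap.opNorm_le_bound _ (norm_nonneg w) fun b => norm_mulL_le hω w b) hw
  obtain ⟨T, hT⟩ := isUnit_one_add_of_norm_lt_one (R := HS H →L[ℂ] HS H) h1
  refine ⟨(↑T⁻¹ : HS H →L[ℂ] HS H) m, ?_⟩
  have h2 : ((T : HS H →L[ℂ] HS H) * (↑T⁻¹ : HS H →L[ℂ] HS H)) m = m := by
    rw [T.mul_inv]; rfl
  rw [hT] at h2
  exact h2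

theorem exists_one_add_op_inverse (hω : 0 < ω) {w : HS H} (hw : ‖w‖ < 1) :
    ∃ s : HS H, (1 + hsOp hω w) * (1 + hsOp hω s) = 1 ∧ (1 + hsOp hω s) * (1 + hsOp hω w) = 1 := by
  obtain ⟨s, hs⟩ := exists_add_mulL_eq hω hw (-w)
  have h1 : (1 + hsOp hω w) * (1 + hsOp hω s) = 1 := by
    have := congrArg (hsOp hω) hs
    rw [map_add, op_mulL_eq_mul, map_neg] at this
    calc (1 + hsOp hω w) * (1 + hsOp hω s) = 1 + hsOp hω w + (hsOp hω s + hsOp hω w * hsOp hω s) := by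
          noncomm_ring
      _ = 1 := by rw [this]; abel
  obtain ⟨T, hT⟩ := isUnit_one_add_of_norm_lt_one ((norm_op_le hω w).trans_lt hw)
  refine ⟨s, h1, ?_⟩
  rw [← hT] at h1 ⊢
  rw [T.mul_eq_one_iff_inv_eq.1 h1 |>.symm, T.inv_mul]

theorem MemHS.add (hω : 0 < ω) {X Y : L2 ω H →L[ℂ] L2 ω H} (hX : MemHS X) (hY : MemHS Y) :
    MemHS (X + Y) := by
  obtain ⟨a, rfl⟩ := hX.exists_op hω
  obtain ⟨b, rfl⟩ := hY.exists_op hω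
  rw [← map_add]
  exact memHS_op hω _

theorem MemHS.sub (hω : 0 < ω) {X Y : L2 ω H →L[ℂ] L2 ω H} (hX : MemHS X) (hY : MemHS Y) :
    MemHS (X - Y) := by
  obtain ⟨a, rfl⟩ := hX.exists_op hω
  obtain ⟨b, rfl⟩ := hY.exists_op hω
  rw [← map_sub]
  exact memHS_op hω _

theorem MemHS.mul (hω : 0 < ω) {X Y : L2 ω H →L[ℂ] L2 ω H} (hX : MemHS X) (hY : MemHS Y) :
    MemHS (X * Y) := by
  obtain ⟨a, rfl⟩ := hX.exists_op hω
  obtain ⟨b, rfl⟩ := hY.exists_op hω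
  rw [← op_mulL_eq_mul]
  exact memHS_op hω _

theorem projF_mul_self (hω : 0 < ω) (F : Finset ℤ) :
    projF ω H F * projF ω H F = projF ω H F :=
  ContinuousLinearMap.ext (projF_projF hω F)

/-- The symmetric interval `{-k, …, k}`. -/
def sym (k : ℕ) : Finset ℤ := Finset.Icc (-(k : ℤ)) k

theorem mem_sym {k : ℕ} {l : ℤ} : l ∈ sym k ↔ |l| ≤ k := by
  rw [sym, Finset.mem_Icc, abs_le]

theorem eventually_mem_sym (l : ℤ) : ∀ᶠ k in atTop, l ∈ sym k := by
  filter_upwards [eventually_ge_atTop l.natAbs] with k hk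
  rw [mem_sym, Int.abs_eq_natAbs]; omega

theorem exists_box (a : HS H) {ε : ℝ} (hε : 0 < ε) :
    ∃ m : ℕ, ‖a - cut {p | p.1 ∈ sym m ∧ p.2 ∈ sym m} a‖ < ε := by
  have h := tendsto_norm_cut (f := atTop) (fun m : ℕ => {p | p.1 ∈ sym m ∧ p.2 ∈ sym m}ᶜ)
    (fun p => by
      filter_upwards [eventually_mem_sym p.1, eventually_mem_sym p.2] with k h1 h2
      exact fun h => h ⟨h1, h2⟩) a
  obtain ⟨m, hm⟩ := (h.eventually (gt_mem_nhds hε)).exists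
  refine ⟨m, ?_⟩
  rwa [sub_eq_of_eq_add' (cut_add_cut_compl _ a).symm]

/-- The operators `I + W` with `W` Hilbert-Schmidt are inverse closed. -/
theorem MemHS.inverse (hω : 0 < ω) {U U' : L2 ω H →L[ℂ] L2 ω H} (h1 : U * U' = 1) (h2 : U' * U = 1)
    (hU : MemHS (U - 1)) : MemHS (U' - 1) := by
  obtain ⟨w, hw⟩ := hU.exists_op hω
  -- For infinite-dimensional `H` the class is not an ideal in the bounded operators, so `U' - 1 =
  -- -U' W` proves nothing. Instead `W` is split into a part of norm below one, which inverts within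
  -- the class, and a part `wm` with finitely many blocks.
  obtain ⟨m, hm⟩ := exists_box w one_pos
  set wm := cut {p | p.1 ∈ sym m ∧ p.2 ∈ sym m} w
  obtain ⟨s, hs1, hs2⟩ := exists_one_add_op_inverse hω hm
  set P := projF ω H (sym m)
  have hP : P * P = P := projF_mul_self hω _
  have hwm : hsOp hω wm * P = hsOp hω wm := by
    rw [ContinuousLinearMap.mul_def, op_comp_projF]
    congr 1
    refine lp.ext (funext fun p => ?_)
    simp only [wm, cut_apply, Set.mem_ofPred_eq]
    split_ifs with h h' <;> simp_all
  have hUe : U = 1 + hsOp hω (w - wm) + hsOp hω wm := by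
    rw [map_sub, hw]; abel
  set A := 1 + hsOp hω (w - wm)
  set S := 1 + hsOp hω s
  set F := S * hsOp hω wm with hF
  have hFP : F * P = F := by rw [hF, mul_assoc, hwm]
  have hSU : S * U = 1 + F := by rw [hUe, mul_add, hs2]
  set G := 1 - U' * A with hG
  have e1 : (1 + F) * (1 - G) = 1 := by
    rw [← hSU, hG, sub_sub_cancel]
    calc S * U * (U' * A) = S * (U * U') * A := by noncomm_ring
      _ = 1 := by rw [h1, mul_one, hs2]
  have e2 : (1 - G) * (1 + F) = 1 := by
    rw [← hSU, hG, sub_sub_cancel]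
    calc U' * A * (S * U) = U' * (A * S) * U := by noncomm_ring
      _ = 1 := by rw [hs1, mul_one, h2]
  have e3 : G = F - F * G := by
    have : F - G - F * G = 0 := by
      calc F - G - F * G = (1 + F) * (1 - G) - 1 := by noncomm_ring
        _ = 0 := by rw [e1, sub_self]
    rw [← sub_eq_zero, ← neg_eq_zero, ← this]; abel
  have e4 : G = (1 - G) * F := by
    have : (1 - G) * F - G = (1 - G) * (1 + F) - 1 := by noncomm_ring
    rw [e2, sub_self, sub_eq_zero] at this
    exact this.symm
  have hGP : G * P = G := by rw [e4, mul_assoc, hFP]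
  have hFm : MemHS F := by
    rw [hF, show S * hsOp hω wm = hsOp hω wm + hsOp hω s * hsOp hω wm by rw [add_mul, one_mul]]
    exact (memHS_op hω _).add hω ((memHS_op hω _).mul hω (memHS_op hω _))
  have hGm : MemHS G := by
    -- Because `F` and `G` both absorb `P` on the right, the a priori only bounded `G` enters
    -- through `P G P`, which has finitely many nonzero blocks and hence lies in the class.
    rw [e3, show F * G = F * (P * G * P) by
      rw [mul_assoc P, hGP, ← mul_assoc, hFP]]
    exact hFm.sub hω (hFm.mul hω (memHS_projF_comp_comp_projF hω G (sym m)))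
  have hU' : U' = (1 - G) * S := by
    rw [hG, sub_sub_cancel, mul_assoc, hs1, mul_one]
  have : U' - 1 = hsOp hω s - G - G * hsOp hω s := by rw [hU']; simp only [S]; noncomm_ring
  rw [this]
  exact ((memHS_op hω _).sub hω hGm).sub hω (hGm.mul hω (memHS_op hω _))

theorem mulL_mono (hω : 0 < ω) {a b : HS H} {α β : ℝ} (ha : ‖a‖ ≤ α) (hb : ‖b‖ ≤ β) :
    ‖mulL hω a b‖ ≤ α * β :=
  (norm_mulL_le hω a b).trans (mul_le_mul ha hb (norm_nonneg _) ((norm_nonneg _).trans ha))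

/-- For `U = I + W` with `W` Hilbert-Schmidt, `U P_n U⁻¹ - P_n` is Hilbert-Schmidt and tends to `0`
as the projections `P_n` exhaust the space. -/
theorem tendsto_hsNorm_conj_projF (hω : 0 < ω) {U U' : L2 ω H →L[ℂ] L2 ω H} (h1 : U * U' = 1)
    (h2 : U' * U = 1) (hU : MemHS (U - 1)) (F : ℕ → Finset ℤ) (hF : ∀ l, ∀ᶠ n in atTop, l ∈ F n) :
    (∀ n, MemHS (U * projF ω H (F n) * U' - projF ω H (F n))) ∧
      Tendsto (fun n => hsNorm (U * projF ω H (F n) * U' - projF ω H (F n))) atTop (𝓝 0) := by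
  obtain ⟨w, hw⟩ := hU.exists_op hω
  obtain ⟨w', hw'⟩ := (hU.inverse hω h1 h2).exists_op hω
  have hUw : U = 1 + hsOp hω w := by rw [hw]; abel
  have hUw' : U' = 1 + hsOp hω w' := by rw [hw']; abel
  have hz : w + w' + mulL hω w w' = 0 := by
    refine op_injective hω ?_
    rw [map_add, map_add, map_zero, op_mulL_eq_mul]
    calc hsOp hω w + hsOp hω w' + hsOp hω w * hsOp hω w' = (1 + hsOp hω w) * (1 + hsOp hω w') - 1 := by
          noncomm_ring
      _ = 0 := by rw [← hUw, ← hUw', h1, sub_self]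
  let e : ℕ → HS H := fun n => cut {p | p.2 ∈ F n} w + cut {p | p.1 ∈ F n} w' +
    mulL hω w (cut {p | p.1 ∈ F n} w')
  have he : ∀ n, U * projF ω H (F n) * U' - projF ω H (F n) = hsOp hω (e n) := fun n => by
    simp only [e, map_add, op_mulL_eq_mul, ← op_comp_projF, ← projF_comp_op, hUw, hUw',
      ← ContinuousLinearMap.mul_def]
    noncomm_ring
  refine ⟨fun n => by rw [he]; exact memHS_op hω _, ?_⟩
  simp only [he, hsNorm_op]
  -- Subtracting `w + w' + w w' = 0` from `e n` turns each cut into minus the complementary cut,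
  -- whose norm tends to zero.
  have he' : ∀ n, ‖e n‖ ≤ ‖cut {p | p.2 ∈ F n}ᶜ w‖ + ‖cut {p | p.1 ∈ F n}ᶜ w'‖ +
      ‖w‖ * ‖cut {p | p.1 ∈ F n}ᶜ w'‖ := fun n => by
    have e1 := eq_sub_of_add_eq (cut_add_cut_compl {p | p.2 ∈ F n} w)
    have e2 := eq_sub_of_add_eq (cut_add_cut_compl {p | p.1 ∈ F n} w')
    have : e n = -(cut {p | p.2 ∈ F n}ᶜ w) - cut {p | p.1 ∈ F n}ᶜ w' -
        mulL hω w (cut {p | p.1 ∈ F n}ᶜ w') := by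
      simp only [e]
      rw [e1, e2, map_sub, ← sub_eq_zero, ← hz]
      abel
    rw [this]
    refine (norm_sub_le _ _).trans (add_le_add ((norm_sub_le _ _).trans ?_) (norm_mulL_le hω _ _))
    rw [norm_neg]
  have t1 := tendsto_norm_cut (f := atTop) (fun n => {p : ℤ × ℤ | p.2 ∈ F n}ᶜ) (fun p => by
    filter_upwards [hF p.2] with n hn using not_not.2 hn) w
  have t2 := tendsto_norm_cut (f := atTop) (fun n => {p : ℤ × ℤ | p.1 ∈ F n}ᶜ) (fun p => by
    filter_upwards [hF p.1] with n hn using not_not.2 hn) w'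
  refine squeeze_zero (fun n => norm_nonneg _) he' ?_
  simpa using (t1.add t2).add (t2.const_mul ‖w‖)

end Inverse


/-! ### Domains of `d/ds` and of the potential -/

section Domain

variable {H : Type*} [NormedAddCommGroup H] [InnerProductSpace ℂ H] [CompleteSpace H] {ω : ℝ}

theorem lam_sub (ω : ℝ) (j l : ℤ) : lam ω j - lam ω l = lam ω (j - l) := by
  simp only [lam]; push_cast; ring

theorem norm_lam (hω : 0 < ω) (l : ℤ) : ‖lam ω l‖ = 2 * Real.pi / ω * |(l : ℝ)| := by
  rw [lam, norm_mul, Complex.norm_I, one_mul, Complex.norm_real, Real.norm_eq_abs, abs_div,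
    abs_mul, abs_of_pos hω, abs_of_pos (by positivity)]
  ring

theorem norm_sq_sub_lam (hω : 0 < ω) (t : ℝ) (l : ℤ) :
    ‖(t : ℂ) - lam ω l‖ ^ 2 = t ^ 2 + (2 * Real.pi / ω) ^ 2 * (l : ℝ) ^ 2 := by
  rw [← Complex.normSq_eq_norm_sq, Complex.normSq_apply]
  simp only [lam, Complex.sub_re, Complex.ofReal_re, Complex.mul_re, Complex.I_re, Complex.I_im,
    Complex.ofReal_im, Complex.sub_im, Complex.mul_im]
  field_simp
  ring

theorem summable_inv_int_sq : Summable fun l : ℤ => ((l : ℝ) ^ 2)⁻¹ := by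
  simpa using Real.summable_one_div_int_pow (p := 2) |>.2 one_lt_two

/-- `∑_l |t - λ_l|⁻²` is finite and tends to `0` as `t → ∞`. -/
theorem tendsto_tsum_inv_norm_sub_lam (hω : 0 < ω) :
    (∀ t : ℝ, 0 < t → Summable fun l : ℤ => (‖(t : ℂ) - lam ω l‖⁻¹) ^ 2) ∧
      Tendsto (fun t : ℝ => ∑' l : ℤ, (‖(t : ℂ) - lam ω l‖⁻¹) ^ 2) atTop (𝓝 0) := by
  set c := 2 * Real.pi / ω
  have hc : 0 < c := by positivity
  -- For `l ≠ 0` the bound does not depend on `t`. The term `l = 0` is added by hand, since `0⁻¹ =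
  -- 0` makes the first summand vanish there. For `t ≥ 1`, `b 1` is a majorant.
  let b : ℝ → ℤ → ℝ := fun t l => (c ^ 2)⁻¹ * ((l : ℝ) ^ 2)⁻¹ + if l = 0 then (t ^ 2)⁻¹ else 0
  have hb : ∀ t : ℝ, Summable (b t) := fun t =>
    (summable_inv_int_sq.mul_left _).add (summable_of_ne_finset_zero (s := {0}) (by simp_all))
  have hle : ∀ t : ℝ, 0 < t → ∀ l : ℤ, (‖(t : ℂ) - lam ω l‖⁻¹) ^ 2 ≤ b t l := fun t ht l => by
    rw [inv_pow, norm_sq_sub_lam hω]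
    simp only [b]
    split_ifs with h
    · subst h; simp
    · rw [add_zero, ← mul_inv]
      have : (0 : ℝ) < (l : ℝ) ^ 2 := by positivity
      gcongr
      nlinarith
  refine ⟨fun t ht => Summable.of_nonneg_of_le (fun _ => by positivity) (hle t ht) (hb t), ?_⟩
  have key : Tendsto (fun t : ℝ => ∑' l : ℤ, (‖(t : ℂ) - lam ω l‖⁻¹) ^ 2) atTop
      (𝓝 (∑' _ : ℤ, (0 : ℝ))) := by
    refine tendsto_tsum_of_dominated_convergence (hb 1) (fun l => ?_) ?_
    · have h1 : Tendsto (fun t : ℝ => (t ^ 2)⁻¹) atTop (𝓝 0) :=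
        tendsto_inv_atTop_zero.comp (tendsto_pow_atTop two_ne_zero)
      refine squeeze_zero' (Eventually.of_forall fun t => by positivity) ?_ h1
      filter_upwards [eventually_gt_atTop 0] with t ht
      rw [inv_pow, norm_sq_sub_lam hω]
      gcongr
      nlinarith [sq_nonneg (2 * Real.pi / ω * l)]
    · filter_upwards [eventually_ge_atTop 1] with t ht l
      rw [Real.norm_of_nonneg (by positivity)]
      refine (hle t (by linarith) l).trans ?_
      simp only [b]
      gcongr
      simp only [one_pow, inv_one]
      split_ifs
      · exact inv_le_one_of_one_le₀ (one_le_pow₀ ht)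
      · exact le_rfl
  rwa [tsum_zero] at key

theorem sub_lam_ne_zero (hω : 0 < ω) {t : ℝ} (ht : 0 < t) (l : ℤ) : (t : ℂ) - lam ω l ≠ 0 := by
  have h := norm_sq_sub_lam hω t l
  intro h0
  rw [h0, norm_zero] at h
  nlinarith [sq_nonneg (2 * Real.pi / ω * l), pow_pos ht 2]

/-- The Fourier series of a function in the domain of `d/ds` is absolutely summable. -/
theorem summable_norm_coeffL_of_mem (hω : 0 < ω) {x g : L2 ω H} (hx : (x, g) ∈ derivGraph ω H)
    {t : ℝ} (ht : 0 < t) :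
    (Summable fun l => ‖coeffL ω H l x‖) ∧ (∑' l, ‖coeffL ω H l x‖) ^ 2 ≤
      (∑' l : ℤ, (‖(t : ℂ) - lam ω l‖⁻¹) ^ 2) * ‖(t : ℂ) • x - g‖ ^ 2 := by
  -- The coefficients of `x` are those of `t x - x'` divided by `t - λ_l`, so Cauchy-Schwarz
  -- applies.
  have h1 : ∀ l, ‖coeffL ω H l x‖ = ‖(t : ℂ) - lam ω l‖⁻¹ * ‖coeffL ω H l ((t : ℂ) • x - g)‖ :=
    fun l => by
      rw [map_sub, map_smul, (mem_derivGraph_iff hω).1 hx, ← sub_smul, norm_smul,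
        inv_mul_cancel_left₀ (norm_ne_zero_iff.2 (sub_lam_ne_zero hω ht l))]
  have h2 := summable_mul_and_sq_tsum_le (fun l => inv_nonneg.2 (norm_nonneg ((t : ℂ) - lam ω l)))
    (fun l => norm_nonneg (coeffL ω H l ((t : ℂ) • x - g)))
    ((tendsto_tsum_inv_norm_sub_lam hω).1 t ht) (summable_norm_coeffL_sq hω _)
  rw [tsum_norm_coeffL_sq hω] at h2
  simpa only [h1] using h2

namespace Potential

/-- Two successive subsequences converge almost everywhere in both components; reflection preserves
null sets, and each `𝒱(s)` is continuous. Closedness lets `V` be applied termwise to Fourier series.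
-/
theorem isClosed_graph (V : Potential ω H) : IsClosed (V.graph : Set (L2 ω H × L2 ω H)) := by
  refine IsSeqClosed.isClosed fun u p hu hp => ?_
  obtain ⟨n1, h1, hae1⟩ := (tendstoInMeasure_of_tendsto_Lp hp.fst_nhds).exists_seq_tendsto_ae
  obtain ⟨n2, h2, hae2⟩ := (tendstoInMeasure_of_tendsto_Lp
    (hp.snd_nhds.comp h1.tendsto_atTop)).exists_seq_tendsto_ae
  have hall : ∀ᵐ s ∂(muI ω), ∀ n, (u n).2 s = V.toFun s ((u n).1 (ω - s)) :=
    ae_all_iff.2 fun n => hu n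
  change p.2 =ᵐ[muI ω] fun s => V.toFun s (p.1 (ω - s))
  filter_upwards [ae_reflect hae1, hae2, hall] with s e1 e2 e3
  have e4 := ((V.toFun s).continuous.tendsto _).comp (e1.comp h2.tendsto_atTop)
  refine tendsto_nhds_unique e2 (e4.congr fun i => ?_)
  simp [e3]

theorem memLp_mulMode (V : Potential ω H) (l : ℤ) (h : H) :
    MemLp (fun s : ℝ => Complex.exp (-(lam ω l * s)) • V.toFun s h) 2 (muI ω) := by
  refine (V.memLp h).of_le
    ((continuous_exp_neg_lam ω l).aestronglyMeasurable.smul (V.memLp h).1)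
    (Eventually.of_forall fun s => ?_)
  rw [norm_smul, norm_exp_neg_lam, one_mul]

/-- The function `s ↦ e^{-2πils/ω} 𝒱(s)h`, the image under `V` of a mode. -/
def mulMode (V : Potential ω H) (l : ℤ) (h : H) : L2 ω H := (V.memLp_mulMode l h).toLp _

theorem mulMode_ae (V : Potential ω H) (l : ℤ) (h : H) :
    (V.mulMode l h : ℝ → H) =ᵐ[muI ω] fun s => Complex.exp (-(lam ω l * s)) • V.toFun s h :=
  MemLp.coeFn_toLp _

theorem evalL_ae (V : Potential ω H) (h : H) :
    (V.evalL h : ℝ → H) =ᵐ[muI ω] fun s => V.toFun s h := (V.memLp h).coeFn_toLp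

theorem norm_mulMode_le (V : Potential ω H) (l : ℤ) (h : H) :
    ‖V.mulMode l h‖ ≤ ‖V.evalL‖ * ‖h‖ := by
  refine le_trans (Lp.norm_le_norm_of_ae_le ?_) (V.evalL.le_opNorm h)
  filter_upwards [V.mulMode_ae l h, V.evalL_ae h] with s h1 h2
  rw [h1, h2, norm_smul, norm_exp_neg_lam, one_mul]

theorem mem_graph_mulMode (hω : 0 < ω) (V : Potential ω H) (l : ℤ) (h : H) :
    (modeL ω H l h, V.mulMode l h) ∈ V.graph := by
  change (V.mulMode l h : ℝ → H) =ᵐ[muI ω] fun s => V.toFun s (modeL ω H l h (ω - s))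
  filter_upwards [V.mulMode_ae l h, ae_reflect (modeL_ae (ω := ω) l h)] with s h1 h2
  rw [h1, h2, map_smul]
  congr 1
  push_cast
  rw [mul_sub, Complex.exp_sub, exp_lam_mul_omega hω, Complex.exp_neg, one_div]

/-- The reflection sends `e^{λ_l s}` to `e^{-λ_l s}`, hence the index `j + l` in place of `j - l`.
-/
theorem coeffL_mulMode (V : Potential ω H) (j l : ℤ) (h : H) :
    coeffL ω H j (V.mulMode l h) = V.coeff (j + l) h := by
  rw [coeff_apply, coeffL_eq_of_ae j (V.mulMode_ae l h)]
  refine integral_congr_ae (Eventually.of_forall fun s => ?_)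
  simp only [smul_smul, ← Complex.exp_add]
  congr 2
  simp only [lam]; push_cast; ring

/-- Functions with absolutely summable Fourier series belong to the domain of `V`. -/
theorem exists_mem_graph (hω : 0 < ω) (V : Potential ω H) {x : L2 ω H}
    (hx : Summable fun l => ‖coeffL ω H l x‖) :
    ∃ z, (x, z) ∈ V.graph ∧ ‖z‖ ≤ ‖V.evalL‖ * ∑' l, ‖coeffL ω H l x‖ ∧
      ∀ j, HasSum (fun l => V.coeff (j + l) (coeffL ω H l x)) (coeffL ω H j z) := by
  have hs : Summable fun l => ‖V.mulMode l (coeffL ω H l x)‖ :=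
    Summable.of_nonneg_of_le (fun _ => norm_nonneg _) (fun l => V.norm_mulMode_le l _)
      (hx.mul_left _)
  have hz := hs.of_norm.hasSum
  refine ⟨∑' l, V.mulMode l (coeffL ω H l x), ?_, ?_, fun j => ?_⟩
  · have h1 := (hasSum_modeL hω x).prodMk hz
    refine V.isClosed_graph.mem_of_tendsto h1 (Eventually.of_forall fun s => ?_)
    exact Submodule.sum_mem _ fun l _ => V.mem_graph_mulMode hω l _
  · refine (norm_tsum_le_tsum_norm hs).trans ?_
    rw [← tsum_mul_left]
    exact hs.tsum_le_tsum (fun l => V.norm_mulMode_le l _) (hx.mul_left _)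
  · simpa only [coeffL_mulMode] using hz.mapL (coeffL ω H j)

theorem graph_unique (V : Potential ω H) {x z z' : L2 ω H} (h : (x, z) ∈ V.graph)
    (h' : (x, z') ∈ V.graph) : z = z' := by
  refine Lp.ext ?_
  have h1 : z =ᵐ[muI ω] fun s => V.toFun s (x (ω - s)) := h
  have h2 : z' =ᵐ[muI ω] fun s => V.toFun s (x (ω - s)) := h'
  exact h1.trans h2.symm

end Potential

theorem mk_add_mk_mem {E : Type*} [AddCommGroup E] [Module ℂ E] {G : Submodule ℂ (E × E)}
    {x y x' y' : E} (h : (x, y) ∈ G) (h' : (x', y') ∈ G) : (x + x', y + y') ∈ G :=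
  G.add_mem h h'

/-- The commutator identity `L₀ W x = W L₀ x + D x`, where `D` has the blocks
`(λ_j - λ_l) W_{jl}`. -/
theorem op_mem_derivGraph (hω : 0 < ω) (w : HS H) {x g d : L2 ω H} (hx : (x, g) ∈ derivGraph ω H)
    (hd : ∀ j, HasSum (fun l => (lam ω j - lam ω l) • w (j, l) (coeffL ω H l x))
      (coeffL ω H j d)) : (hsOp hω w x, hsOp hω w g + d) ∈ derivGraph ω H := by
  refine (mem_derivGraph_iff hω).2 fun j => ?_
  have h1 := (w.apply_summable hω x j).1.of_norm.hasSum
  have h2 := (w.apply_summable hω g j).1.of_norm.hasSum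
  rw [← coeffL_op hω] at h1 h2
  rw [map_add]
  refine (h2.add (hd j)).unique ?_
  convert h1.const_smul (lam ω j) using 2 with l
  rw [(mem_derivGraph_iff hω).1 hx, map_smul, sub_smul]
  abel

end Domain


/-! ### Block diagonalisation of Hilbert-Schmidt perturbations -/

section Steps

variable {H : Type*} [NormedAddCommGroup H] [InnerProductSpace ℂ H] [CompleteSpace H] {ω : ℝ}

/-- The off-diagonal indices outside the central box of size `k`. -/
def offDiag (k : ℕ) : Set (ℤ × ℤ) := {p | p.1 ≠ p.2 ∧ ¬(p.1 ∈ sym k ∧ p.2 ∈ sym k)}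

theorem sym_mono {m k : ℕ} (h : m ≤ k) {l : ℤ} (hl : l ∈ sym m) : l ∈ sym k := by
  rw [mem_sym] at hl ⊢; omega

theorem eventually_notMem_offDiag (p : ℤ × ℤ) : ∀ᶠ k in atTop, p ∉ offDiag k := by
  filter_upwards [eventually_mem_sym p.1, eventually_mem_sym p.2] with k h1 h2
  exact fun h => h.2 ⟨h1, h2⟩

theorem norm_inv_lam_sub (hω : 0 < ω) (p : ℤ × ℤ) :
    ‖(lam ω p.1 - lam ω p.2)⁻¹‖ = ω / (2 * Real.pi) * |((p.1 - p.2 : ℤ) : ℝ)|⁻¹ := by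
  rw [norm_inv, lam_sub, norm_lam hω, mul_inv, inv_div]

open Classical in
/-- The symbol of the operation `Γ_k` inverting the commutator with `d/ds`. -/
def gam (ω : ℝ) (k : ℕ) (p : ℤ × ℤ) : ℂ :=
  if p ∈ offDiag k then (lam ω p.1 - lam ω p.2)⁻¹ else 0

theorem one_le_abs_intCast {n : ℤ} (hn : n ≠ 0) : (1 : ℝ) ≤ |(n : ℝ)| := by
  exact_mod_cast Int.one_le_abs hn

theorem norm_gam_le (hω : 0 < ω) (k : ℕ) (p : ℤ × ℤ) : ‖gam ω k p‖ ≤ ω / (2 * Real.pi) := by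
  have h0 : 0 ≤ ω / (2 * Real.pi) := by positivity
  rw [gam]
  split_ifs with h
  · rw [norm_inv_lam_sub hω]
    exact mul_le_of_le_one_right h0
      (inv_le_one_of_one_le₀ (one_le_abs_intCast (sub_ne_zero.2 h.1)))
  · simpa using h0

theorem lam_sub_mul_gam (hω : 0 < ω) (k : ℕ) {p : ℤ × ℤ} (hp : p ∈ offDiag k) :
    (lam ω p.1 - lam ω p.2) * gam ω k p = 1 := by
  rw [gam, if_pos hp, mul_inv_cancel₀]
  rw [lam_sub]
  exact mt (lam_eq_zero_iff hω).1 (sub_ne_zero.2 hp.1)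

/-- The operation `Γ_k` on Hilbert-Schmidt block matrices. -/
def Gam (hω : 0 < ω) (k : ℕ) : HS H →L[ℂ] HS H := schur (gam ω k) (norm_gam_le hω k)

/-- The commutator identity `L₀ Γ_k a - (Γ_k a) L₀ = a - J_k a` on the domain of `d/ds`. -/
theorem Gam_mem_derivGraph (hω : 0 < ω) (k : ℕ) (a : HS H) {x g : L2 ω H}
    (hx : (x, g) ∈ derivGraph ω H) :
    (hsOp hω (Gam hω k a) x, hsOp hω (Gam hω k a) g + hsOp hω (cut (offDiag k) a) x) ∈
      derivGraph ω H := by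
  refine op_mem_derivGraph hω _ hx fun j => ?_
  rw [coeffL_op]
  convert ((cut (offDiag k) a).apply_summable hω x j).1.of_norm.hasSum using 2 with l
  rw [cut_apply, Gam, schur_apply]
  split_ifs with h
  · rw [smul_apply, smul_smul, lam_sub_mul_gam hω k h, one_smul]
  · simp [gam, h]

theorem norm_Gam_le (hω : 0 < ω) (k : ℕ) (Z : HS H) :
    ‖Gam hω k Z‖ ≤ ω / (2 * Real.pi) * ‖Z‖ := by
  refine HS.norm_le_mul (by positivity) fun p => ?_
  rw [Gam, schur_apply, norm_smul]
  gcongr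
  exact norm_gam_le hω k p

/-- An index pair where `Γ_k` acts and one index is at most `m` has the other one beyond `k`, so the
divisor is large. -/
theorem norm_gam_le_of_lt (hω : 0 < ω) {m k : ℕ} (hmk : m < k) {p : ℤ × ℤ}
    (hp : p.1 ∈ sym m ∨ p.2 ∈ sym m) :
    ‖gam ω k p‖ ≤ ω / (2 * Real.pi) * ((k : ℝ) - m)⁻¹ := by
  have hmk' : (0 : ℝ) < k - m := by rw [sub_pos]; exact_mod_cast hmk
  rw [gam]
  split_ifs with h
  · rw [norm_inv_lam_sub hω]
    gcongr
    have h2 : (k : ℤ) - m ≤ |p.1 - p.2| := by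
      have h3 := h.2
      rw [mem_sym, mem_sym] at hp h3
      rw [Int.abs_eq_natAbs] at *
      rw [Int.abs_eq_natAbs] at hp h3
      omega
    exact_mod_cast h2
  · rw [norm_zero]; positivity

theorem norm_cut_Gam_le (hω : 0 < ω) {m k : ℕ} (hmk : m < k) {s : Set (ℤ × ℤ)}
    (hs : ∀ p ∈ s, p.1 ∈ sym m ∨ p.2 ∈ sym m) (Z : HS H) :
    ‖cut s (Gam hω k Z)‖ ≤ ω / (2 * Real.pi) * ((k : ℝ) - m)⁻¹ * ‖Z‖ := by
  have hmk' : (0 : ℝ) < k - m := by rw [sub_pos]; exact_mod_cast hmk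
  refine HS.norm_le_mul (by positivity) fun p => ?_
  rw [cut_apply]
  split_ifs with h
  · rw [Gam, schur_apply, norm_smul]
    gcongr
    exact norm_gam_le_of_lt hω hmk (hs p h)
  · rw [norm_zero]; positivity

theorem cut_cut (s t : Set (ℤ × ℤ)) (a : HS H) : cut s (cut t a) = cut (s ∩ t) a := by
  refine lp.ext (funext fun p => ?_)
  rw [cut_apply, cut_apply, cut_apply]
  by_cases hs : p ∈ s
  · by_cases ht : p ∈ t
    · rw [if_pos hs, if_pos ht, if_pos (Set.mem_inter hs ht)]
    · rw [if_pos hs, if_neg ht, if_neg fun h => ht h.2]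
  · rw [if_neg hs, if_neg fun h => hs h.1]

theorem Gam_cut_box (hω : 0 < ω) {m k : ℕ} (hmk : m < k) (a : HS H) :
    Gam hω k (cut {p | p.1 ∈ sym m ∧ p.2 ∈ sym m} a) = 0 := by
  refine lp.ext (funext fun p => ?_)
  rw [Gam, schur_apply, cut_apply, gam]
  split_ifs with h h'
  · exact absurd ⟨sym_mono hmk.le h'.1, sym_mono hmk.le h'.2⟩ h.2
  · exact smul_zero _
  · exact zero_smul ..
  · exact zero_smul ..

/-- Multiplication by a fixed block matrix is small on the range of `Γ_k`. -/
theorem exists_norm_mulL_Gam_le (hω : 0 < ω) (C : HS H) {η : ℝ} (hη : 0 < η) :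
    ∃ k : ℕ, (∀ Z : HS H, ‖mulL hω C (Gam hω k Z)‖ ≤ η * ‖Z‖) ∧
      (∀ Z : HS H, ‖mulL hω (Gam hω k Z) (cut (offDiag k)ᶜ C)‖ ≤ η * ‖Z‖) ∧
      ‖Gam hω k C‖ ≤ η := by
  set γ := ω / (2 * Real.pi)
  have hγ : 0 < γ := by positivity
  -- Off the box, `C` has norm below `η / (2γ)` and costs at most half of `η`. The box part meets
  -- only rows, or columns, of `Γ_k Z` with index at most `m`, where the symbol is at most `γ / (k -
  -- m)`; a large `k` makes this the other half.
  obtain ⟨m, hm⟩ := exists_box C (ε := η / (2 * γ)) (by positivity)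
  set Cm := cut {p | p.1 ∈ sym m ∧ p.2 ∈ sym m} C with hCm
  obtain ⟨k, hmk, hk⟩ : ∃ k : ℕ, m < k ∧ ‖C‖ * (γ * ((k : ℝ) - m)⁻¹) ≤ η / 2 := by
    have : Tendsto (fun k : ℕ => ‖C‖ * (γ * ((k : ℝ) - m)⁻¹)) atTop (𝓝 (‖C‖ * (γ * 0))) := by
      refine ((Tendsto.inv_tendsto_atTop ?_).const_mul γ).const_mul _
      exact tendsto_atTop_add_const_right _ _ tendsto_natCast_atTop_atTop
    rw [mul_zero, mul_zero] at this
    obtain ⟨k, h1, h2⟩ := ((eventually_gt_atTop m).and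
      (this.eventually (ge_mem_nhds (by positivity : 0 < η / 2)))).exists
    exact ⟨k, h1, h2⟩
  have hγε : γ * (η / (2 * γ)) = η / 2 := by field_simp
  have hCmc : ‖Cm‖ ≤ ‖C‖ := norm_cut_le _ _
  have hCmR : hsOp hω Cm * projF ω H (sym m) = hsOp hω Cm := by
    rw [ContinuousLinearMap.mul_def, op_comp_projF, hCm, cut_cut]
    rw [Set.inter_eq_right.2 fun p hp => hp.2]
  have hCmL : projF ω H (sym m) * hsOp hω Cm = hsOp hω Cm := by
    rw [ContinuousLinearMap.mul_def, projF_comp_op, hCm, cut_cut]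
    rw [Set.inter_eq_right.2 fun p hp => hp.1]
  have hsum : ∀ x : ℝ, 0 ≤ x → γ * x * (η / (2 * γ)) + ‖C‖ * (γ * ((k : ℝ) - m)⁻¹ * x) ≤ η * x :=
    fun x hx => by nlinarith
  refine ⟨k, fun Z => ?_, fun Z => ?_, ?_⟩
  · have e : mulL hω C (Gam hω k Z) = mulL hω (C - Cm) (Gam hω k Z) +
        mulL hω Cm (cut {p | p.1 ∈ sym m} (Gam hω k Z)) := by
      refine op_injective hω ?_
      rw [map_add, op_mulL_eq_mul, op_mulL_eq_mul, op_mulL_eq_mul, ← projF_comp_op, map_sub,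
        ← ContinuousLinearMap.mul_def, ← mul_assoc, hCmR, sub_mul, sub_add_cancel]
    rw [e]
    refine (norm_add_le _ _).trans ((add_le_add (mulL_mono hω hm.le (norm_Gam_le hω k Z))
      (mulL_mono hω hCmc (norm_cut_Gam_le hω hmk (fun p hp => Or.inl hp) Z))).trans ?_)
    rw [mul_comm (η / (2 * γ))]
    exact hsum _ (norm_nonneg Z)
  · have hdiag : cut (offDiag k)ᶜ C = cut (offDiag k)ᶜ (C - Cm) + Cm := by
      have : cut (offDiag k)ᶜ Cm = Cm := by
        rw [hCm, cut_cut]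
        congr 1
        refine congrArg _ (Set.inter_eq_right.2 fun p hp h => ?_)
        exact h.2 ⟨sym_mono hmk.le hp.1, sym_mono hmk.le hp.2⟩
      rw [map_sub, this, sub_add_cancel]
    have e : mulL hω (Gam hω k Z) (cut (offDiag k)ᶜ C) =
        mulL hω (Gam hω k Z) (cut (offDiag k)ᶜ (C - Cm)) +
        mulL hω (cut {p | p.2 ∈ sym m} (Gam hω k Z)) Cm := by
      rw [hdiag]
      refine op_injective hω ?_
      rw [map_add (mulL hω _), map_add, map_add, op_mulL_eq_mul, op_mulL_eq_mul, op_mulL_eq_mul,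
        ← op_comp_projF, ← ContinuousLinearMap.mul_def, mul_assoc, hCmL]
    rw [e]
    refine (norm_add_le _ _).trans ((add_le_add (mulL_mono hω (norm_Gam_le hω k Z)
      ((norm_cut_le _ _).trans hm.le)) (mulL_mono hω
        (norm_cut_Gam_le hω hmk (fun p hp => Or.inr hp) Z) hCmc)).trans ?_)
    rw [mul_comm _ ‖C‖]
    exact hsum _ (norm_nonneg Z)
  · have : Gam hω k C = Gam hω k (C - Cm) := by rw [map_sub, Gam_cut_box hω hmk, sub_zero]
    rw [this]
    refine (norm_Gam_le hω k _).trans ?_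
    calc γ * ‖C - Cm‖ ≤ γ * (η / (2 * γ)) := by gcongr
      _ ≤ η := by linarith

theorem exists_fixedPoint_of_half_lipschitz {F : Type*} [NormedAddCommGroup F] [CompleteSpace F]
    (Φ : F → F) (c : F) {r : ℝ} (hr : 0 ≤ r) (hc : ‖Φ c - c‖ ≤ r / 2)
    (hlip : ∀ x ∈ Metric.closedBall c r, ∀ y ∈ Metric.closedBall c r,
      ‖Φ x - Φ y‖ ≤ 1 / 2 * ‖x - y‖) : ∃ x ∈ Metric.closedBall c r, Φ x = x := by
  have hcb : c ∈ Metric.closedBall c r := Metric.mem_closedBall_self hr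
  have hmaps : Set.MapsTo Φ (Metric.closedBall c r) (Metric.closedBall c r) := fun x hx => by
    have h1 := hlip x hx c hcb
    rw [mem_closedBall_iff_norm] at hx ⊢
    calc ‖Φ x - c‖ = ‖(Φ x - Φ c) + (Φ c - c)‖ := by rw [sub_add_sub_cancel]
      _ ≤ _ := (norm_add_le _ _).trans (add_le_add h1 hc)
      _ ≤ r := by linarith
  have hcontr : ContractingWith (1 / 2) (hmaps.restrict Φ _ _) := by
    refine ⟨by rw [← NNReal.coe_lt_coe]; norm_num, LipschitzWith.of_dist_le_mul fun x y => ?_⟩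
    have := hlip x x.2 y y.2
    rw [← dist_eq_norm, ← dist_eq_norm] at this
    change dist (Φ x) (Φ y) ≤ _ * dist (x : F) y
    simpa using this
  obtain ⟨x, hx, hfix, -⟩ := hcontr.exists_fixedPoint' Metric.isClosed_closedBall.isComplete
    hmaps hcb (edist_ne_top _ _)
  exact ⟨x, hx, hfix⟩

/-- This equation is what `(L₀ - C)(I + Γ_k X) = (I + Γ_k X)(L₀ - J_k X)` becomes after inserting
the commutator identity. `C` need not be small: the fixed point is sought near `C`, and `k` is
chosen so that the terms linear in `Γ_k` become small. -/
theorem exists_eq_add_mulL_Gam (hω : 0 < ω) (C : HS H) :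
    ∃ (k : ℕ) (X : HS H), ‖Gam hω k X‖ < 1 ∧
      C + (mulL hω C (Gam hω k X) - mulL hω (Gam hω k X) (cut (offDiag k)ᶜ X)) = X := by
  set γ := ω / (2 * Real.pi) with hγd
  have hγ : 0 < γ := by positivity
  -- Chosen so that `γ r = 1/16`. With `η ≤ 1/16` this gives `‖Γ_k X‖ ≤ 1/8` on the ball and
  -- Lipschitz constant `2η + γr + 1/8 ≤ 1/2`; `η ‖C‖ ≤ r/4` moves the centre by at most `r/2`.
  set r := 1 / (16 * γ)
  have hr : 0 < r := by positivity
  have hγr : γ * r = 1 / 16 := by simp only [r]; field_simp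
  obtain ⟨η, hη, hη1, hη2⟩ : ∃ η : ℝ, 0 < η ∧ η ≤ 1 / 16 ∧ η * ‖C‖ ≤ r / 4 := by
    refine ⟨min (1 / 16) (r / (4 * (‖C‖ + 1))), by positivity, min_le_left _ _, ?_⟩
    calc min (1 / 16) (r / (4 * (‖C‖ + 1))) * ‖C‖ ≤ r / (4 * (‖C‖ + 1)) * (‖C‖ + 1) := by
          gcongr
          · exact min_le_right _ _
          · linarith
      _ = r / 4 := by field_simp
  obtain ⟨k, hL, hR, hGC⟩ := exists_norm_mulL_Gam_le hω C hη
  have hball : ∀ X ∈ Metric.closedBall C r, ‖X - C‖ ≤ r := fun X hX =>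
    mem_closedBall_iff_norm.1 hX
  have hGX : ∀ X ∈ Metric.closedBall C r, ‖Gam hω k X‖ ≤ 1 / 8 := fun X hX => by
    have e : Gam hω k X = Gam hω k C + Gam hω k (X - C) := by rw [map_sub]; abel
    have h1 := (norm_Gam_le hω k (X - C)).trans (mul_le_mul_of_nonneg_left (hball X hX) hγ.le)
    rw [e]
    refine (norm_add_le _ _).trans ((add_le_add hGC h1).trans ?_)
    linarith
  obtain ⟨X, hX, hfix⟩ := exists_fixedPoint_of_half_lipschitz
    (fun X => C + (mulL hω C (Gam hω k X) - mulL hω (Gam hω k X) (cut (offDiag k)ᶜ X))) C hr.le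
    (by
      rw [add_sub_cancel_left]
      refine (norm_sub_le _ _).trans ((add_le_add (hL C) (hR C)).trans ?_)
      linarith)
    (fun X hX X' hX' => by
      -- The quadratic term is polarised, and `J_k X` is split as `J_k C + J_k (X - C)`. Only the
      -- piece with `J_k C` needs `k` large; the rest is small because the ball is.
      have e : C + (mulL hω C (Gam hω k X) - mulL hω (Gam hω k X) (cut (offDiag k)ᶜ X)) -
          (C + (mulL hω C (Gam hω k X') - mulL hω (Gam hω k X') (cut (offDiag k)ᶜ X'))) =
          mulL hω C (Gam hω k (X - X')) -
          mulL hω (Gam hω k (X - X')) (cut (offDiag k)ᶜ C) -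
          mulL hω (Gam hω k (X - X')) (cut (offDiag k)ᶜ (X - C)) -
          mulL hω (Gam hω k X') (cut (offDiag k)ᶜ (X - X')) := by
        simp only [map_sub, sub_apply]
        abel
      have b3 : ‖mulL hω (Gam hω k (X - X')) (cut (offDiag k)ᶜ (X - C))‖ ≤ γ * ‖X - X'‖ * r :=
        mulL_mono hω (norm_Gam_le hω k _) ((norm_cut_le _ _).trans (hball X hX))
      have b4 : ‖mulL hω (Gam hω k X') (cut (offDiag k)ᶜ (X - X'))‖ ≤ 1 / 8 * ‖X - X'‖ :=
        mulL_mono hω (hGX X' hX') (norm_cut_le _ _)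
      rw [e]
      refine (norm_sub_le _ _).trans ((add_le_add ((norm_sub_le _ _).trans (add_le_add
        ((norm_sub_le _ _).trans (add_le_add (hL _) (hR _))) b3)) b4).trans ?_)
      rw [show η * ‖X - X'‖ + η * ‖X - X'‖ + γ * ‖X - X'‖ * r + 1 / 8 * ‖X - X'‖ =
        (2 * η + γ * r + 1 / 8) * ‖X - X'‖ by ring]
      gcongr
      linarith)
  exact ⟨k, X, (hGX X hX).trans_lt (by norm_num), hfix⟩

/-- A Hilbert-Schmidt perturbation of `d/ds` is similar to a block diagonal one. -/
theorem exists_blockDiagonal_of_HS (hω : 0 < ω) (C : HS H) :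
    ∃ (k : ℕ) (W X : HS H), ‖W‖ < 1 ∧ ∀ x g, (x, g) ∈ derivGraph ω H →
      ∃ g', (x + hsOp hω W x, g') ∈ derivGraph ω H ∧
        g' - hsOp hω C (x + hsOp hω W x) =
          (g - hsOp hω (cut (offDiag k)ᶜ X) x) + hsOp hω W (g - hsOp hω (cut (offDiag k)ᶜ X) x) := by
  obtain ⟨k, X, h1, h2⟩ := exists_eq_add_mulL_Gam hω C
  refine ⟨k, Gam hω k X, X, h1, fun x g hx => ?_⟩
  set W := Gam hω k X
  set D := cut (offDiag k)ᶜ X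
  have h3 := mk_add_mk_mem hx (Gam_mem_derivGraph hω k X hx)
  refine ⟨_, h3, ?_⟩
  have h4 : cut (offDiag k) X = X - D := eq_sub_of_add_eq (cut_add_cut_compl _ X)
  have h5 := congrArg (fun Y => hsOp hω Y x) h2
  simp only [map_add, map_sub, op_mulL_eq_mul, add_apply, sub_apply,
    mul_apply_eq_comp] at h5
  rw [h4, map_sub, sub_apply, ← h5]
  simp only [map_add, map_sub]
  abel

end Steps

/-! ### From the potential to a Hilbert-Schmidt perturbation -/

section FirstStep

variable {H : Type*} [NormedAddCommGroup H] [InnerProductSpace ℂ H] [CompleteSpace H] {ω : ℝ}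

namespace Potential

theorem Admissible.summable_sq_shift {V : Potential ω H} (hV : V.Admissible) (j : ℤ) :
    Summable fun n : ℤ => ‖V.coeff (j + n)‖ ^ 2 :=
  hV.summable_sq.comp_injective (i := fun n => j + n) (add_right_injective j)

/-- In the indices `(j + l, j - l)`, an injective change of variables, the double series is
dominated by `∑ ‖𝒱̂(n)‖²` times `∑ 1/m²`. -/
theorem Admissible.summable_Gam {V : Potential ω H} (hω : 0 < ω) (hV : V.Admissible) :
    Summable fun p : ℤ × ℤ => ‖(lam ω p.1 - lam ω p.2)⁻¹ • V.coeff (p.1 + p.2)‖ ^ 2 := by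
  have h1 : Summable fun q : ℤ × ℤ => ‖V.coeff q.1‖ ^ 2 * ((q.2 : ℝ) ^ 2)⁻¹ :=
    hV.summable_sq.mul_of_nonneg summable_inv_int_sq (fun _ => sq_nonneg _) fun _ => by positivity
  have h2 := (h1.comp_injective (i := fun p : ℤ × ℤ => (p.1 + p.2, p.1 - p.2)) fun p q h => by
    simp only [Prod.mk.injEq] at h
    exact Prod.ext (by omega) (by omega)).mul_left ((ω / (2 * Real.pi)) ^ 2)
  refine h2.congr fun p => ?_
  simp only [Function.comp_apply]
  rw [norm_smul, norm_inv_lam_sub hω, mul_pow, mul_pow, inv_pow, sq_abs]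
  ring

/-- The block matrix of `ΓV`. -/
def gamMatrix (hω : 0 < ω) (V : Potential ω H) (hV : V.Admissible) : HS H :=
  HS.mk _ (hV.summable_Gam hω)

-- The diagonal consists of the coefficients `𝒱̂(2l)`, which are square summable, and the central
-- box is finite.
open Classical in
theorem Admissible.summable_diag {V : Potential ω H} (hV : V.Admissible) (k : ℕ) :
    Summable fun p : ℤ × ℤ => ‖if p ∈ offDiag k then 0 else V.coeff (p.1 + p.2)‖ ^ 2 := by
  have h1 : Summable fun p : ℤ × ℤ => if p.1 = p.2 then ‖V.coeff (p.1 + p.2)‖ ^ 2 else 0 := by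
    have hinj : Function.Injective fun l : ℤ => (l, l) := fun a b h => (Prod.mk.inj h).1
    refine (hinj.summable_iff fun p hp => ?_).1 ?_
    · rw [if_neg]
      rintro h
      exact hp ⟨p.1, Prod.ext rfl h⟩
    · have := hV.summable_sq.comp_injective (i := fun l : ℤ => l + l) fun a b h => by
        simp only at h; omega
      simpa [Function.comp_def] using this
  have h2 : Summable fun p : ℤ × ℤ =>
      if p ∈ sym k ×ˢ sym k then ‖V.coeff (p.1 + p.2)‖ ^ 2 else 0 :=
    summable_of_ne_finset_zero (s := sym k ×ˢ sym k) fun p hp => if_neg hp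
  refine Summable.of_nonneg_of_le (fun p => sq_nonneg _) (fun p => ?_) (h1.add h2)
  by_cases h : p ∈ offDiag k
  · rw [if_pos h]
    simp only [norm_zero, ne_eq, OfNat.ofNat_ne_zero, not_false_eq_true, zero_pow]
    positivity
  · rw [if_neg h]
    by_cases h3 : p.1 = p.2
    · rw [if_pos h3]
      refine le_add_of_nonneg_right ?_
      positivity
    · have h4 : p ∈ sym k ×ˢ sym k := by
        rw [Finset.mem_product]
        by_contra h5
        exact h ⟨h3, h5⟩
      rw [if_neg h3, if_pos h4, zero_add]

open Classical in
/-- The block matrix of `J_k V`. -/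
def diagMatrix (V : Potential ω H) (hV : V.Admissible) (k : ℕ) : HS H :=
  HS.mk _ (hV.summable_diag k)

theorem mul_summable {V : Potential ω H} (hV : V.Admissible) (w : HS H) (j l : ℤ) :
    Summable fun n => V.coeff (j + n) ∘L w (n, l) :=
  (summable_and_norm_tsum_sq_le (F := H →L[ℂ] H) (f := fun n => V.coeff (j + n) ∘L w (n, l))
    (u := fun n => ‖V.coeff (j + n)‖) (v := fun n => ‖w (n, l)‖)
    (fun n => (V.coeff (j + n)).opNorm_comp_le (w (n, l))) (fun _ => norm_nonneg _)
    (fun _ => norm_nonneg _) (hV.summable_sq_shift j) (w.summable_col l)).1.of_norm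

/-- Up to the factor `κ` coming from `λ_1`, this is the second standing assumption on the potential.
-/
theorem summable_mul_gamMatrix (hω : 0 < ω) (V : Potential ω H) (hV : V.Admissible) :
    Summable fun p : ℤ × ℤ =>
      ‖∑' n, V.coeff (p.1 + n) ∘L V.gamMatrix hω hV (n, p.2)‖ ^ 2 := by
  set κ : ℂ := -(Complex.I * ((2 * Real.pi / ω : ℝ) : ℂ))⁻¹
  refine (hV.summable_double.mul_left (‖κ‖ ^ 2)).congr fun p => ?_
  rw [← mul_pow, ← norm_smul, ← tsum_const_smul'']
  congr 3
  ext1 n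
  have h1 : (lam ω n - lam ω p.2)⁻¹ = κ * (((p.2 - n : ℤ) : ℂ))⁻¹ := by
    rw [lam_sub, lam, neg_mul, ← mul_inv, ← inv_neg]
    congr 1
    push_cast
    ring
  rw [gamMatrix, HS.mk_apply, ContinuousLinearMap.comp_smul, smul_smul, h1, add_comm n]

/-- Only finitely many terms of each inner sum survive, so the rows of `V` need only be square
summable over finitely many shifts; `V` itself is not Hilbert-Schmidt in general. -/
theorem summable_mul_of_box {V : Potential ω H} (hV : V.Admissible) (k : ℕ) {w : HS H}
    (hw : ∀ p, p.1 ∉ sym k → w p = 0) :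
    Summable fun p : ℤ × ℤ => ‖∑' n, V.coeff (p.1 + n) ∘L w (n, p.2)‖ ^ 2 := by
  have h1 : Summable fun j : ℤ => ∑ n ∈ sym k, ‖V.coeff (j + n)‖ ^ 2 :=
    summable_sum fun n _ => hV.summable_sq.comp_injective (i := fun j => j + n)
      (add_left_injective n)
  have h2 := h1.mul_of_nonneg w.summable_cols (fun _ => by positivity)
    (fun _ => tsum_nonneg fun _ => sq_nonneg _)
  refine Summable.of_nonneg_of_le (fun p => sq_nonneg _) (fun p => ?_) h2
  let u : ℤ → ℝ := fun n => if n ∈ sym k then ‖V.coeff (p.1 + n)‖ else 0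
  have hu : ∀ n ∉ sym k, u n ^ 2 = 0 := fun n hn => by simp [u, hn]
  have h3 := (summable_and_norm_tsum_sq_le (f := fun n => V.coeff (p.1 + n) ∘L w (n, p.2))
    (u := u) (v := fun n => ‖w (n, p.2)‖) (fun n => ?_) (fun n => ?_) (fun _ => norm_nonneg _)
    (summable_of_ne_finset_zero hu) (w.summable_col p.2)).2
  · rw [tsum_eq_sum hu] at h3
    refine h3.trans (le_of_eq ?_)
    congr 1
    exact Finset.sum_congr rfl fun n hn => by simp [u, hn]
  · by_cases hn : n ∈ sym k
    · simp only [u, if_pos hn]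
      exact ContinuousLinearMap.opNorm_comp_le _ _
    · rw [hw _ hn]
      simp [u, hn]
  · simp only [u]
    split_ifs <;> positivity

/-- `ΓV` and `Γ_k V` differ only inside the central box, because the diagonal of `ΓV` is zero by
`0⁻¹ = 0`. The previous two cases therefore combine. -/
theorem summable_mul_cut_gamMatrix (hω : 0 < ω) (V : Potential ω H) (hV : V.Admissible) (k : ℕ) :
    Summable fun p : ℤ × ℤ =>
      ‖∑' n, V.coeff (p.1 + n) ∘L cut (offDiag k) (V.gamMatrix hω hV) (n, p.2)‖ ^ 2 := by
  have hc := summable_mul_of_box hV k (w := cut (offDiag k)ᶜ (V.gamMatrix hω hV)) fun p hp => by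
    rw [cut_apply]
    split_ifs with h
    · have h1 : p.1 = p.2 := by
        by_contra h2
        exact h ⟨h2, fun h3 => hp h3.1⟩
      simp [gamMatrix, h1]
    · rfl
  have hf := V.summable_mul_gamMatrix hω hV
  refine Summable.of_nonneg_of_le (fun p => sq_nonneg _) (fun p => ?_)
    ((hf.add hc).mul_left 2)
  have e : ∑' n, V.coeff (p.1 + n) ∘L cut (offDiag k) (V.gamMatrix hω hV) (n, p.2) =
      ∑' n, V.coeff (p.1 + n) ∘L V.gamMatrix hω hV (n, p.2) -
      ∑' n, V.coeff (p.1 + n) ∘L cut (offDiag k)ᶜ (V.gamMatrix hω hV) (n, p.2) := by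
    rw [← Summable.tsum_sub (mul_summable hV _ _ _) (mul_summable hV _ _ _)]
    congr 1
    ext1 n
    rw [← ContinuousLinearMap.comp_sub]
    congr 1
    rw [eq_sub_of_add_eq (cut_add_cut_compl (offDiag k) (V.gamMatrix hω hV))]
    rfl
  rw [e]
  refine (pow_le_pow_left₀ (norm_nonneg _) (norm_sub_le _ _) 2).trans ?_
  exact add_sq_le

/-- The product of `V` with a Hilbert-Schmidt block matrix, when it is again Hilbert-Schmidt. -/
theorem mem_graph_op {V : Potential ω H} (hω : 0 < ω) (hV : V.Admissible) (w : HS H)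
    (hB : Summable fun p : ℤ × ℤ => ‖∑' n, V.coeff (p.1 + n) ∘L w (n, p.2)‖ ^ 2) {x z : L2 ω H}
    (hz : ∀ j, HasSum (fun l => V.coeff (j + l) (coeffL ω H l (hsOp hω w x))) (coeffL ω H j z)) :
    z = hsOp hω (HS.mk _ hB) x := by
  refine ext_coeffL hω fun j => ?_
  let f : ℤ × ℤ → H := fun q => V.coeff (j + q.1) (w q (coeffL ω H q.2 x))
  -- Absolute convergence of the double series justifies interchanging the sums: `‖𝒱̂(j+n)‖ ‖x̂(l)‖`
  -- is square summable over pairs, and so is `w`.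
  have hf : Summable f := by
    have h1 : Summable fun q : ℤ × ℤ => (‖V.coeff (j + q.1)‖ * ‖coeffL ω H q.2 x‖) ^ 2 := by
      simp only [mul_pow]
      exact (hV.summable_sq_shift j).mul_of_nonneg (summable_norm_coeffL_sq hω x)
        (fun _ => sq_nonneg _) fun _ => sq_nonneg _
    have h2 : ∀ q, ‖f q‖ ≤ (‖V.coeff (j + q.1)‖ * ‖coeffL ω H q.2 x‖) * ‖w q‖ := fun q => by
      refine ((V.coeff (j + q.1)).le_opNorm _).trans ?_
      rw [mul_assoc, mul_comm ‖coeffL ω H q.2 x‖]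
      exact mul_le_mul_of_nonneg_left ((w q).le_opNorm _) (norm_nonneg _)
    exact (summable_and_norm_tsum_sq_le h2 (fun q => mul_nonneg (norm_nonneg _) (norm_nonneg _))
      (fun q => norm_nonneg _) h1 w.summable_sq).1.of_norm
  rw [← (hz j).tsum_eq, coeffL_op]
  have e1 : ∀ n, V.coeff (j + n) (coeffL ω H n (hsOp hω w x)) = ∑' l, f (n, l) := fun n => by
    rw [coeffL_op, ContinuousLinearMap.map_tsum _ (w.apply_summable hω x n).1.of_norm]
  have e2 : ∀ l, HS.mk _ hB (j, l) (coeffL ω H l x) = ∑' n, f (n, l) := fun l => by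
    rw [HS.mk_apply]
    exact ((mul_summable hV w j l).hasSum.mapL
      (ContinuousLinearMap.apply ℂ H (coeffL ω H l x))).tsum_eq.symm
  simp only [e1, e2]
  exact (Summable.tsum_comm (f := fun n l => f (n, l)) hf).symm

theorem hsOp_add_mulL_apply (hω : 0 < ω) {w c m : HS H} (h : c + mulL hω w c = m) (x : L2 ω H) :
    hsOp hω c x + hsOp hω w (hsOp hω c x) = hsOp hω m x := by
  rw [← h, map_add, op_mulL_eq_mul]
  rfl

theorem lam_sub_smul_cut_gamMatrix (hω : 0 < ω) (V : Potential ω H) (hV : V.Admissible) (k : ℕ)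
    (p : ℤ × ℤ) : (lam ω p.1 - lam ω p.2) • cut (offDiag k) (V.gamMatrix hω hV) p =
      V.coeff (p.1 + p.2) - V.diagMatrix hV k p := by
  rw [cut_apply, diagMatrix, HS.mk_apply, gamMatrix, HS.mk_apply]
  split_ifs with h
  · rw [sub_zero, smul_smul, mul_inv_cancel₀, one_smul]
    rw [lam_sub]
    exact mt (lam_eq_zero_iff hω).1 (sub_ne_zero.2 h.1)
  · rw [sub_self, smul_zero]

/-- `W = Γ_k V` with `k` large enough for norm below one, `J = J_k V`, and `B` is the product `V W`.
-/
theorem exists_gam_diag_mul (hω : 0 < ω) (V : Potential ω H) (hV : V.Admissible) :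
    ∃ W J B : HS H, ‖W‖ < 1 ∧
      (∀ p : ℤ × ℤ, (lam ω p.1 - lam ω p.2) • W p = V.coeff (p.1 + p.2) - J p) ∧
      ∀ x z : L2 ω H, (∀ j, HasSum (fun l => V.coeff (j + l) (coeffL ω H l (hsOp hω W x)))
        (coeffL ω H j z)) → z = hsOp hω B x := by
  obtain ⟨k, hk⟩ := ((tendsto_norm_cut (f := atTop) offDiag eventually_notMem_offDiag
    (V.gamMatrix hω hV)).eventually (gt_mem_nhds one_pos)).exists
  refine ⟨cut (offDiag k) (V.gamMatrix hω hV), V.diagMatrix hV k,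
    HS.mk _ (V.summable_mul_cut_gamMatrix hω hV k), hk, V.lam_sub_smul_cut_gamMatrix hω hV k,
    fun x z hz => ?_⟩
  exact mem_graph_op hω hV _ (V.summable_mul_cut_gamMatrix hω hV k) hz

/-- `L` is similar to a Hilbert-Schmidt perturbation of `d/ds`. -/
theorem exists_HS_perturbation (hω : 0 < ω) (V : Potential ω H) (hV : V.Admissible) :
    ∃ W C : HS H, ‖W‖ < 1 ∧ ∀ x g, (x, g) ∈ derivGraph ω H →
      ∃ g' z, (x + hsOp hω W x, g') ∈ derivGraph ω H ∧ (x + hsOp hω W x, z) ∈ V.graph ∧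
        g' - z = (g - hsOp hω C x) + hsOp hω W (g - hsOp hω C x) := by
  obtain ⟨W, J, B, hW1, hWJ, hB⟩ := exists_gam_diag_mul hω V hV
  -- Since `L₀W = WL₀ + V - J`, one has `(L₀ - V)(I + W) = (I + W)L₀ - (J + VW)`; so `C` must
  -- satisfy `(I + W) C = J + B`.
  obtain ⟨C, hC⟩ := exists_add_mulL_eq hω hW1 (J + B)
  refine ⟨W, C, hW1, fun x g hx => ?_⟩
  obtain ⟨v, hv1, -, hv2⟩ := V.exists_mem_graph hω (summable_norm_coeffL_of_mem hω hx one_pos).1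
  have h1 : (hsOp hω W x, hsOp hω W g + (v - hsOp hω J x)) ∈ derivGraph ω H := by
    refine op_mem_derivGraph hω W hx fun j => ?_
    have hJ := (J.apply_summable hω x j).1.of_norm.hasSum
    rw [← coeffL_op hω] at hJ
    rw [map_sub]
    convert (hv2 j).sub hJ using 2 with l
    exact congrArg (fun A : H →L[ℂ] H => A (coeffL ω H l x)) (hWJ (j, l))
  obtain ⟨v', hv1', -, hv2'⟩ :=
    V.exists_mem_graph hω (summable_norm_coeffL_of_mem hω h1 one_pos).1
  have hv' : v' = hsOp hω B x := hB x v' hv2'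
  refine ⟨_, _, mk_add_mk_mem hx h1, mk_add_mk_mem hv1 hv1', ?_⟩
  have h5 := hsOp_add_mulL_apply hω hC x
  rw [map_add, add_apply] at h5
  change g + (hsOp hω W g + (v - hsOp hω J x)) - (v + v') = _
  rw [hB x v' hv2', map_sub]
  have h6 : hsOp hω B x = hsOp hω C x + hsOp hω W (hsOp hω C x) - hsOp hω J x := by
    rw [h5]; abel
  rw [h6]
  abel

end Potential

end FirstStep


/-! ### Graphs of differences of unbounded operators -/

section Graphs

variable {E : Type*} [AddCommGroup E] [Module ℂ E]

theorem mem_graph_sub_iff {A B : E →ₗ.[ℂ] E} {x f : E} :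
    (x, f) ∈ (A - B).graph ↔ ∃ a b, (x, a) ∈ A.graph ∧ (x, b) ∈ B.graph ∧ f = a - b := by
  constructor
  · intro h
    obtain ⟨⟨y, hy⟩, rfl, rfl⟩ := (A - B).mem_graph_iff.1 h
    exact ⟨_, _, A.mem_graph ⟨y, hy.1⟩, B.mem_graph ⟨y, hy.2⟩, rfl⟩
  · rintro ⟨a, b, ha, hb, rfl⟩
    obtain ⟨⟨y, hy⟩, rfl, rfl⟩ := A.mem_graph_iff.1 ha
    obtain ⟨⟨y', hy'⟩, h1, rfl⟩ := B.mem_graph_iff.1 hb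
    simp only at h1 hy ⊢
    subst h1
    exact (A - B).mem_graph ⟨y', hy, hy'⟩

theorem mem_graph_toPMap_top_iff {A : E →ₗ[ℂ] E} {x f : E} :
    (x, f) ∈ (A.toPMap ⊤).graph ↔ f = A x := by
  rw [LinearPMap.mem_graph_iff]
  constructor
  · rintro ⟨y, rfl, rfl⟩; rfl
  · rintro rfl; exact ⟨⟨x, trivial⟩, rfl, rfl⟩

end Graphs

/-! ### Bounded perturbations of `d/ds` and existence of a reduction -/

section Operators

variable {H : Type*} [NormedAddCommGroup H] [InnerProductSpace ℂ H] [CompleteSpace H] {ω : ℝ}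

/-- The operator `L₀ - A` for a bounded operator `A`. -/
def pert (A : L2 ω H →L[ℂ] L2 ω H) : L2 ω H →ₗ.[ℂ] L2 ω H :=
  opL0 ω H - (A : L2 ω H →ₗ[ℂ] L2 ω H).toPMap ⊤

theorem mem_graph_pert_iff {A : L2 ω H →L[ℂ] L2 ω H} {x f : L2 ω H} :
    (x, f) ∈ (pert A).graph ↔ (x, f + A x) ∈ derivGraph ω H := by
  rw [pert, mem_graph_sub_iff]
  simp only [opL0_graph, mem_graph_toPMap_top_iff]
  constructor
  · rintro ⟨a, b, ha, rfl, rfl⟩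
    rwa [ContinuousLinearMap.coe_coe, sub_add_cancel]
  · intro h
    exact ⟨_, _, h, rfl, (add_sub_cancel_right _ _).symm⟩

theorem mem_graph_opL_iff {V : Potential ω H} {x f : L2 ω H} :
    (x, f) ∈ (opL V).graph ↔ ∃ g z, (x, g) ∈ derivGraph ω H ∧ (x, z) ∈ V.graph ∧ f = g - z := by
  rw [opL, mem_graph_sub_iff, opL0_graph, Potential.op_graph]

theorem isSimilarityTransform_of_graph {E : Type*} [NormedAddCommGroup E] [NormedSpace ℂ E]
    {A₁ A₂ : E →ₗ.[ℂ] E} {U : E ≃L[ℂ] E} (h1 : ∀ x f, (x, f) ∈ A₂.graph → (U x, U f) ∈ A₁.graph)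
    (h2 : ∀ y ∈ A₁.domain, ∃ x ∈ A₂.domain, U x = y) : IsSimilarityTransform A₁ A₂ U := by
  constructor
  · ext y
    constructor
    · rintro ⟨x, hx, rfl⟩
      exact LinearPMap.mem_domain_of_mem_graph (h1 _ _ (A₂.mem_graph ⟨x, hx⟩))
    · intro hy
      obtain ⟨x, hx, rfl⟩ := h2 y hy
      exact ⟨x, hx, rfl⟩
  · intro x h
    exact ((LinearPMap.image_iff h).2 (h1 _ _ (A₂.mem_graph x))).symm

theorem IsSimilarityTransform.mem_graph {E : Type*} [NormedAddCommGroup E] [NormedSpace ℂ E]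
    {A₁ A₂ : E →ₗ.[ℂ] E} {U : E ≃L[ℂ] E} (h : IsSimilarityTransform A₁ A₂ U) {x f : E} :
    (x, f) ∈ A₂.graph ↔ (U x, U f) ∈ A₁.graph := by
  constructor
  · intro hx
    obtain ⟨y, rfl, rfl⟩ := A₂.mem_graph_iff.1 hx
    have hd : U y ∈ (A₁.domain : Set E) := by
      rw [← h.1]
      exact ⟨y, y.2, rfl⟩
    rw [← LinearPMap.image_iff hd]
    exact (h.2 y hd).symm
  · intro hx
    have hd : U x ∈ (A₁.domain : Set E) := LinearPMap.mem_domain_of_mem_graph hx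
    rw [← h.1] at hd
    obtain ⟨y, hy, hyx⟩ := hd
    obtain rfl := U.injective hyx
    rw [← LinearPMap.image_iff hy]
    refine U.injective ?_
    have hd : U y ∈ A₁.domain := LinearPMap.mem_domain_of_mem_graph hx
    rw [← h.2 ⟨y, hy⟩ hd]
    exact (LinearPMap.image_iff hd).2 hx

/-- Diagonal operators with a bounded symbol. -/
theorem exists_diagonal (hω : 0 < ω) (s : ℤ → ℂ) {C : ℝ} (hC : 0 ≤ C) (hs : ∀ l, ‖s l‖ ≤ C) :
    ∃ S : L2 ω H →L[ℂ] L2 ω H, (∀ j x, coeffL ω H j (S x) = s j • coeffL ω H j x) ∧ ‖S‖ ≤ C := by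
  refine exists_clm_of_rows hω (fun j => (s j • coeffL ω H j : L2 ω H →L[ℂ] H).toLinearMap) hC
    fun x => ?_
  have hb : ∀ j, ‖s j • coeffL ω H j x‖ ^ 2 ≤ C ^ 2 * ‖coeffL ω H j x‖ ^ 2 := fun j => by
    rw [norm_smul, mul_pow]
    gcongr
    exact hs j
  have hsum := (summable_norm_coeffL_sq hω x).mul_left (C ^ 2)
  have hs' := Summable.of_nonneg_of_le (fun j => sq_nonneg _) hb hsum
  refine ⟨hs', ?_⟩
  rw [← tsum_norm_coeffL_sq hω x, ← tsum_mul_left]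
  exact hs'.tsum_le_tsum hb hsum

/-- With `S = (t - L₀)⁻¹`, of norm at most `1/t` because the `λ_l` are imaginary, the equation
becomes `(I + A S) u = y` for `x = S u`. -/
theorem exists_mem_graph_pert (hω : 0 < ω) (A : L2 ω H →L[ℂ] L2 ω H) {t : ℝ} (ht : ‖A‖ < t)
    (y : L2 ω H) : ∃ x, (x, (t : ℂ) • x - y) ∈ (pert A).graph := by
  have ht0 : 0 < t := (norm_nonneg _).trans_lt ht
  obtain ⟨S, hS, hSn⟩ := exists_diagonal (H := H) hω (fun l => ((t : ℂ) - lam ω l)⁻¹)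
    (inv_nonneg.2 ht0.le) fun l => by
      rw [norm_inv]
      gcongr
      have h := norm_sq_sub_lam hω t l
      refine le_of_sq_le_sq ?_ (norm_nonneg _)
      nlinarith [sq_nonneg (2 * Real.pi / ω * l)]
  have hlt : ‖A * S‖ < 1 := by
    refine (norm_mul_le _ _).trans_lt ?_
    calc ‖A‖ * ‖S‖ ≤ ‖A‖ * t⁻¹ := by gcongr
      _ < 1 := by rwa [← div_eq_mul_inv, div_lt_one ht0]
  obtain ⟨T, hT⟩ := isUnit_one_add_of_norm_lt_one hlt
  set u := (↑T⁻¹ : L2 ω H →L[ℂ] L2 ω H) y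
  have hu : u + A (S u) = y := by
    have : ((T : L2 ω H →L[ℂ] L2 ω H) * (↑T⁻¹ : L2 ω H →L[ℂ] L2 ω H)) y = y := by
      rw [T.mul_inv]; rfl
    rwa [hT] at this
  refine ⟨S u, mem_graph_pert_iff.2 ?_⟩
  have e : (t : ℂ) • S u - y + A (S u) = (t : ℂ) • S u - u := by rw [← hu]; abel
  rw [e]
  refine (mem_derivGraph_iff hω).2 fun l => ?_
  have h0 := sub_lam_ne_zero hω ht0 l
  rw [map_sub, map_smul, hS, smul_smul, smul_smul, sub_eq_iff_eq_add]
  nth_rw 3 [← one_smul ℂ (coeffL ω H l u)]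
  rw [← add_smul]
  congr 1
  field_simp
  ring

/-- An eigenvector satisfies `(t - L₀) y = -V y`. Cauchy-Schwarz bounds `∑ ‖ŷ(l)‖`, and hence `‖V
y‖`, by `‖V y‖` times a factor tending to zero as `t → ∞`. -/
theorem eventually_opL_injective (hω : 0 < ω) (V : Potential ω H) :
    ∀ᶠ t : ℝ in atTop, ∀ y, (y, (t : ℂ) • y) ∈ (opL V).graph → y = 0 := by
  have h1 := ((tendsto_tsum_inv_norm_sub_lam hω).2.const_mul (‖V.evalL‖ ^ 2))
  rw [mul_zero] at h1
  filter_upwards [h1.eventually (gt_mem_nhds one_pos), eventually_gt_atTop 0] with t ht ht0 y hy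
  obtain ⟨g, z, hg, hz, e⟩ := mem_graph_opL_iff.1 hy
  obtain ⟨hs, hs2⟩ := summable_norm_coeffL_of_mem hω hg ht0
  obtain ⟨z', hz', hn, -⟩ := V.exists_mem_graph hω hs
  obtain rfl := V.graph_unique hz hz'
  have e2 : (t : ℂ) • y - g = -z := by rw [e]; abel
  rw [e2, norm_neg] at hs2
  set σ := ∑' l, ‖coeffL ω H l y‖
  set κ := ∑' l : ℤ, (‖(t : ℂ) - lam ω l‖⁻¹) ^ 2
  have h2 : ‖z‖ ^ 2 ≤ ‖V.evalL‖ ^ 2 * κ * ‖z‖ ^ 2 := by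
    calc ‖z‖ ^ 2 ≤ (‖V.evalL‖ * σ) ^ 2 := pow_le_pow_left₀ (norm_nonneg _) hn 2
      _ = ‖V.evalL‖ ^ 2 * σ ^ 2 := by ring
      _ ≤ ‖V.evalL‖ ^ 2 * (κ * ‖z‖ ^ 2) := by gcongr
      _ = _ := by ring
  have hz0 : ‖z‖ ^ 2 = 0 := by
    by_contra h
    have : 0 < ‖z‖ ^ 2 := lt_of_le_of_ne (sq_nonneg _) (Ne.symm h)
    nlinarith
  rw [hz0, mul_zero] at hs2
  have hσ : σ = 0 := by nlinarith
  refine eq_zero_of_coeffL hω y fun l => norm_le_zero_iff.1 ?_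
  rw [← hσ]
  exact hs.le_tsum l fun _ _ => norm_nonneg _

theorem projF_hsOp_of_support (hω : 0 < ω) {a : HS H} {F : Finset ℤ}
    (h : ∀ p : ℤ × ℤ, p.2 ∈ F → p.1 ∉ F → a p = 0) {x : L2 ω H} (hx : projF ω H F x = x) :
    projF ω H F (hsOp hω a x) = hsOp hω a x := by
  refine ext_coeffL hω fun j => ?_
  rw [coeffL_projF hω]
  split_ifs with hj
  · rfl
  · rw [coeffL_op]
    symm
    refine (tsum_congr fun l => ?_).trans tsum_zero
    by_cases hl : l ∈ F
    · rw [h (j, l) hl hj]; rfl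
    · rw [← hx, coeffL_projF hω, if_neg hl, map_zero]

theorem mem_range_projF_iff (hω : 0 < ω) {F : Finset ℤ} {x : L2 ω H} :
    x ∈ (projF ω H F).range ↔ projF ω H F x = x := by
  constructor
  · rintro ⟨y, rfl⟩; exact projF_projF hω F y
  · intro h; exact ⟨x, h⟩

theorem projLow_eq (k : ℕ) : projLow ω H k = projF ω H (sym k) := rfl

theorem proj_eq (l : ℤ) : proj ω H l = projF ω H {l} := by simp [projF]

theorem exists_unit_one_add (hω : 0 < ω) {w : HS H} (hw : ‖w‖ < 1) :
    ∃ u : (L2 ω H →L[ℂ] L2 ω H)ˣ, (u : L2 ω H →L[ℂ] L2 ω H) = 1 + hsOp hω w :=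
  isUnit_one_add_of_norm_lt_one ((norm_op_le hω w).trans_lt hw)

/-- Every admissible potential gives an operator that can be reduced to block diagonal form. -/
theorem exists_reduction (hω : 0 < ω) (V : Potential ω H) (hV : V.Admissible) :
    ∃ k U V₀, Reduction V k U V₀ := by
  obtain ⟨W₁, C, hW₁, h1⟩ := V.exists_HS_perturbation hω hV
  obtain ⟨k, W₂, X, hW₂, h2⟩ := exists_blockDiagonal_of_HS hω C
  set D := cut (offDiag k)ᶜ X with hD
  obtain ⟨u₁, hu₁⟩ := exists_unit_one_add hω hW₁
  obtain ⟨u₂, hu₂⟩ := exists_unit_one_add hω hW₂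
  let U : L2 ω H ≃L[ℂ] L2 ω H := ContinuousLinearEquiv.unitsEquiv ℂ _ (u₁ * u₂)
  have hU : ∀ x, U x = (x + hsOp hω W₂ x) + hsOp hω W₁ (x + hsOp hω W₂ x) := fun x => by
    change (u₁ : L2 ω H →L[ℂ] L2 ω H) ((u₂ : L2 ω H →L[ℂ] L2 ω H) x) = _
    rw [hu₁, hu₂]
    rfl
  have hgraph : ∀ x f, (x, f) ∈ (pert (hsOp hω D)).graph → (U x, U f) ∈ (opL V).graph := by
    intro x f hx
    obtain ⟨g', hg1, hg2⟩ := h2 x _ (mem_graph_pert_iff.1 hx)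
    obtain ⟨g'', z, hg3, hz, hg4⟩ := h1 _ g' hg1
    refine mem_graph_opL_iff.2 ⟨g'', z, ?_, ?_, ?_⟩
    · rw [hU]; exact hg3
    · rw [hU]; exact hz
    · rw [add_sub_cancel_right] at hg2
      rw [hU, hg4, hg2]
  -- Entries that `J_k` retains never leave a block: they lie on the diagonal or have both indices
  -- in the central box.
  have hsub : ∀ p ∉ offDiag k, ∀ F : Finset ℤ, (F = sym k ∨ ∃ l, F = {l} ∧ (k : ℤ) < |l|) →
      p.2 ∈ F → p.1 ∈ F := by
    rintro p hp F (rfl | ⟨l, rfl, hl⟩) h3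
    · by_contra h4
      exact hp ⟨fun h5 => h4 (h5 ▸ h3), fun h5 => h4 h5.1⟩
    · rw [Finset.mem_singleton] at h3 ⊢
      by_contra h4
      refine hp ⟨fun h5 => h4 (h5.trans h3), fun h5 => ?_⟩
      have := mem_sym.1 h5.2
      rw [h3] at this
      omega
  have hinv : ∀ F : Finset ℤ, (F = sym k ∨ ∃ l, F = {l} ∧ (k : ℤ) < |l|) →
      ∀ x ∈ (projF ω H F).range, hsOp hω D x ∈ (projF ω H F).range := fun F hF x hx => by
    rw [mem_range_projF_iff hω] at hx ⊢
    refine projF_hsOp_of_support hω (fun p hp1 hp2 => ?_) hx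
    rw [hD, cut_apply, if_neg]
    exact fun h => hp2 (hsub p h F hF hp1)
  refine ⟨k, U, hsOp hω D, ⟨?_, memHS_op hω _, ?_, ?_, ?_⟩⟩
  · have : (U : L2 ω H →L[ℂ] L2 ω H) - ContinuousLinearMap.id ℂ (L2 ω H) =
        hsOp hω (W₂ + (W₁ + mulL hω W₁ W₂)) := by
      ext1 x
      rw [map_add, map_add, op_mulL_eq_mul]
      change U x - x = hsOp hω W₂ x + (hsOp hω W₁ x + hsOp hω W₁ (hsOp hω W₂ x))
      rw [hU, map_add]
      abel
    rw [this]
    exact memHS_op hω _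
  · refine isSimilarityTransform_of_graph hgraph fun y hy => ?_
    obtain ⟨f, hf⟩ := LinearPMap.mem_domain_iff.1 hy
    -- The intertwining so far gives only one inclusion of domains. For large `t` the operator `t -
    -- (L₀ - J_k X)` is surjective while `t - L` is injective, so `L` cannot properly extend the
    -- transported operator.
    obtain ⟨t, ht1, ht2⟩ := ((eventually_opL_injective hω V).and
      (eventually_gt_atTop ‖hsOp hω D‖)).exists
    obtain ⟨x, hx⟩ := exists_mem_graph_pert hω (hsOp hω D) ht2 (U.symm ((t : ℂ) • y - f))
    refine ⟨x, LinearPMap.mem_domain_of_mem_graph hx, ?_⟩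
    have h3 := hgraph _ _ hx
    rw [map_sub, map_smul, U.apply_symm_apply] at h3
    have h4 := (opL V).graph.sub_mem h3 hf
    rw [← sub_eq_zero]
    refine ht1 _ ?_
    convert h4 using 1
    refine Prod.ext rfl ?_
    change (t : ℂ) • (U x - y) = (t : ℂ) • U x - ((t : ℂ) • y - f) - f
    rw [smul_sub]
    abel
  · rw [projLow_eq]
    exact hinv _ (Or.inl rfl)
  · intro l hl
    rw [proj_eq]
    exact hinv _ (Or.inr ⟨l, rfl, hl⟩)

end Operators


/-! ### Contour integrals and winding numbers -/

namespace Contour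

variable {F : Type*} [NormedAddCommGroup F] [NormedSpace ℂ F]

theorem isCompact_support (c : Contour) : IsCompact c.support :=
  isCompact_iUnion fun i => isCompact_Icc.image (c.smooth i).continuous

theorem curve_mem_support (c : Contour) (i : Fin c.num) {t : ℝ} (ht : t ∈ Set.Icc (0 : ℝ) 1) :
    c.curve i t ∈ c.support := Set.mem_iUnion.2 ⟨i, t, ht, rfl⟩

theorem continuous_deriv_curve (c : Contour) (i : Fin c.num) : Continuous (deriv (c.curve i)) :=
  (c.smooth i).continuous_deriv le_rfl

theorem continuousOn_integrand (c : Contour) (i : Fin c.num) {f : ℂ → F}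
    (hf : ContinuousOn f c.support) :
    ContinuousOn (fun t => deriv (c.curve i) t • f (c.curve i t)) (Set.Icc 0 1) :=
  (c.continuous_deriv_curve i).continuousOn.smul
    (hf.comp (c.smooth i).continuous.continuousOn fun _ ht => c.curve_mem_support i ht)

theorem intervalIntegrable_integrand (c : Contour) (i : Fin c.num) {f : ℂ → F}
    (hf : ContinuousOn f c.support) :
    IntervalIntegrable (fun t => deriv (c.curve i) t • f (c.curve i t)) volume 0 1 :=
  ContinuousOn.intervalIntegrable (by
    rw [Set.uIcc_of_le zero_le_one]; exact c.continuousOn_integrand i hf)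

theorem integral_congr (c : Contour) {f g : ℂ → F} (h : Set.EqOn f g c.support) :
    c.integral f = c.integral g := by
  refine Finset.sum_congr rfl fun i _ => intervalIntegral.integral_congr fun t ht => ?_
  rw [Set.uIcc_of_le zero_le_one] at ht
  rw [h (c.curve_mem_support i ht)]

theorem integral_sub (c : Contour) {f g : ℂ → F} (hf : ContinuousOn f c.support)
    (hg : ContinuousOn g c.support) :
    (c.integral fun z => f z - g z) = c.integral f - c.integral g := by
  simp only [Contour.integral, smul_sub]
  rw [← Finset.sum_sub_distrib]
  exact Finset.sum_congr rfl fun i _ => intervalIntegral.integral_sub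
    (c.intervalIntegrable_integrand i hf) (c.intervalIntegrable_integrand i hg)

theorem integral_clm [CompleteSpace F] {G : Type*} [NormedAddCommGroup G] [NormedSpace ℂ G]
    [CompleteSpace G] (c : Contour) {f : ℂ → F} (hf : ContinuousOn f c.support) (L : F →L[ℂ] G) :
    (c.integral fun z => L (f z)) = L (c.integral f) := by
  simp only [Contour.integral, map_sum]
  refine Finset.sum_congr rfl fun i _ => ?_
  rw [← L.intervalIntegral_comp_comm (c.intervalIntegrable_integrand i hf)]
  simp only [map_smul]

theorem continuousOn_inv (c : Contour) {w : ℂ} (hw : w ∉ c.support) :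
    ContinuousOn (fun z => (z - w)⁻¹) c.support :=
  (continuousOn_id.sub continuousOn_const).inv₀ fun z hz => sub_ne_zero.2 fun h : z = w => hw (h ▸ hz)

theorem integral_inv_eq (c : Contour) (w : ℂ) :
    (c.integral fun z => (z - w)⁻¹) = 2 * Real.pi * Complex.I * c.winding w := by
  rw [winding, mul_inv_cancel_left₀ Complex.two_pi_I_ne_zero]

/-- Differentiation under the integral sign; points within `δ/2` of `w` keep distance at least `δ/2`
from the contour, which gives the domination. -/
theorem hasDerivAt_cauchy (c : Contour) {f : ℂ → F} (hf : ContinuousOn f c.support) {w : ℂ}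
    (hw : w ∉ c.support) :
    HasDerivAt (fun w => c.integral fun z => (z - w)⁻¹ • f z)
      (c.integral fun z => ((z - w) ^ 2)⁻¹ • f z) w := by
  obtain ⟨δ, hδ, hδ'⟩ := Metric.isOpen_iff.1 c.isCompact_support.isClosed.isOpen_compl w hw
  have hdist : ∀ z ∈ c.support, ∀ w' ∈ Metric.ball w (δ / 2), δ / 2 ≤ ‖z - w'‖ := by
    intro z hz w' hw'
    by_contra h
    push Not at h
    refine hδ' (?_ : z ∈ Metric.ball w δ) hz
    rw [Metric.mem_ball] at hw' ⊢
    rw [← dist_eq_norm] at h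
    linarith [dist_triangle z w' w]
  have hout : ∀ w' ∈ Metric.ball w (δ / 2), w' ∉ c.support := by
    intro w' hw' h
    have := hdist _ h _ hw'
    rw [sub_self, norm_zero] at this
    linarith
  simp only [Contour.integral]
  refine HasDerivAt.fun_sum fun i _ => ?_
  have hint : ∀ w' ∈ Metric.ball w (δ / 2), IntervalIntegrable
      (fun t => deriv (c.curve i) t • (c.curve i t - w')⁻¹ • f (c.curve i t)) volume 0 1 :=
    fun w' hw' => c.intervalIntegrable_integrand i ((c.continuousOn_inv (hout w' hw')).smul hf)
  have hint2 : IntervalIntegrable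
      (fun t => deriv (c.curve i) t • ((c.curve i t - w) ^ 2)⁻¹ • f (c.curve i t)) volume 0 1 := by
    refine c.intervalIntegrable_integrand i (f := fun z => ((z - w) ^ 2)⁻¹ • f z)
      (ContinuousOn.smul ?_ hf)
    exact ((c.continuousOn_inv hw).pow 2).congr fun z _ => (inv_pow (z - w) 2).symm
  refine (intervalIntegral.hasDerivAt_integral_of_dominated_loc_of_deriv_le
    (F := fun w' t => deriv (c.curve i) t • (c.curve i t - w')⁻¹ • f (c.curve i t))
    (F' := fun w' t => deriv (c.curve i) t • ((c.curve i t - w') ^ 2)⁻¹ • f (c.curve i t))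
    (bound := fun t => (δ / 2)⁻¹ ^ 2 * ‖deriv (c.curve i) t • f (c.curve i t)‖)
    (Metric.ball_mem_nhds w (half_pos hδ)) ?_
    (hint w (Metric.mem_ball_self (half_pos hδ))) ?_ ?_ ?_ ?_).2
  · filter_upwards [Metric.ball_mem_nhds w (half_pos hδ)] with w' hw'
    exact (hint w' hw').aestronglyMeasurable_restrict_uIoc
  · exact hint2.aestronglyMeasurable_restrict_uIoc
  · refine Eventually.of_forall fun t ht w' hw' => ?_
    rw [Set.uIoc_of_le zero_le_one] at ht
    have h1 := hdist _ (c.curve_mem_support i ⟨ht.1.le, ht.2⟩) w' hw'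
    have h2 : ‖((c.curve i t - w') ^ 2)⁻¹‖ ≤ (δ / 2)⁻¹ ^ 2 := by
      rw [norm_inv, norm_pow, ← inv_pow]
      gcongr
    rw [smul_comm, norm_smul]
    gcongr
  · exact ((c.intervalIntegrable_integrand i hf).norm).const_mul _
  · refine Eventually.of_forall fun t ht w' hw' => ?_
    rw [Set.uIoc_of_le zero_le_one] at ht
    have h1 : c.curve i t - w' ≠ 0 := sub_ne_zero.2 fun h =>
      hout w' hw' (h ▸ c.curve_mem_support i ⟨ht.1.le, ht.2⟩)
    have h2 : HasDerivAt (fun w' => (c.curve i t - w')⁻¹) ((c.curve i t - w') ^ 2)⁻¹ w' := by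
      exact (((hasDerivAt_id w').const_sub (c.curve i t)).inv h1).congr_deriv (by simp)
    exact (h2.smul_const _).const_smul _

/-- The integrand has the primitive `-(z - w)⁻¹` and every curve is closed. Hence the winding number
has derivative zero off the contour. -/
theorem integral_inv_sq (c : Contour) {w : ℂ} (hw : w ∉ c.support) :
    (c.integral fun z => ((z - w) ^ 2)⁻¹) = 0 := by
  refine Finset.sum_eq_zero fun i _ => ?_
  have hcont : ContinuousOn (fun z => ((z - w) ^ 2)⁻¹) c.support := by
    exact ((c.continuousOn_inv hw).pow 2).congr fun z _ => (inv_pow (z - w) 2).symm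
  have h := intervalIntegral.integral_eq_sub_of_hasDerivAt
    (f := fun t => -(c.curve i t - w)⁻¹)
    (f' := fun t => deriv (c.curve i) t • ((c.curve i t - w) ^ 2)⁻¹) (a := 0) (b := 1)
    (fun t ht => ?_) (c.intervalIntegrable_integrand i hcont)
  · rw [h, c.closed i, sub_self]
  · rw [Set.uIcc_of_le zero_le_one] at ht
    have h1 : c.curve i t - w ≠ 0 := sub_ne_zero.2 fun h =>
      hw (h ▸ c.curve_mem_support i ht)
    have h2 := ((((c.smooth i).differentiable one_ne_zero) t).hasDerivAt.sub_const w).inv h1 |>.neg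
    exact h2.congr_deriv (by simp [div_eq_mul_inv])

theorem eventually_winding_eq (c : Contour) {w : ℂ} (hw : w ∉ c.support) :
    ∀ᶠ w' in 𝓝 w, w' ∉ c.support ∧ c.winding w' = c.winding w := by
  have hd : ∀ w' ∉ c.support, HasDerivAt c.winding 0 w' := by
    intro w' hw'
    have h := (c.hasDerivAt_cauchy (f := fun _ => (1 : ℂ)) continuousOn_const hw').const_mul
      (2 * Real.pi * Complex.I)⁻¹
    simp only [smul_eq_mul, mul_one] at h
    rw [c.integral_inv_sq hw', mul_zero] at h
    exact h
  obtain ⟨δ, hδ, hδ'⟩ := Metric.isOpen_iff.1 c.isCompact_support.isClosed.isOpen_compl w hw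
  filter_upwards [Metric.ball_mem_nhds w hδ] with w' hw'
  refine ⟨hδ' hw', ?_⟩
  exact Metric.isOpen_ball.is_const_of_deriv_eq_zero (convex_ball w δ).isPreconnected
    (fun z hz => (hd z (hδ' hz)).differentiableAt.differentiableWithinAt)
    (fun z hz => (hd z (hδ' hz)).deriv) hw' (Metric.mem_ball_self hδ)

end Contour

/-! ### Contour integrals of bounded resolvents -/

section BoundedResolvent

variable {B : Type*} [NormedRing B] [NormedAlgebra ℂ B]

theorem resolvent_mul_resolvent {a : B} {z w : ℂ} (hz : z ∈ resolventSet ℂ a)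
    (hw : w ∈ resolventSet ℂ a) (h : z ≠ w) :
    resolvent a z * resolvent a w = (z - w)⁻¹ • (resolvent a w - resolvent a z) := by
  have h1 := Ring.inverse_mul_cancel _ hz
  have h2 := Ring.mul_inverse_cancel _ hw
  have h3 : (z - w) • (resolvent a z * resolvent a w) = resolvent a w - resolvent a z := by
    calc (z - w) • (resolvent a z * resolvent a w)
        = resolvent a z * ((algebraMap ℂ B z - a) - (algebraMap ℂ B w - a)) * resolvent a w := by
          rw [sub_sub_sub_cancel_right, ← map_sub, Algebra.algebraMap_eq_smul_one, mul_smul_comm,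
            mul_one, smul_mul_assoc]
      _ = _ := by
          rw [mul_sub, sub_mul]
          simp only [resolvent]
          rw [h1, one_mul, mul_assoc, h2, mul_one]
  rw [← h3, inv_smul_smul₀ (sub_ne_zero.2 h)]

theorem continuousOn_resolvent [CompleteSpace B] (a : B) :
    ContinuousOn (resolvent a) (resolventSet ℂ a) := fun _ hz =>
  (spectrum.hasDerivAt_resolvent_const_left hz).continuousAt.continuousWithinAt

/-- A contour in the resolvent set that winds the same number of times around every point of the
spectrum. -/
theorem Contour.integral_resolvent [CompleteSpace B] (c : Contour) {a : B} {n : ℂ}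
    (hc : c.support ⊆ resolventSet ℂ a) (hn : ∀ w ∈ spectrum ℂ a, c.winding w = n) :
    c.integral (resolvent a) = (2 * Real.pi * Complex.I * n) • (1 : B) := by
  classical
  set J := c.integral (resolvent a)
  have hcont := (continuousOn_resolvent a).mono hc
  -- Integrating the first resolvent identity in `z` separates the winding number from a Cauchy
  -- integral that also makes sense for `w` in the spectrum.
  have key : ∀ w ∉ spectrum ℂ a, w ∉ c.support → J * resolvent a w =
      (2 * Real.pi * Complex.I * c.winding w) • resolvent a w -
        c.integral fun z => (z - w)⁻¹ • resolvent a z := by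
    intro w hw hws
    have h1 : J * resolvent a w = c.integral fun z => resolvent a z * resolvent a w :=
      (c.integral_clm hcont ((ContinuousLinearMap.mul ℂ B).flip (resolvent a w))).symm
    have h2 : (c.integral fun z => (z - w)⁻¹ • resolvent a w) =
        (2 * Real.pi * Complex.I * c.winding w) • resolvent a w := by
      rw [← c.integral_inv_eq]
      exact c.integral_clm (c.continuousOn_inv hws)
        ((ContinuousLinearMap.id ℂ ℂ).smulRight (resolvent a w))
    rw [h1, ← h2]
    refine (c.integral_congr fun z hz => ?_).trans (c.integral_sub
      (f := fun z => (z - w)⁻¹ • resolvent a w) (g := fun z => (z - w)⁻¹ • resolvent a z)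
      ((c.continuousOn_inv hws).smul continuousOn_const) ((c.continuousOn_inv hws).smul hcont))
    rw [resolvent_mul_resolvent (hc hz) (not_not.1 hw) (fun h => hws (h ▸ hz)), smul_sub]
  set M : B := J - (2 * Real.pi * Complex.I * n) • (1 : B)
  -- `M` is the defect to be shown zero. By `key` and the local constancy of the winding number, `M
  -- (w - a)⁻¹` continues across the spectrum as a Cauchy integral. The result is entire and
  -- vanishes at infinity, so it is zero by Liouville, and cancelling an invertible resolvent gives
  -- `M = 0`.
  set h : ℂ → B := fun w => if w ∈ spectrum ℂ a then
    -(c.integral fun z => (z - w)⁻¹ • resolvent a z) else M * resolvent a w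
  have hdiff : Differentiable ℂ h := by
    intro w
    by_cases hw : w ∈ spectrum ℂ a
    · have hws : w ∉ c.support := fun h => hw (hc h)
      refine ((c.hasDerivAt_cauchy hcont hws).neg.congr_of_eventuallyEq ?_).differentiableAt
      filter_upwards [c.eventually_winding_eq hws] with w' hw'
      simp only [h]
      split_ifs with hs
      · rfl
      · rw [sub_mul, key w' hs hw'.1, hw'.2, hn w hw, smul_mul_assoc, one_mul]
        simp
    · refine ((((spectrum.hasDerivAt_resolvent_const_left (not_not.1 hw)).const_mul M)
        ).congr_of_eventuallyEq ?_).differentiableAt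
      filter_upwards [(spectrum.isClosed a).isOpen_compl.mem_nhds hw] with w' hw'
      exact if_neg hw'
  have hlim : Tendsto h (cocompact ℂ) (𝓝 0) := by
    rw [← Metric.cobounded_eq_cocompact]
    have h1 := (spectrum.resolvent_tendsto_cobounded (𝕜 := ℂ) a).const_mul M
    rw [mul_zero] at h1
    refine h1.congr' ?_
    filter_upwards [(spectrum.isBounded (𝕜 := ℂ) a)] with w hw
    exact (if_neg hw).symm
  obtain ⟨w, hw⟩ : ∃ w : ℂ, w ∉ spectrum ℂ a := by
    by_contra! hall
    refine NormedSpace.unbounded_univ ℂ ℂ ?_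
    rw [← Set.eq_univ_of_forall hall]
    exact spectrum.isBounded a
  have hzero := hdiff.apply_eq_of_tendsto_cocompact w hlim
  simp only [h, if_neg hw] at hzero
  have hu := Ring.inverse_mul_cancel _ (not_not.1 hw)
  have : M * (resolvent a w * (algebraMap ℂ B w - a)) = 0 := by rw [← mul_assoc, hzero, zero_mul]
  rw [resolvent, hu, mul_one] at this
  exact sub_eq_zero.1 this

end BoundedResolvent

/-! ### Resolvents and Riesz projections of unbounded operators -/

section UnboundedResolvent

variable {E : Type*} [NormedAddCommGroup E] [NormedSpace ℂ E]

theorem Contour.integral_apply_subtype [CompleteSpace E] (c : Contour) {K : Submodule ℂ E}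
    [CompleteSpace K] {f : ℂ → K →L[ℂ] K} {g : ℂ → E →L[ℂ] E} (hf : ContinuousOn f c.support)
    (hg : ContinuousOn g c.support) (y : K) (h : ∀ z ∈ c.support, (f z y : E) = g z y) :
    c.integral g y = (c.integral f y : E) := by
  have h2 := c.integral_clm hf (K.subtypeL ∘L ContinuousLinearMap.apply ℂ K y)
  have h3 := c.integral_clm hg (ContinuousLinearMap.apply ℂ E (y : E))
  exact h3.symm.trans ((c.integral_congr fun z hz => (h z hz).symm).trans h2)

theorem isResolventAt_iff {T : E →ₗ.[ℂ] E} {z : ℂ} {R : E →L[ℂ] E} :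
    IsResolventAt T z R ↔ (∀ x, (R x, z • R x - x) ∈ T.graph) ∧
      ∀ y f, (y, f) ∈ T.graph → R (z • y - f) = y := by
  refine and_congr (forall_congr' fun x => ?_) ?_
  · constructor
    · rintro ⟨h, hx⟩
      have := T.mem_graph ⟨R x, h⟩
      rwa [show T ⟨R x, h⟩ = z • R x - x by rw [eq_sub_iff_add_eq, eq_comm, ← sub_eq_iff_eq_add', hx]] at this
    · intro h
      have hd := LinearPMap.mem_domain_of_mem_graph h
      refine ⟨hd, ?_⟩
      rw [← (LinearPMap.image_iff hd).2 h]
      abel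
  · constructor
    · intro h y f hy
      obtain ⟨y, rfl, rfl⟩ := T.mem_graph_iff.1 hy
      exact h y
    · intro h y
      exact h _ _ (T.mem_graph y)

theorem IsResolventAt.res_eq {T : E →ₗ.[ℂ] E} {z : ℂ} {R : E →L[ℂ] E} (h : IsResolventAt T z R) :
    res T z = R := by
  have hex : ∃ R : E →L[ℂ] E, IsResolventAt T z R := ⟨R, h⟩
  rw [res, dif_pos hex]
  exact hex.choose_spec.unique h

theorem isResolventAt_res {T : E →ₗ.[ℂ] E} {z : ℂ} (hz : z ∈ resSet T) :
    IsResolventAt T z (res T z) := by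
  obtain ⟨R, hR⟩ := hz
  rwa [hR.res_eq]

/-- Factorisation `z - T = (1 + (z - w) R)(w - T)`; it yields norm continuity of the resolvent. -/
theorem IsResolventAt.of_near {T : E →ₗ.[ℂ] E} {z w : ℂ} {R : E →L[ℂ] E}
    (h : IsResolventAt T w R) {u : (E →L[ℂ] E)ˣ} (hu : (u : E →L[ℂ] E) = 1 + (z - w) • R) :
    IsResolventAt T z (R * ↑u⁻¹) := by
  rw [isResolventAt_iff] at h ⊢
  have hcomm : R * ↑u⁻¹ = ↑u⁻¹ * R := by
    have : Commute (u : E →L[ℂ] E) R := by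
      rw [hu]
      exact (Commute.one_left R).add_left ((Commute.refl R).smul_left _)
    exact (this.units_inv_left).eq.symm
  have hux : ∀ x, x = (↑u⁻¹ : E →L[ℂ] E) x + (z - w) • R ((↑u⁻¹ : E →L[ℂ] E) x) := fun x => by
    have := congrArg (fun X : E →L[ℂ] E => X x) u.mul_inv
    rw [hu] at this
    exact this.symm
  constructor
  · intro x
    set y := (↑u⁻¹ : E →L[ℂ] E) x
    change (R y, z • R y - x) ∈ T.graph
    have : z • R y - x = w • R y - y := by
      nth_rw 1 [hux x]
      rw [sub_smul]
      abel
    rw [this]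
    exact h.1 y
  · intro y f hy
    have h1 : R (z • y - f) = (u : E →L[ℂ] E) y := by
      have : z • y - f = (w • y - f) + (z - w) • y := by rw [sub_smul]; abel
      rw [this, map_add, h.2 y f hy, map_smul, hu]
      rfl
    rw [hcomm]
    change (↑u⁻¹ : E →L[ℂ] E) (R (z • y - f)) = y
    rw [h1]
    exact congrArg (fun X : E →L[ℂ] E => X y) u.inv_mul

theorem continuousOn_res [CompleteSpace E] (T : E →ₗ.[ℂ] E) : ContinuousOn (res T) (resSet T) := by
  intro w hw
  refine ContinuousAt.continuousWithinAt ?_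
  have hR := isResolventAt_res hw
  set R := res T w with hRdef
  have hc : ContinuousAt (fun z : ℂ => 1 + (z - w) • R) w := by fun_prop
  have h1 : ContinuousAt (fun z : ℂ => R * Ring.inverse (1 + (z - w) • R)) w := by
    refine continuousAt_const.mul (ContinuousAt.comp' ?_ hc)
    rw [sub_self, zero_smul, add_zero]
    exact NormedRing.inverse_continuousAt (1 : (E →L[ℂ] E)ˣ)
  refine h1.congr ?_
  have h2 : ∀ᶠ z in 𝓝 w, IsUnit (1 + (z - w) • R) := by
    refine hc.eventually (Units.isOpen.mem_nhds ?_)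
    simp
  filter_upwards [h2] with z hz
  obtain ⟨u, hu⟩ := hz
  rw [← hu, Ring.inverse_unit]
  exact (hR.of_near hu).res_eq.symm

theorem Contour.integral_resolvent_clm [CompleteSpace E] (c : Contour) {T : E →L[ℂ] E} {n : ℂ}
    (hc : c.support ⊆ resolventSet ℂ T) (hn : ∀ w ∈ spectrum ℂ T, c.winding w = n) :
    c.integral (resolvent T) = (2 * Real.pi * Complex.I * n) • (1 : E →L[ℂ] E) :=
  c.integral_resolvent (a := T) (n := n) hc hn

/-- On a subspace where the resolvent agrees with that of a bounded operator, the Riesz integral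
reduces to the bounded case and acts as the common winding number. -/
theorem Contour.riesz_apply_of_invariant [CompleteSpace E] (c : Contour) {T : E →ₗ.[ℂ] E}
    (hc : c.support ⊆ resSet T) {K : Submodule ℂ E} [CompleteSpace K] {B : K →L[ℂ] K} {n : ℂ}
    (hn : ∀ w ∈ spectrum ℂ B, c.winding w = n)
    (hsub : c.support ⊆ resolventSet ℂ B)
    (h : ∀ z ∈ c.support, ∀ x : K, (resolvent B z x : E) = res T z x) (y : K) : ((2 * Real.pi * Complex.I : ℂ)⁻¹ • c.integral (res T)) (y : E) = n • (y : E) := by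
  have h1 : c.integral (resolvent B) = (2 * Real.pi * Complex.I * n) • (1 : K →L[ℂ] K) :=
    c.integral_resolvent_clm (E := K) hsub hn
  have h2 : c.integral (res T) y = (c.integral (resolvent B) y : E) :=
    c.integral_apply_subtype (f := resolvent B) ((continuousOn_resolvent B).mono hsub)
      ((continuousOn_res T).mono hc) y fun z hz => h z hz y
  change (2 * Real.pi * Complex.I : ℂ)⁻¹ • c.integral (res T) (y : E) = _
  rw [h2, h1]
  change (2 * Real.pi * Complex.I : ℂ)⁻¹ • (2 * Real.pi * Complex.I * n) • (y : E) = n • (y : E)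
  rw [smul_smul, inv_mul_cancel_left₀ Complex.two_pi_I_ne_zero]

section Similar

variable {A₁ A₂ : E →ₗ.[ℂ] E} {U : E ≃L[ℂ] E}

theorem IsResolventAt.conj (hG : ∀ x f, (x, f) ∈ A₂.graph ↔ (U x, U f) ∈ A₁.graph) {z : ℂ}
    {R : E →L[ℂ] E} (h : IsResolventAt A₂ z R) :
    IsResolventAt A₁ z ((U : E →L[ℂ] E) * R * (U.symm : E →L[ℂ] E)) := by
  rw [isResolventAt_iff] at h ⊢
  constructor
  · intro x
    have := (hG _ _).1 (h.1 (U.symm x))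
    rwa [map_sub, map_smul, U.apply_symm_apply] at this
  · intro y f hy
    have h1 : (U.symm y, U.symm f) ∈ A₂.graph := by
      rw [hG, U.apply_symm_apply, U.apply_symm_apply]
      exact hy
    have := h.2 _ _ h1
    change U (R (U.symm (z • y - f))) = y
    rw [map_sub, map_smul, this, U.apply_symm_apply]

theorem resSet_subset_of_similar (hG : ∀ x f, (x, f) ∈ A₂.graph ↔ (U x, U f) ∈ A₁.graph) :
    resSet A₂ ⊆ resSet A₁ := fun _ ⟨_, hR⟩ => ⟨_, hR.conj hG⟩

theorem graph_symm_of_similar (hG : ∀ x f, (x, f) ∈ A₂.graph ↔ (U x, U f) ∈ A₁.graph) (x f : E) :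
    (x, f) ∈ A₁.graph ↔ (U.symm x, U.symm f) ∈ A₂.graph := by
  rw [hG, U.apply_symm_apply, U.apply_symm_apply]

/-- The same contour works, because similar operators share their resolvent set and conjugation by
`U` passes through the integral. -/
theorem IsRieszProjection.conj [CompleteSpace E]
    (hG : ∀ x f, (x, f) ∈ A₂.graph ↔ (U x, U f) ∈ A₁.graph)
    {σ : Set ℂ} {Q : E →L[ℂ] E} (h : IsRieszProjection A₂ σ Q) :
    IsRieszProjection A₁ σ ((U : E →L[ℂ] E) * Q * (U.symm : E →L[ℂ] E)) := by
  obtain ⟨c, hc, h1, h2, rfl⟩ := h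
  have hres : resSet A₂ = resSet A₁ := Set.Subset.antisymm (resSet_subset_of_similar hG)
    (resSet_subset_of_similar (graph_symm_of_similar hG))
  refine ⟨c, hres ▸ hc, h1, ?_, ?_⟩
  · rwa [spec, ← hres]
  · rw [mul_smul_comm, smul_mul_assoc]
    congr 1
    have := c.integral_clm ((continuousOn_res A₂).mono hc)
      ((ContinuousLinearMap.mul ℂ (E →L[ℂ] E)).flip (U.symm : E →L[ℂ] E) ∘L
        (ContinuousLinearMap.mul ℂ (E →L[ℂ] E) (U : E →L[ℂ] E)))
    refine this.symm.trans (c.integral_congr fun z hz => ?_)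
    exact ((isResolventAt_res (hc hz)).conj hG).res_eq.symm

end Similar

end UnboundedResolvent

/-! ### Riesz projections of block diagonal operators -/

section Blocks

variable {H : Type*} [NormedAddCommGroup H] [InnerProductSpace ℂ H] [CompleteSpace H] {ω : ℝ}

theorem ext_modeL {X Y : L2 ω H →L[ℂ] L2 ω H} (hω : 0 < ω)
    (h : ∀ l u, X (modeL ω H l u) = Y (modeL ω H l u)) : X = Y := by
  ext1 x
  have h1 := (hasSum_modeL hω x).mapL X
  have h2 := (hasSum_modeL hω x).mapL Y
  simp only [h] at h1
  exact h1.unique h2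

/-- `∑_{ℓ ∈ F} λ_ℓ P_ℓ`. -/
def diagF (ω : ℝ) (H : Type*) [NormedAddCommGroup H] [InnerProductSpace ℂ H] [CompleteSpace H]
    (F : Finset ℤ) : L2 ω H →L[ℂ] L2 ω H := ∑ l ∈ F, lam ω l • proj ω H l

theorem coeffL_diagF (hω : 0 < ω) (F : Finset ℤ) (j : ℤ) (x : L2 ω H) :
    coeffL ω H j (diagF ω H F x) = if j ∈ F then lam ω j • coeffL ω H j x else 0 := by
  simp only [diagF, sum_apply, smul_apply, map_sum, map_smul, coeffL_proj hω, smul_ite, smul_zero]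
  rw [Finset.sum_ite_eq]

/-- `σ` is the spectrum of the part of `L₀ - A` in the range of `∑_{ℓ ∈ F} P_ℓ`, a subspace which
reduces `A`. -/
def IsBlockSpectrum (A : L2 ω H →L[ℂ] L2 ω H) (F : Finset ℤ) (σ : Set ℂ) : Prop :=
  ∃ (K : Submodule ℂ (L2 ω H)) (B : K →L[ℂ] K), (∀ x, x ∈ K ↔ projF ω H F x = x) ∧
    (∀ x : K, (B x : L2 ω H) = diagF ω H F x - A x) ∧
    (∀ x, A (projF ω H F x) = projF ω H F (A x)) ∧ σ = spectrum ℂ B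

theorem mem_graph_pert_of_block (hω : 0 < ω) {A : L2 ω H →L[ℂ] L2 ω H} {F : Finset ℤ} {x : L2 ω H}
    (hx : projF ω H F x = x) : (x, diagF ω H F x - A x) ∈ (pert A).graph := by
  rw [mem_graph_pert_iff, sub_add_cancel, mem_derivGraph_iff hω]
  intro l
  rw [coeffL_diagF hω]
  split_ifs with hl
  · rfl
  · rw [← hx, coeffL_projF hω, if_neg hl, smul_zero]

theorem projF_mem_graph_pert (hω : 0 < ω) {A : L2 ω H →L[ℂ] L2 ω H} {F : Finset ℤ}
    (hA : ∀ x, A (projF ω H F x) = projF ω H F (A x)) {x f : L2 ω H}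
    (h : (x, f) ∈ (pert A).graph) : (projF ω H F x, projF ω H F f) ∈ (pert A).graph := by
  rw [mem_graph_pert_iff, mem_derivGraph_iff hω] at h ⊢
  intro l
  rw [hA, ← map_add, coeffL_projF hω, coeffL_projF hω, h l, smul_ite, smul_zero]

theorem res_projF (hω : 0 < ω) {A : L2 ω H →L[ℂ] L2 ω H} {F : Finset ℤ}
    (hA : ∀ x, A (projF ω H F x) = projF ω H F (A x)) {z : ℂ} (hz : z ∈ resSet (pert A))
    (x : L2 ω H) : res (pert A) z (projF ω H F x) = projF ω H F (res (pert A) z x) := by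
  have hR := isResolventAt_iff.1 (isResolventAt_res hz)
  have h := hR.2 _ _ (projF_mem_graph_pert hω hA (hR.1 x))
  rwa [map_sub (projF ω H F), map_smul, sub_sub_cancel] at h

/-- The full resolvent commutes with the block projection, so it restricts to the block and inverts
`z - B` there. -/
theorem exists_resolvent_block (hω : 0 < ω) {A : L2 ω H →L[ℂ] L2 ω H} {F : Finset ℤ}
    {K : Submodule ℂ (L2 ω H)} {B : K →L[ℂ] K} (hK : ∀ x, x ∈ K ↔ projF ω H F x = x)
    (hB : ∀ x : K, (B x : L2 ω H) = diagF ω H F x - A x)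
    (hA : ∀ x, A (projF ω H F x) = projF ω H F (A x)) {z : ℂ} (hz : z ∈ resSet (pert A)) :
    z ∈ resolventSet ℂ B ∧ ∀ x : K, (resolvent B z x : L2 ω H) = res (pert A) z x := by
  have hR := isResolventAt_iff.1 (isResolventAt_res hz)
  set R := res (pert A) z
  have hRK : ∀ x : K, R x ∈ K := fun x => by
    rw [hK, ← res_projF hω hA hz, (hK _).1 x.2]
  let r : K →L[ℂ] K := (R ∘L K.subtypeL).codRestrict K hRK
  have hgr : ∀ x : K, ((x : L2 ω H), (B x : L2 ω H)) ∈ (pert A).graph := fun x => by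
    rw [hB]; exact mem_graph_pert_of_block hω ((hK _).1 x.2)
  have h1 : (algebraMap ℂ (K →L[ℂ] K) z - B) * r = 1 := by
    ext1 x
    refine Subtype.ext ?_
    change z • R x - (B (r x) : L2 ω H) = x
    have := LinearPMap.mem_graph_snd_inj _ (hgr (r x)) (hR.1 x) rfl
    rw [this, sub_sub_cancel]
  have h2 : r * (algebraMap ℂ (K →L[ℂ] K) z - B) = 1 := by
    ext1 x
    refine Subtype.ext ?_
    change R (z • (x : L2 ω H) - (B x : L2 ω H)) = x
    exact hR.2 _ _ (hgr x)
  let u : (K →L[ℂ] K)ˣ := ⟨_, r, h1, h2⟩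
  have hu : resolvent B z = r := Ring.inverse_unit u
  refine ⟨u.isUnit, fun x => ?_⟩
  rw [hu]
  rfl

theorem IsBlockSpectrum.subset_spec (hω : 0 < ω) {A : L2 ω H →L[ℂ] L2 ω H} {F : Finset ℤ}
    {σ : Set ℂ} (h : IsBlockSpectrum A F σ) : σ ⊆ spec (pert A) := by
  obtain ⟨K, B, hK, hB, hA, rfl⟩ := h
  exact fun z hz hz' => hz (exists_resolvent_block hω hK hB hA hz').1

theorem completeSpace_of_mem_iff {K : Submodule ℂ (L2 ω H)} {F : Finset ℤ}
    (hK : ∀ x, x ∈ K ↔ projF ω H F x = x) : CompleteSpace K := by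
  have : IsClosed (K : Set (L2 ω H)) := by
    have e : (K : Set (L2 ω H)) = {x | projF ω H F x = x} := Set.ext hK
    rw [e]
    exact isClosed_eq (projF ω H F).continuous continuous_id
  exact this.completeSpace_coe

theorem IsBlockSpectrum.integral_res (hω : 0 < ω) {A : L2 ω H →L[ℂ] L2 ω H} {F : Finset ℤ}
    {σ : Set ℂ} (h : IsBlockSpectrum A F σ) {c : Contour} (hc : c.support ⊆ resSet (pert A)) {n : ℂ}
    (hn : ∀ w ∈ σ, c.winding w = n) {x : L2 ω H} (hx : projF ω H F x = x) :
    ((2 * Real.pi * Complex.I : ℂ)⁻¹ • c.integral (res (pert A))) x = n • x := by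
  obtain ⟨K, B, hK, hB, hA, rfl⟩ := h
  have := completeSpace_of_mem_iff hK
  exact c.riesz_apply_of_invariant hc hn (fun z hz => (exists_resolvent_block hω hK hB hA (hc hz)).1)
    (fun z hz => (exists_resolvent_block hω hK hB hA (hc hz)).2) ⟨x, (hK x).2 hx⟩

/-- It suffices to test on modes. A mode in `F` sees winding number one. Any other mode lies in a
block whose spectrum is part of the spectrum of `L₀ - A` outside `σ`, hence sees winding number
zero. -/
theorem IsBlockSpectrum.riesz_eq (hω : 0 < ω) {A : L2 ω H →L[ℂ] L2 ω H} {F : Finset ℤ}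
    {σ : Set ℂ} (h : IsBlockSpectrum A F σ) {Q : L2 ω H →L[ℂ] L2 ω H}
    (hQ : IsRieszProjection (pert A) σ Q)
    (hcover : ∀ l ∉ F, ∃ F' σ', l ∈ F' ∧ IsBlockSpectrum A F' σ' ∧
      Disjoint σ σ') : Q = projF ω H F := by
  obtain ⟨c, hc, h1, h2, rfl⟩ := hQ
  refine ext_modeL hω fun l u => ?_
  by_cases hl : l ∈ F
  · have hx : projF ω H F (modeL ω H l u) = modeL ω H l u := by rw [projF_modeL hω, if_pos hl]
    rw [h.integral_res hω hc h1 hx, one_smul, hx]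
  · obtain ⟨F', σ', hl', hb, hd⟩ := hcover l hl
    have hx : projF ω H F' (modeL ω H l u) = modeL ω H l u := by rw [projF_modeL hω, if_pos hl']
    rw [hb.integral_res hω hc (fun w hw => h2 w ⟨hb.subset_spec hω hw,
      fun hw' => Set.disjoint_left.1 hd hw' hw⟩) hx, zero_smul, projF_modeL hω, if_neg hl]

/-- The maximum is needed because for `n ≤ k` the sum over `k < |l| ≤ n` is empty and the central
block alone remains. -/
theorem projF_sym_max (k n : ℕ) : projF ω H (sym (max k n)) = projF ω H (sym k) +
    ∑ l ∈ (Finset.Icc (-(n : ℤ)) n).filter (fun l => (k : ℤ) < |l|), proj ω H l := by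
  rw [projF, projF, ← Finset.sum_union]
  · refine Finset.sum_congr ?_ fun _ _ => rfl
    ext l
    rw [Finset.mem_union, Finset.mem_filter, mem_sym, mem_sym]
    change _ ↔ _ ∨ l ∈ sym n ∧ _
    rw [mem_sym]
    push_cast
    omega
  · rw [Finset.disjoint_left]
    intro l hl hl'
    have := (Finset.mem_filter.1 hl').2
    rw [mem_sym] at hl
    omega

namespace Reduction

variable {V : Potential ω H} {k : ℕ} {U : L2 ω H ≃L[ℂ] L2 ω H} {V₀ : L2 ω H →L[ℂ] L2 ω H}

theorem projF_apply (hω : 0 < ω) (hR : Reduction V k U V₀) {F : Finset ℤ}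
    (hF : F = sym k ∨ ∃ l, F = {l} ∧ (k : ℤ) < |l|) {x : L2 ω H} (hx : projF ω H F x = x) :
    projF ω H F (V₀ x) = V₀ x := by
  rw [← mem_range_projF_iff hω] at hx ⊢
  rcases hF with rfl | ⟨l, rfl, hl⟩
  · exact hR.invariant_low x hx
  · rw [← proj_eq] at hx ⊢
    exact hR.invariant l hl x hx

theorem exists_block (k : ℕ) (l : ℤ) :
    ∃ F : Finset ℤ, (F = sym k ∨ ∃ l, F = {l} ∧ (k : ℤ) < |l|) ∧ l ∈ F := by
  by_cases h : l ∈ sym k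
  · exact ⟨_, Or.inl rfl, h⟩
  · rw [mem_sym, not_le] at h
    exact ⟨{l}, Or.inr ⟨l, rfl, h⟩, Finset.mem_singleton_self l⟩

theorem block_unique {k : ℕ} {F F' : Finset ℤ} (hF : F = sym k ∨ ∃ l, F = {l} ∧ (k : ℤ) < |l|)
    (hF' : F' = sym k ∨ ∃ l, F' = {l} ∧ (k : ℤ) < |l|) {l : ℤ} (hl : l ∈ F) (hl' : l ∈ F') :
    F = F' := by
  rcases hF with rfl | ⟨j, rfl, hj⟩ <;> rcases hF' with rfl | ⟨j', rfl, hj'⟩ <;>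
    simp only [mem_sym, Finset.mem_singleton] at hl hl'
  · rfl
  · subst hl'; omega
  · subst hl; omega
  · rw [← hl, ← hl']

/-- Invariance of one subspace would not suffice. The blocks partition `ℤ` and all are invariant, so
`V₀` maps every mode outside `F` into a block disjoint from `F`. -/
theorem commute_projF (hω : 0 < ω) (hR : Reduction V k U V₀) {F : Finset ℤ}
    (hF : F = sym k ∨ ∃ l, F = {l} ∧ (k : ℤ) < |l|) (x : L2 ω H) :
    V₀ (projF ω H F x) = projF ω H F (V₀ x) := by
  suffices h : V₀ * projF ω H F = projF ω H F * V₀ from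
    congrArg (fun X : L2 ω H →L[ℂ] L2 ω H => X x) h
  refine ext_modeL hω fun l u => ?_
  change V₀ (projF ω H F (modeL ω H l u)) = projF ω H F (V₀ (modeL ω H l u))
  obtain ⟨F', hF', hl'⟩ := exists_block k l
  have h1 := hR.projF_apply hω hF' (x := modeL ω H l u) (by rw [projF_modeL hω, if_pos hl'])
  rw [projF_modeL hω]
  split_ifs with hl
  · rw [block_unique hF hF' hl hl', h1]
  · rw [map_zero, ← h1]
    refine ext_coeffL hω fun j => ?_
    rw [coeffL_projF hω, coeffL_projF hω, map_zero]
    split_ifs with h2 h3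
    · exact absurd (block_unique hF hF' h2 h3 ▸ hl') hl
    · rfl
    · rfl

theorem isBlockSpectrum_low (hω : 0 < ω) (hR : Reduction V k U V₀) :
    IsBlockSpectrum V₀ (sym k) hR.sigmaLow :=
  ⟨(projLow ω H k).range, _, fun _ => mem_range_projF_iff hω, fun _ => rfl,
    hR.commute_projF hω (Or.inl rfl), rfl⟩

theorem isBlockSpectrum (hω : 0 < ω) (hR : Reduction V k U V₀) (l : ℤ) (hl : (k : ℤ) < |l|) :
    IsBlockSpectrum V₀ {l} (hR.sigma l hl) := by
  have hK : ∀ x, x ∈ (proj ω H l).range ↔ projF ω H {l} x = x := fun x => by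
    rw [proj_eq]; exact mem_range_projF_iff hω
  refine ⟨(proj ω H l).range,
    algebraMap ℂ _ (lam ω l) - restrictTo V₀ (proj ω H l).range (hR.invariant l hl), hK,
    fun x => ?_, hR.commute_projF hω (Or.inr ⟨l, rfl, hl⟩), ?_⟩
  · have h1 : diagF ω H {l} x = lam ω l • (x : L2 ω H) := by
      rw [diagF, Finset.sum_singleton, smul_apply]
      have := (hK _).1 x.2
      rw [← proj_eq] at this
      rw [this]
    rw [h1]
    rfl
  · rw [← spectrum.singleton_sub_eq, Set.singleton_sub]
    rfl

theorem disjoint_cover_low (hω : 0 < ω) (hR : Reduction V k U V₀) (hS : hR.Separated) :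
    ∀ l ∉ sym k, ∃ F' σ', l ∈ F' ∧ IsBlockSpectrum V₀ F' σ' ∧ Disjoint hR.sigmaLow σ' := by
  intro l hl
  rw [mem_sym, not_le] at hl
  exact ⟨{l}, _, Finset.mem_singleton_self l, hR.isBlockSpectrum hω l hl, hS.1 l hl⟩

theorem disjoint_cover (hω : 0 < ω) (hR : Reduction V k U V₀) (hS : hR.Separated) (l : ℤ)
    (hl : (k : ℤ) < |l|) : ∀ j ∉ ({l} : Finset ℤ), ∃ F' σ', j ∈ F' ∧ IsBlockSpectrum V₀ F' σ' ∧
      Disjoint (hR.sigma l hl) σ' := by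
  intro j hj
  rw [Finset.mem_singleton] at hj
  by_cases h : j ∈ sym k
  · exact ⟨_, _, h, hR.isBlockSpectrum_low hω, (hS.1 l hl).symm⟩
  · rw [mem_sym, not_le] at h
    exact ⟨{j}, _, Finset.mem_singleton_self j, hR.isBlockSpectrum hω j h,
      hS.2 l hl j h (Ne.symm hj)⟩

theorem riesz_eq (hω : 0 < ω) (hR : Reduction V k U V₀) {F : Finset ℤ} {σ : Set ℂ}
    (hb : IsBlockSpectrum V₀ F σ) (hcover : ∀ l ∉ F, ∃ F' σ', l ∈ F' ∧ IsBlockSpectrum V₀ F' σ' ∧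
      Disjoint σ σ') {Q : L2 ω H →L[ℂ] L2 ω H} (hQ : IsRieszProjection (opL V) σ Q) :
    Q = (U : L2 ω H →L[ℂ] L2 ω H) * projF ω H F * (U.symm : L2 ω H →L[ℂ] L2 ω H) := by
  have hG : ∀ x f, (x, f) ∈ (pert V₀).graph ↔ (U x, U f) ∈ (opL V).graph := fun x f =>
    hR.similar.mem_graph
  have h1 := hb.riesz_eq hω (hQ.conj (graph_symm_of_similar hG)) hcover
  rw [← h1]
  ext1 x
  change Q x = U (U.symm (Q (U (U.symm x))))
  rw [U.apply_symm_apply, U.apply_symm_apply]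

theorem partialSumDiff_eq (hω : 0 < ω) (hR : Reduction V k U V₀) (hS : hR.Separated)
    {Qlow : L2 ω H →L[ℂ] L2 ω H} {Q : ℤ → L2 ω H →L[ℂ] L2 ω H}
    (hQ : hR.AreSpectralProjections Qlow Q) (n : ℕ) :
    partialSumDiff k Qlow Q n = (U : L2 ω H →L[ℂ] L2 ω H) * projF ω H (sym (max k n)) *
      (U.symm : L2 ω H →L[ℂ] L2 ω H) - projF ω H (sym (max k n)) := by
  have h1 := hR.riesz_eq hω (hR.isBlockSpectrum_low hω) (hR.disjoint_cover_low hω hS) hQ.1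
  have h2 : ∀ l ∈ (Finset.Icc (-(n : ℤ)) n).filter (fun l => (k : ℤ) < |l|),
      Q l = (U : L2 ω H →L[ℂ] L2 ω H) * proj ω H l * (U.symm : L2 ω H →L[ℂ] L2 ω H) := by
    intro l hl
    have hl' := (Finset.mem_filter.1 hl).2
    rw [proj_eq]
    exact hR.riesz_eq hω (hR.isBlockSpectrum hω l hl') (hR.disjoint_cover hω hS l hl') (hQ.2 l hl')
  rw [partialSumDiff, Finset.sum_congr rfl h2, h1, projF_sym_max, projLow_eq, ← Finset.sum_mul,
    ← Finset.mul_sum, mul_add, add_mul]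
  abel

theorem tendsto_partialSumDiff (hω : 0 < ω) (hR : Reduction V k U V₀) (hS : hR.Separated)
    {Qlow : L2 ω H →L[ℂ] L2 ω H} {Q : ℤ → L2 ω H →L[ℂ] L2 ω H}
    (hQ : hR.AreSpectralProjections Qlow Q) :
    (∀ n : ℕ, MemHS (partialSumDiff k Qlow Q n)) ∧
      Tendsto (fun n : ℕ => hsNorm (partialSumDiff k Qlow Q n)) atTop (𝓝 0) := by
  simp only [hR.partialSumDiff_eq hω hS hQ]
  refine tendsto_hsNorm_conj_projF hω ?_ ?_ hR.memHS_W (fun n => sym (max k n)) fun l => ?_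
  · ext1 x; exact U.apply_symm_apply x
  · ext1 x; exact U.symm_apply_apply x
  · filter_upwards [eventually_mem_sym l] with n hn
    rw [mem_sym] at hn ⊢
    push_cast
    omega

end Reduction

end Blocks

/-! ### Circles as contours -/

section Circle

/-- The positively oriented circle with centre `a` and radius `R`. -/
def circleContour (a : ℂ) (R : ℝ) : Contour where
  num := 1
  curve _ t := circleMap a R (2 * Real.pi * t)
  smooth _ := (contDiff_circleMap a R).comp (contDiff_const.mul contDiff_id)
  closed _ := by
    have := periodic_circleMap a R 0
    rw [zero_add] at this
    rw [mul_zero, mul_one, this]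

theorem circleContour_integral {F : Type*} [NormedAddCommGroup F] [NormedSpace ℂ F] (a : ℂ) (R : ℝ)
    (f : ℂ → F) : (circleContour a R).integral f = ∮ z in C(a, R), f z := by
  have hd : ∀ t : ℝ, deriv (fun t : ℝ => circleMap a R (2 * Real.pi * t)) t =
      (2 * Real.pi) • deriv (circleMap a R) (2 * Real.pi * t) := fun t =>
    deriv_comp_mul_left _ _ _
  have h := intervalIntegral.smul_integral_comp_mul_left (a := 0) (b := 1)
    (fun θ => deriv (circleMap a R) θ • f (circleMap a R θ)) (2 * Real.pi)
  rw [mul_zero, mul_one] at h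
  rw [circleIntegral, ← h, Contour.integral]
  change ∑ _i : Fin 1, _ = _
  rw [Fin.sum_univ_one, ← intervalIntegral.integral_smul]
  refine intervalIntegral.integral_congr fun t _ => ?_
  change deriv (fun t : ℝ => circleMap a R (2 * Real.pi * t)) t • f _ = _
  rw [hd, smul_assoc]
  rfl

theorem circleContour_support_subset (a : ℂ) {R : ℝ} (hR : 0 ≤ R) :
    (circleContour a R).support ⊆ Metric.sphere a R := by
  refine Set.iUnion_subset fun i => ?_
  rintro _ ⟨t, -, rfl⟩
  exact circleMap_mem_sphere a hR _

theorem circleContour_winding_of_mem_ball {a w : ℂ} {R : ℝ} (hw : w ∈ Metric.ball a R) :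
    (circleContour a R).winding w = 1 := by
  rw [Contour.winding, circleContour_integral, circleIntegral.integral_sub_inv_of_mem_ball hw,
    inv_mul_cancel₀ Complex.two_pi_I_ne_zero]

theorem circleContour_winding_of_notMem_closedBall {a w : ℂ} {R : ℝ} (hR : 0 ≤ R)
    (hw : w ∉ Metric.closedBall a R) : (circleContour a R).winding w = 0 := by
  have hne : ∀ z ∈ Metric.closedBall a R, z - w ≠ 0 := fun z hz =>
    sub_ne_zero.2 fun h => hw (h ▸ hz)
  rw [Contour.winding, circleContour_integral,
    Complex.circleIntegral_eq_zero_of_differentiable_on_off_countable hR Set.countable_empty,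
    mul_zero]
  · exact (continuousOn_id.sub continuousOn_const).inv₀ hne
  · intro z hz
    exact (differentiableAt_id.sub_const w).inv (hne z (Metric.ball_subset_closedBall hz.1))

theorem exists_isRieszProjection {E : Type*} [NormedAddCommGroup E] [NormedSpace ℂ E]
    {T : E →ₗ.[ℂ] E} {σ : Set ℂ} {a : ℂ} {R : ℝ} (hR : 0 ≤ R) (h1 : σ ⊆ Metric.ball a R)
    (h2 : ∀ z ∈ Metric.closedBall a R, z ∉ σ → z ∈ resSet T) : ∃ Q, IsRieszProjection T σ Q := by
  refine ⟨_, circleContour a R, fun z hz => ?_,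
    fun w hw => circleContour_winding_of_mem_ball (h1 hw), fun w hw => ?_, rfl⟩
  · have hz' := circleContour_support_subset a hR hz
    exact h2 z (Metric.sphere_subset_closedBall hz') fun hs =>
      (Metric.mem_ball.1 (h1 hs)).ne (Metric.mem_sphere.1 hz')
  · exact circleContour_winding_of_notMem_closedBall hR fun hw' => hw.1 (h2 w hw' hw.2)

end Circle

/-! ### Resolvents assembled from complementary blocks -/

section BlockResolvent

variable {H : Type*} [NormedAddCommGroup H] [InnerProductSpace ℂ H] [CompleteSpace H] {ω : ℝ}

theorem exists_resolvent_on_block (hω : 0 < ω) {A : L2 ω H →L[ℂ] L2 ω H} {F : Finset ℤ} {σ : Set ℂ}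
    (hb : IsBlockSpectrum A F σ) {z : ℂ} (hz : z ∉ σ) :
    ∃ R : L2 ω H →L[ℂ] L2 ω H, (∀ x, (R x, z • R x - projF ω H F x) ∈ (pert A).graph) ∧
      ∀ y f, (y, f) ∈ (pert A).graph → R (z • y - f) = projF ω H F y := by
  obtain ⟨K, B, hK, hB, hA, rfl⟩ := hb
  obtain ⟨u, hu⟩ := not_not.1 hz
  have hP : ∀ x, projF ω H F x ∈ K := fun x => (hK _).2 (projF_projF hω F x)
  have hgr : ∀ x : K, ((x : L2 ω H), (B x : L2 ω H)) ∈ (pert A).graph := fun x => by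
    rw [hB]; exact mem_graph_pert_of_block hω ((hK _).1 x.2)
  have h1 : ∀ x : K, z • (↑u⁻¹ : K →L[ℂ] K) x - B ((↑u⁻¹ : K →L[ℂ] K) x) = x := fun x => by
    have := congrArg (fun X : K →L[ℂ] K => X x) u.mul_inv
    rw [hu] at this
    exact this
  have h2 : ∀ x : K, (↑u⁻¹ : K →L[ℂ] K) (z • x - B x) = x := fun x => by
    have := congrArg (fun X : K →L[ℂ] K => X x) u.inv_mul
    rw [hu] at this
    exact this
  refine ⟨K.subtypeL ∘L (↑u⁻¹ : K →L[ℂ] K) ∘L (projF ω H F).codRestrict K hP, fun x => ?_,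
    fun y f hy => ?_⟩
  · set y : K := (↑u⁻¹ : K →L[ℂ] K) ⟨projF ω H F x, hP x⟩ with hy
    change ((y : L2 ω H), z • (y : L2 ω H) - projF ω H F x) ∈ (pert A).graph
    have h3 : z • (y : L2 ω H) - B y = projF ω H F x :=
      congrArg Subtype.val (h1 ⟨projF ω H F x, hP x⟩)
    rw [← h3, sub_sub_cancel]
    exact hgr y
  · have h3 := projF_mem_graph_pert hω hA hy
    have h4 : projF ω H F f = B ⟨projF ω H F y, hP y⟩ :=
      LinearPMap.mem_graph_snd_inj _ h3 (hgr ⟨projF ω H F y, hP y⟩) rfl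
    have h5 : (⟨projF ω H F (z • y - f), hP _⟩ : K) =
        z • ⟨projF ω H F y, hP y⟩ - B ⟨projF ω H F y, hP y⟩ := by
      refine Subtype.ext ?_
      change projF ω H F (z • y - f) = z • projF ω H F y - (B ⟨projF ω H F y, hP y⟩ : L2 ω H)
      rw [map_sub, map_smul, h4]
    change ((↑u⁻¹ : K →L[ℂ] K) ⟨projF ω H F (z • y - f), hP _⟩ : L2 ω H) = projF ω H F y
    rw [h5, h2]

theorem unit_inv_apply {E : Type*} [NormedAddCommGroup E] [NormedSpace ℂ E] {X : E →L[ℂ] E}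
    {u : (E →L[ℂ] E)ˣ} (hu : (u : E →L[ℂ] E) = 1 + X) (x : E) :
    (↑u⁻¹ : E →L[ℂ] E) x + X ((↑u⁻¹ : E →L[ℂ] E) x) = x ∧ (↑u⁻¹ : E →L[ℂ] E) (x + X x) = x := by
  have h1 := congrArg (fun Y : E →L[ℂ] E => Y x) u.mul_inv
  have h2 := congrArg (fun Y : E →L[ℂ] E => Y x) u.inv_mul
  rw [hu] at h1 h2
  exact ⟨h1, h2⟩

/-- `S` inverts `z - L₀` on the modes outside `F` and vanishes on those in `F`. The partial
resolvent is `S (I + A S)⁻¹ (I - P)`, with `P` the projection onto the modes in `F`. -/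
theorem exists_resolvent_off_block (hω : 0 < ω) {A : L2 ω H →L[ℂ] L2 ω H} {F : Finset ℤ}
    (hA : ∀ x, A (projF ω H F x) = projF ω H F (A x)) {z : ℂ} {s : ℤ → ℂ}
    {S : L2 ω H →L[ℂ] L2 ω H} (hS : ∀ j x, coeffL ω H j (S x) = s j • coeffL ω H j x)
    (h0 : ∀ l ∈ F, s l = 0) (h1 : ∀ l ∉ F, s l * (z - lam ω l) = 1) (hlt : ‖A * S‖ < 1) :
    ∃ R : L2 ω H →L[ℂ] L2 ω H, (∀ x, (R x, z • R x - (x - projF ω H F x)) ∈ (pert A).graph) ∧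
      ∀ y f, (y, f) ∈ (pert A).graph → R (z • y - f) = y - projF ω H F y := by
  obtain ⟨u, hu⟩ := isUnit_one_add_of_norm_lt_one hlt
  have hu' := unit_inv_apply hu
  have hSP : ∀ x, projF ω H F (S x) = 0 := fun x => by
    refine eq_zero_of_coeffL hω _ fun l => ?_
    rw [coeffL_projF hω]
    split_ifs with hl
    · rw [hS, h0 l hl, zero_smul]
    · rfl
  have hAS : ∀ x, projF ω H F (A (S x)) = 0 := fun x => by rw [← hA, hSP, map_zero]
  refine ⟨S * (↑u⁻¹ : L2 ω H →L[ℂ] L2 ω H) * (1 - projF ω H F), fun x => ?_, fun y f hy => ?_⟩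
  · set y := (↑u⁻¹ : L2 ω H →L[ℂ] L2 ω H) (x - projF ω H F x)
    change (S y, z • S y - (x - projF ω H F x)) ∈ (pert A).graph
    have hy : y + A (S y) = x - projF ω H F x := (hu' _).1
    have hPy : projF ω H F y = 0 := by
      have h2 := congrArg (projF ω H F) hy
      rwa [map_add, hAS, add_zero, map_sub, projF_projF hω, sub_self] at h2
    rw [← hy, mem_graph_pert_iff, mem_derivGraph_iff hω]
    have e : z • S y - (y + A (S y)) + A (S y) = z • S y - y := by abel
    rw [e]
    intro l
    rw [map_sub, map_smul, hS, smul_smul, smul_smul]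
    by_cases hl : l ∈ F
    · have h3 : coeffL ω H l y = 0 := by
        have := coeffL_projF hω F l y
        rwa [hPy, map_zero, if_pos hl, eq_comm] at this
      rw [h3, smul_zero, smul_zero, sub_zero]
    · have h3 : z * s l = 1 + lam ω l * s l := by linear_combination h1 l hl
      rw [h3, add_smul, one_smul, add_sub_cancel_left]
  · set y' := y - projF ω H F y
    have hg := (pert A).graph.sub_mem hy (projF_mem_graph_pert hω hA hy)
    have hg' : (y', f - projF ω H F f + A y') ∈ derivGraph ω H := mem_graph_pert_iff.1 hg
    rw [mem_derivGraph_iff hω] at hg'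
    set w := z • y' - (f - projF ω H F f + A y')
    have hSw : S w = y' := by
      refine ext_coeffL hω fun l => ?_
      rw [hS, map_sub, map_smul, hg', ← sub_smul, smul_smul]
      by_cases hl : l ∈ F
      · rw [h0 l hl, zero_mul, zero_smul, map_sub, coeffL_projF hω, if_pos hl, sub_self]
      · rw [h1 l hl, one_smul]
    have e : z • y - f - projF ω H F (z • y - f) = w + A (S w) := by
      rw [hSw, map_sub (projF ω H F), map_smul]
      simp only [w, y', smul_sub]
      abel
    change S ((↑u⁻¹ : L2 ω H →L[ℂ] L2 ω H) (z • y - f - projF ω H F (z • y - f))) = y'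
    rw [e]
    exact (congrArg S (hu' w).2).trans hSw

/-- The inverses on `F` and off `F` add up to a full resolvent, since `A` commutes with the block
projection. -/
theorem IsBlockSpectrum.mem_resSet (hω : 0 < ω) {A : L2 ω H →L[ℂ] L2 ω H} {F : Finset ℤ} {σ : Set ℂ}
    (hb : IsBlockSpectrum A F σ) {z : ℂ} (hz : z ∉ σ) {s : ℤ → ℂ}
    {S : L2 ω H →L[ℂ] L2 ω H} (hS : ∀ j x, coeffL ω H j (S x) = s j • coeffL ω H j x)
    (h0 : ∀ l ∈ F, s l = 0) (h1 : ∀ l ∉ F, s l * (z - lam ω l) = 1) (hlt : ‖A * S‖ < 1) :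
    z ∈ resSet (pert A) := by
  obtain ⟨R₁, h2, h3⟩ := exists_resolvent_on_block hω hb hz
  obtain ⟨_, _, _, _, hA, _⟩ := hb
  obtain ⟨R₂, h4, h5⟩ := exists_resolvent_off_block hω hA hS h0 h1 hlt
  refine ⟨R₁ + R₂, isResolventAt_iff.2 ⟨fun x => ?_, fun y f hy => ?_⟩⟩
  · have := (pert A).graph.add_mem (h2 x) (h4 x)
    convert this using 1
    refine Prod.ext rfl ?_
    change z • (R₁ x + R₂ x) - x = z • R₁ x - projF ω H F x + (z • R₂ x - (x - projF ω H F x))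
    rw [smul_add]
    abel
  · change R₁ (z • y - f) + R₂ (z • y - f) = y
    rw [h3 y f hy, h5 y f hy, add_sub_cancel]

end BlockResolvent

/-! ### Localisation of block spectra and existence of Riesz projections -/

section Existence

variable {H : Type*} [NormedAddCommGroup H] [InnerProductSpace ℂ H] [CompleteSpace H] {ω : ℝ}

/-- Here `S` inverts `z - L₀` on the modes in `F`, and `S (I + A S)⁻¹` restricts to an inverse of `z
- B` on the block. -/
theorem IsBlockSpectrum.notMem (hω : 0 < ω) {A : L2 ω H →L[ℂ] L2 ω H} {F : Finset ℤ} {σ : Set ℂ}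
    (hb : IsBlockSpectrum A F σ) {z : ℂ} {s : ℤ → ℂ}
    {S : L2 ω H →L[ℂ] L2 ω H} (hS : ∀ j x, coeffL ω H j (S x) = s j • coeffL ω H j x)
    (h0 : ∀ l ∉ F, s l = 0) (h1 : ∀ l ∈ F, s l * (z - lam ω l) = 1) (hlt : ‖A * S‖ < 1) :
    z ∉ σ := by
  obtain ⟨K, B, hK, hB, hA, rfl⟩ := hb
  obtain ⟨u, hu⟩ := isUnit_one_add_of_norm_lt_one hlt
  have hu' := unit_inv_apply hu
  have hSP : ∀ x, projF ω H F (S x) = S x := fun x => by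
    refine ext_coeffL hω fun l => ?_
    rw [coeffL_projF hω]
    split_ifs with hl
    · rfl
    · rw [hS, h0 l hl, zero_smul]
  have hAS : ∀ x, projF ω H F (A (S x)) = A (S x) := fun x => by rw [← hA, hSP]
  have hSK : ∀ x, S x ∈ K := fun x => (hK _).2 (hSP x)
  let r : K →L[ℂ] K :=
    (S ∘L (↑u⁻¹ : L2 ω H →L[ℂ] L2 ω H) ∘L K.subtypeL).codRestrict K fun x => hSK _
  have hr1 : ∀ x : K, z • (r x : L2 ω H) - (B (r x) : L2 ω H) = x := fun x => by
    rw [hB]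
    change z • S ((↑u⁻¹ : L2 ω H →L[ℂ] L2 ω H) x) - (diagF ω H F (S ((↑u⁻¹ : L2 ω H →L[ℂ] L2 ω H) x))
      - A (S ((↑u⁻¹ : L2 ω H →L[ℂ] L2 ω H) x))) = x
    set y := (↑u⁻¹ : L2 ω H →L[ℂ] L2 ω H) x
    have hy : y + A (S y) = x := (hu' _).1
    have hyP : projF ω H F y = y := by
      have h2 := congrArg (projF ω H F) hy
      rw [map_add, hAS, (hK _).1 x.2, ← hy] at h2
      exact add_right_cancel h2
    have h3 : z • S y - diagF ω H F (S y) = y := by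
      rw [← hyP]
      refine ext_coeffL hω fun l => ?_
      rw [hyP, map_sub, map_smul, coeffL_diagF hω, hS]
      split_ifs with hl
      · rw [smul_smul, smul_smul, ← sub_smul, ← sub_mul, mul_comm, h1 l hl, one_smul]
      · rw [h0 l hl, zero_smul, smul_zero, sub_zero, ← hyP, coeffL_projF hω, if_neg hl]
    rw [← sub_add, h3, hy]
  have hr2 : ∀ x : K, S ((↑u⁻¹ : L2 ω H →L[ℂ] L2 ω H) (z • (x : L2 ω H) - (B x : L2 ω H))) = x := by
    intro x
    have hx := (hK _).1 x.2
    have hw : S (z • (x : L2 ω H) - diagF ω H F x) = x := by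
      refine ext_coeffL hω fun l => ?_
      rw [hS, map_sub, map_smul, coeffL_diagF hω]
      split_ifs with hl
      · rw [← sub_smul, smul_smul, h1 l hl, one_smul]
      · rw [h0 l hl, zero_smul, ← hx, coeffL_projF hω, if_neg hl]
    have e : z • (x : L2 ω H) - (B x : L2 ω H) = (z • (x : L2 ω H) - diagF ω H F x) +
        A (S (z • (x : L2 ω H) - diagF ω H F x)) := by
      rw [hw, hB]
      abel
    rw [e]
    exact (congrArg S (hu' _).2).trans hw
  refine not_not.2 ?_
  have hu1 : (algebraMap ℂ (K →L[ℂ] K) z - B) * r = 1 := by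
    ext1 x; exact Subtype.ext (hr1 x)
  have hu2 : r * (algebraMap ℂ (K →L[ℂ] K) z - B) = 1 := by
    ext1 x; exact Subtype.ext (hr2 x)
  exact (⟨_, r, hu1, hu2⟩ : (K →L[ℂ] K)ˣ).isUnit

/-- A diagonal `S` of size `C` need not make `A S` small. The columns of `A` beyond `m` have norm
below `1/(2C)`, and on the remaining modes smallness of the symbol is demanded; each part
contributes at most one half. -/
theorem exists_norm_mul_lt_one (hω : 0 < ω) {A : L2 ω H →L[ℂ] L2 ω H} (hA : MemHS A) {C : ℝ}
    (hC : 0 < C) : ∃ (m : ℕ) (δ : ℝ), 0 < δ ∧ ∀ s : ℤ → ℂ, (∀ l, ‖s l‖ ≤ C) →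
      (∀ l ∈ sym m, ‖s l‖ ≤ δ) → ∃ S : L2 ω H →L[ℂ] L2 ω H,
        (∀ j x, coeffL ω H j (S x) = s j • coeffL ω H j x) ∧ ‖A * S‖ < 1 := by
  obtain ⟨a, rfl⟩ := hA.exists_op hω
  have h1 := tendsto_norm_cut (f := atTop) (fun m : ℕ => {p : ℤ × ℤ | p.2 ∈ sym m}ᶜ) (fun p => by
    filter_upwards [eventually_mem_sym p.2] with m hm
    exact not_not.2 hm) a
  obtain ⟨m, hm⟩ := (h1.eventually (gt_mem_nhds (by positivity : 0 < (2 * C)⁻¹))).exists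
  refine ⟨m, (2 * (‖a‖ + 1))⁻¹, by positivity, fun s hs1 hs2 => ?_⟩
  obtain ⟨S, hS, hSn⟩ := exists_diagonal (H := H) hω s hC.le hs1
  refine ⟨S, hS, ?_⟩
  have hP : ‖projF ω H (sym m) * S‖ ≤ (2 * (‖a‖ + 1))⁻¹ := by
    refine ContinuousLinearMap.opNorm_le_bound _ (by positivity) fun x => ?_
    refine norm_le_of_coeffL hω (by positivity) fun l => ?_
    change ‖coeffL ω H l (projF ω H (sym m) (S x))‖ ≤ _
    rw [coeffL_projF hω]
    split_ifs with hl
    · rw [hS, norm_smul]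
      gcongr
      exact hs2 l hl
    · rw [norm_zero]; positivity
  have e : hsOp hω a * S = hsOp hω a * (projF ω H (sym m) * S) +
      hsOp hω (cut {p : ℤ × ℤ | p.2 ∈ sym m}ᶜ a) * S := by
    rw [← mul_assoc, ← add_mul]
    congr 1
    change _ = hsOp hω a ∘L projF ω H (sym m) + _
    rw [op_comp_projF, ← map_add, cut_add_cut_compl]
  rw [e]
  have h2 : ‖hsOp hω a * (projF ω H (sym m) * S)‖ ≤ ‖a‖ * (2 * (‖a‖ + 1))⁻¹ :=
    (norm_mul_le _ _).trans (by gcongr; exact norm_op_le hω a)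
  have h3 : ‖hsOp hω (cut {p : ℤ × ℤ | p.2 ∈ sym m}ᶜ a) * S‖ ≤
      ‖cut {p : ℤ × ℤ | p.2 ∈ sym m}ᶜ a‖ * C :=
    (norm_mul_le _ _).trans (by gcongr; exact norm_op_le hω _)
  have h4 : ‖cut {p : ℤ × ℤ | p.2 ∈ sym m}ᶜ a‖ * C < 1 / 2 := by
    calc ‖cut {p : ℤ × ℤ | p.2 ∈ sym m}ᶜ a‖ * C < (2 * C)⁻¹ * C := by gcongr
      _ = 1 / 2 := by field_simp
  have h5 : ‖a‖ * (2 * (‖a‖ + 1))⁻¹ ≤ 1 / 2 := by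
    rw [← div_eq_mul_inv, div_le_iff₀ (by positivity)]
    linarith
  linarith [norm_add_le (hsOp hω a * (projF ω H (sym m) * S))
    (hsOp hω (cut {p : ℤ × ℤ | p.2 ∈ sym m}ᶜ a) * S)]

-- The previous estimate for the symbol `(z - λ_l)⁻¹` on `G`: a uniform distance `r` from all `λ_l`
-- with `l ∈ G` suffices, except for the finitely many low modes, which must be at distance `M`.
-- Both `m` and `M` are independent of `z` and `G`.
open Classical in
theorem exists_partial_inverse (hω : 0 < ω) {A : L2 ω H →L[ℂ] L2 ω H} (hA : MemHS A) {r : ℝ}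
    (hr : 0 < r) : ∃ (m : ℕ) (M : ℝ), 0 < M ∧ ∀ (z : ℂ) (G : Set ℤ),
      (∀ l ∈ G, r ≤ ‖z - lam ω l‖) → (∀ l ∈ G, l ∈ sym m → M ≤ ‖z - lam ω l‖) →
      ∃ (s : ℤ → ℂ) (S : L2 ω H →L[ℂ] L2 ω H),
        (∀ j x, coeffL ω H j (S x) = s j • coeffL ω H j x) ∧ (∀ l ∉ G, s l = 0) ∧
        (∀ l ∈ G, s l * (z - lam ω l) = 1) ∧ ‖A * S‖ < 1 := by
  obtain ⟨m, δ, hδ, h⟩ := exists_norm_mul_lt_one hω hA (inv_pos.2 hr)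
  refine ⟨m, δ⁻¹, inv_pos.2 hδ, fun z G h1 h2 => ?_⟩
  set s : ℤ → ℂ := fun l => if l ∈ G then (z - lam ω l)⁻¹ else 0 with hs
  have hs1 : ∀ l, ‖s l‖ ≤ r⁻¹ := fun l => by
    simp only [hs]
    split_ifs with hl
    · rw [norm_inv]
      exact inv_anti₀ hr (h1 l hl)
    · rw [norm_zero]; positivity
  have hs2 : ∀ l ∈ sym m, ‖s l‖ ≤ δ := fun l hl => by
    simp only [hs]
    split_ifs with hl'
    · rw [norm_inv]
      exact inv_le_of_inv_le₀ hδ (h2 l hl' hl)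
    · rw [norm_zero]; positivity
  obtain ⟨S, hS, hlt⟩ := h s hs1 hs2
  refine ⟨s, S, hS, fun l hl => if_neg hl, fun l hl => ?_, hlt⟩
  simp only [hs, if_pos hl]
  exact inv_mul_cancel₀ (norm_pos_iff.1 (hr.trans_le (h1 l hl)))

theorem exists_spectral_gap (hω : 0 < ω) {A : L2 ω H →L[ℂ] L2 ω H} (hA : MemHS A) :
    ∃ r > 0, (∀ l, ‖lam ω l‖ = 4 * r * |(l : ℝ)|) ∧ ∃ k₀ : ℕ, ∀ k ≥ k₀,
      (∀ σ, IsBlockSpectrum A (sym k) σ → σ ⊆ Metric.ball 0 (4 * r * k + r) ∧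
        ∀ z ∈ Metric.closedBall 0 (4 * r * k + 2 * r), z ∉ σ → z ∈ resSet (pert A)) ∧
      ∀ l : ℤ, (k : ℤ) < |l| → ∀ σ, IsBlockSpectrum A {l} σ → σ ⊆ Metric.ball (lam ω l) r ∧
        ∀ z ∈ Metric.closedBall (lam ω l) (2 * r), z ∉ σ → z ∈ resSet (pert A) := by
  -- The eigenvalues `λ_l` have spacing `2π/ω = 4r`. Discs of radius `r` about them are disjoint,
  -- and circles of radius `2r` stay at distance at least `2r` from every other eigenvalue.
  set r := Real.pi / (2 * ω) with hr
  have hr0 : 0 < r := by positivity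
  have hlam : ∀ l, ‖lam ω l‖ = 4 * r * |(l : ℝ)| := fun l => by
    rw [norm_lam hω, hr]
    field_simp
    ring
  obtain ⟨m, M, hM, h⟩ := exists_partial_inverse hω hA hr0
  obtain ⟨N, hN⟩ := exists_nat_gt (M / (4 * r))
  have hN' : M ≤ 4 * r * N := by
    rw [div_lt_iff₀ (by positivity)] at hN
    linarith
  have habs : ∀ {l : ℤ} {k : ℕ}, (k : ℤ) < |l| → (k : ℝ) + 1 ≤ |(l : ℝ)| := fun {l k} hl => by
    have : (k : ℤ) + 1 ≤ |l| := hl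
    exact_mod_cast this
  have hsym : ∀ {l : ℤ} {k : ℕ}, l ∈ sym k → |(l : ℝ)| ≤ k := fun {l k} hl => by
    rw [mem_sym] at hl
    exact_mod_cast hl
  have htri : ∀ (z : ℂ) (l : ℤ), ‖z‖ - 4 * r * |(l : ℝ)| ≤ ‖z - lam ω l‖ ∧
      4 * r * |(l : ℝ)| - ‖z‖ ≤ ‖z - lam ω l‖ := fun z l => by
    rw [← hlam]
    exact ⟨norm_sub_norm_le _ _, by rw [norm_sub_rev]; exact norm_sub_norm_le _ _⟩
  -- With `k ≥ m + N` the low modes `|l| ≤ m` are separated from the relevant `z` by at least `4r(k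
  -- - m) ≥ 4rN ≥ M`, or belong to the central block when its complement is considered.
  refine ⟨r, hr0, hlam, m + N, fun k hk => ⟨fun σ hb => ⟨fun z hz => ?_, fun z hz hzσ => ?_⟩,
    fun l hl σ hb => ⟨fun z hz => ?_, fun z hz hzσ => ?_⟩⟩⟩
  all_goals have hk' : (m : ℝ) + N ≤ k := by exact_mod_cast hk
  all_goals have hkm : M ≤ 4 * r * (k - m) := hN'.trans (by gcongr; linarith)
  · by_contra hz'
    rw [Metric.mem_ball, dist_zero_right, not_lt] at hz'
    obtain ⟨s, S, hS, h0, h1, hlt⟩ := h z (sym k)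
      (fun l hl => by
        have := mul_le_mul_of_nonneg_left (hsym hl) (by positivity : 0 ≤ 4 * r)
        linarith [(htri z l).1])
      (fun l _ hl => by
        have := mul_le_mul_of_nonneg_left (hsym hl) (by positivity : 0 ≤ 4 * r)
        linarith [(htri z l).1])
    exact hb.notMem hω hS h0 h1 hlt hz
  · rw [Metric.mem_closedBall, dist_zero_right] at hz
    obtain ⟨s, S, hS, h0, h1, hlt⟩ := h z (sym k : Set ℤ)ᶜ
      (fun l hl => by
        have hl' : (k : ℤ) < |l| := by
          by_contra h'
          exact hl (mem_sym.2 (not_lt.1 h'))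
        have := mul_le_mul_of_nonneg_left (habs hl') (by positivity : 0 ≤ 4 * r)
        linarith [(htri z l).2])
      (fun l hl hl' => by
        refine absurd (mem_sym.2 ?_) hl
        have := mem_sym.1 hl'
        omega)
    exact hb.mem_resSet hω hzσ hS (fun l hl => h0 l (not_not.2 hl)) h1 hlt
  · by_contra hz'
    rw [Metric.mem_ball, dist_eq_norm, not_lt] at hz'
    obtain ⟨s, S, hS, h0, h1, hlt⟩ := h z ({l} : Finset ℤ)
      (fun j hj => by
        obtain rfl := Finset.mem_singleton.1 hj
        exact hz')
      (fun j hj hj' => by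
        obtain rfl := Finset.mem_singleton.1 hj
        have := mem_sym.1 hj'
        omega)
    exact hb.notMem hω hS h0 h1 hlt hz
  · rw [Metric.mem_closedBall, dist_eq_norm] at hz
    have hdist : ∀ j : ℤ, 4 * r * |((l - j : ℤ) : ℝ)| - 2 * r ≤ ‖z - lam ω j‖ := fun j => by
      have h2 : lam ω (l - j) = (z - lam ω j) - (z - lam ω l) := by rw [← lam_sub]; ring
      have h3 := norm_sub_le (z - lam ω j) (z - lam ω l)
      rw [← h2, hlam] at h3
      linarith
    obtain ⟨s, S, hS, h0, h1, hlt⟩ := h z (({l} : Finset ℤ) : Set ℤ)ᶜ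
      (fun j hj => by
        have h2 : ((0 : ℕ) : ℤ) < |l - j| := by
          have : l ≠ j := fun h => hj (by simp [h])
          simpa [sub_eq_zero] using this
        have h3 := mul_le_mul_of_nonneg_left (habs h2) (by positivity : 0 ≤ 4 * r)
        rw [Nat.cast_zero, zero_add] at h3
        linarith [hdist j])
      (fun j hj hj' => by
        have h2 : (k : ℝ) + 1 - m ≤ |((l - j : ℤ) : ℝ)| := by
          push_cast
          linarith [habs hl, hsym hj', abs_sub_abs_le_abs_sub (l : ℝ) j]
        have := mul_le_mul_of_nonneg_left h2 (by positivity : 0 ≤ 4 * r)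
        linarith [hdist j])
    exact hb.mem_resSet hω hzσ hS (fun l hl => h0 l (not_not.2 hl)) h1 hlt

namespace Reduction

variable {V : Potential ω H} {k : ℕ} {U : L2 ω H ≃L[ℂ] L2 ω H} {V₀ : L2 ω H →L[ℂ] L2 ω H}

/-- Merging one-mode blocks into the central one preserves invariance; this is the freedom used to
achieve separation. -/
theorem mono (hω : 0 < ω) (hR : Reduction V k U V₀) {k' : ℕ} (hk : k ≤ k') :
    Reduction V k' U V₀ := by
  refine ⟨hR.memHS_W, hR.memHS_V₀, hR.similar, fun x hx => ?_, fun l hl => hR.invariant l (by omega)⟩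
  rw [projLow_eq, mem_range_projF_iff hω] at hx ⊢
  have h1 := projF_sym_max (ω := ω) (H := H) k k'
  rw [max_eq_right hk] at h1
  have h2 : V₀ (projF ω H (sym k') x) = projF ω H (sym k') (V₀ x) := by
    rw [h1, add_apply, add_apply, sum_apply, sum_apply, map_add, map_sum,
      hR.commute_projF hω (Or.inl rfl)]
    congr 1
    refine Finset.sum_congr rfl fun l hl => ?_
    rw [proj_eq, hR.commute_projF hω (Or.inr ⟨l, rfl, (Finset.mem_filter.1 hl).2⟩)]
  rw [← h2, hx]

theorem isRieszProjection_opL (hR : Reduction V k U V₀) {σ : Set ℂ}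
    (h : ∃ Q, IsRieszProjection (pert V₀) σ Q) : ∃ Q, IsRieszProjection (opL V) σ Q := by
  obtain ⟨Q, hQ⟩ := h
  exact ⟨_, hQ.conj fun x f => hR.similar.mem_graph⟩

open Classical in
theorem exists_separated (hω : 0 < ω) (hR : Reduction V k U V₀) :
    ∃ (k' : ℕ) (hR' : Reduction V k' U V₀), hR'.Separated ∧
      ∃ Qlow Q, hR'.AreSpectralProjections Qlow Q := by
  obtain ⟨r, hr, hlam, k₀, h⟩ := exists_spectral_gap hω hR.memHS_V₀
  have hR' := hR.mono hω (le_max_left k k₀)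
  set k' := max k k₀
  obtain ⟨hlow, hsingle⟩ := h k' (le_max_right k k₀)
  obtain ⟨h1, h2⟩ := hlow _ (hR'.isBlockSpectrum_low hω)
  have h3 := fun l hl => hsingle l hl _ (hR'.isBlockSpectrum hω l hl)
  refine ⟨k', hR', ⟨fun l hl => ?_, fun l hl l' hl' hne => ?_⟩, ?_⟩
  · refine Set.disjoint_of_subset h1 (h3 l hl).1 (Metric.ball_disjoint_ball ?_)
    have h4 : (k' : ℝ) + 1 ≤ |(l : ℝ)| := by
      have : (k' : ℤ) + 1 ≤ |l| := hl
      exact_mod_cast this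
    rw [dist_zero_left, hlam]
    have := mul_le_mul_of_nonneg_left h4 (by positivity : 0 ≤ 4 * r)
    linarith
  · refine Set.disjoint_of_subset (h3 l hl).1 (h3 l' hl').1 (Metric.ball_disjoint_ball ?_)
    have h4 : (1 : ℝ) ≤ |((l - l' : ℤ) : ℝ)| := by
      have : 1 ≤ |l - l'| := Int.one_le_abs (sub_ne_zero.2 hne)
      exact_mod_cast this
    rw [dist_eq_norm, lam_sub, hlam]
    have := mul_le_mul_of_nonneg_left h4 (by positivity : 0 ≤ 4 * r)
    linarith
  · obtain ⟨Qlow, hQlow⟩ := hR'.isRieszProjection_opL (exists_isRieszProjection (by positivity)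
      (h1.trans (Metric.ball_subset_ball (by linarith))) h2)
    have hQ : ∀ l hl, ∃ Q, IsRieszProjection (opL V) (hR'.sigma l hl) Q := fun l hl =>
      hR'.isRieszProjection_opL (exists_isRieszProjection (by positivity)
        ((h3 l hl).1.trans (Metric.ball_subset_ball (by linarith))) (h3 l hl).2)
    choose Q hQ using hQ
    -- The value for `|l| ≤ k'` is irrelevant: the indexed projections are constrained only for `|l|
    -- > k'`.
    refine ⟨Qlow, fun l => if hl : (k' : ℤ) < |l| then Q l hl else 0, hQlow, fun l hl => ?_⟩
    simp only [dif_pos hl]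
    exact hQ l hl

end Reduction

end Existence

end InvolutionOperator

end

theorem theorem2p7 {H : Type*} [NormedAddCommGroup H] [InnerProductSpace ℂ H] [CompleteSpace H]
    (ω : ℝ) (hω : 0 < ω) (V : Potential ω H) (hV : V.Admissible) :
    (∃ (k : ℕ) (U : L2 ω H ≃L[ℂ] L2 ω H) (V₀ : L2 ω H →L[ℂ] L2 ω H) (hR : Reduction V k U V₀),
      hR.Separated ∧ ∃ Qlow Q, hR.AreSpectralProjections Qlow Q) ∧
    ∀ (k : ℕ) (U : L2 ω H ≃L[ℂ] L2 ω H) (V₀ : L2 ω H →L[ℂ] L2 ω H) (hR : Reduction V k U V₀),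
      hR.Separated →
      ∀ (Qlow : L2 ω H →L[ℂ] L2 ω H) (Q : ℤ → L2 ω H →L[ℂ] L2 ω H),
        hR.AreSpectralProjections Qlow Q →
        (∀ n : ℕ, MemHS (partialSumDiff k Qlow Q n)) ∧
          Tendsto (fun n : ℕ => hsNorm (partialSumDiff k Qlow Q n)) atTop (𝓝 0) := by
  refine ⟨?_, fun k U V₀ hR hS Qlow Q hQ => hR.tendsto_partialSumDiff hω hS hQ⟩
  obtain ⟨k, U, V₀, hR⟩ := exists_reduction hω V hV
  obtain ⟨k', hR', h⟩ := hR.exists_separated hω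
  exact ⟨k', U, V₀, hR', h⟩
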